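/- Let $\alpha\in\mathbb{R}$, $B_0>0$, $A_B(x)=\alpha\,\frac{(-x_2,x_1)}{|x|^2}$, $A_{\mathrm{hmf}}(x)=\frac{B_0}{2}(-x_2,x_1)$, and let $H_{\alpha,B_0}=-(\nabla+i(A_B+A_{\mathrm{hmf}}))^2$ be the Friedrichs extension on $L^2(\mathbb{R}^2;\mathbb{C})$, i.e. the operator associated with the closure of the quadratic form $\int_{\mathbb{R}^2}|(\nabla+i(A_B+A_{\mathrm{hmf}}))f|^2\,dx$ on $C_c^\infty(\mathbb{R}^2\setminus\{0\};\mathbb{C})$. Then $-H_{\alpha,B_0}$ generates a strongly continuous semigroup $(e^{-tH_{\alpha,B_0}})_{t\ge0}$ on $L^2(\mathbb{R}^2)$; for every $f\in L^2(\mathbb{R}^2)$ the heat equation $$\partial_t u+H_{\alpha,B_0}u=0\quad(t>0),\qquad u(0,\cdot)=f,$$ has exactly one solution $u$ (continuous $[0,\infty)\to L^2$, and for $t>0$ differentiable with $u(t)$ in the domain of $H_{\alpha,B_0}$), and for $t>0$ and a.e. $x$ $$u(t,x)=(e^{-tH_{\alpha,B_0}}f)(x)=\int_{\mathbb{R}^2}K_H(t;x,y)f(y)\,dy$$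 with an absolutely convergent integral. For $x=r_1(\cos\theta_1,\sin\theta_1)$, $y=r_2(\cos\theta_2,\sin\theta_2)$ with $r_1,r_2>0$ the kernel is $$K_H(t;x,y)=\frac{B_0e^{-\alpha tB_0}}{4\pi\sinh (tB_0)}\,e^{-\frac{B_0(r_1^2+r_2^2)\cosh (tB_0)}{4\sinh (tB_0)}}\sum_{k\in\mathbb{Z}}e^{ik(\theta_1-\theta_2+itB_0)}\,I_{|k+\alpha|}\!\left(\frac{B_0r_1r_2}{2\sinh (tB_0)}\right),$$ where $I_\nu$ is the modified Bessel function of the first kind and the series converges absolutely. (If $x$ or $y$ is the origin, $K_H$ is defined by the same formula with the polar angle of the origin taken to be $0$.) Furthermore, there is an absolute constant $C>0$ such that for all $\alpha\le 1$, $B_0>0$, $t>0$ and $x,y\in\mathbb{R}^2$, with $r_1=|x|$, $r_2=|y|$, $$|K_H(t;x,y)|\le C\,\frac{B_0e^{(1-\alpha)B_0t}}{\sinh (tB_0)}\,e^{-\frac{B_0(r_1-r_2)^2}{4\tanh (tB_0)}}.$$ -/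

import Mathlib

open MeasureTheory Filter Topology
open scoped ContDiff

noncomputable section

/-- The Euclidean plane. -/
abbrev Plane : Type := EuclideanSpace ℝ (Fin 2)

/-- The Hilbert space `L²(ℝ²; ℂ)`. -/
abbrev L2Plane : Type := Lp ℂ 2 (volume : Measure Plane)

/-- The point with polar coordinates `(r, θ)`. -/
def polarPoint (r θ : ℝ) : Plane := !₂[r * Real.cos θ, r * Real.sin θ]

/-- The argument in `(-π, π]` of a point of the plane (and `0` at the origin). -/
def planeArg (x : Plane) : ℝ := Complex.arg ⟨x 0, x 1⟩

/-! ### The magnetic Schrödinger operator -/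

/-- The Aharonov-Bohm potential `α (-x₂, x₁) / |x|²`. -/
def abPotential (α : ℝ) (x : Plane) : Fin 2 → ℝ :=
  ![α * (-(x 1) / ‖x‖ ^ 2), α * (x 0 / ‖x‖ ^ 2)]

/-- The potential `(B₀ / 2) (-x₂, x₁)` of the homogeneous magnetic field. -/
def hmfPotential (B₀ : ℝ) (x : Plane) : Fin 2 → ℝ :=
  ![B₀ / 2 * (-(x 1)), B₀ / 2 * x 0]

/-- The `j`-th component of `∇φ + i (A_B + A_hmf) φ`. -/
def covDeriv (α B₀ : ℝ) (j : Fin 2) (φ : Plane → ℂ) (x : Plane) : ℂ :=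
  fderiv ℝ φ x (EuclideanSpace.single j 1) +
    Complex.I * ((abPotential α x j + hmfPotential B₀ x j : ℝ) : ℂ) * φ x

/-- Membership in `C_c^∞(ℝ² \ {0}; ℂ)`. -/
structure IsTestFun (φ : Plane → ℂ) : Prop where
  smooth : ContDiff ℝ ∞ φ
  compact : HasCompactSupport φ
  zero_notMem : (0 : Plane) ∉ tsupport φ

theorem IsTestFun.differentiable {φ : Plane → ℂ} (h : IsTestFun φ) : Differentiable ℝ φ :=
  h.smooth.differentiable (by simp)

theorem isTestFun_zero : IsTestFun (fun _ => (0 : ℂ)) where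
  smooth := contDiff_const
  compact := HasCompactSupport.zero
  zero_notMem := by simp [tsupport, Function.support]

theorem IsTestFun.add {φ ψ : Plane → ℂ} (h : IsTestFun φ) (k : IsTestFun ψ) :
    IsTestFun (fun x => φ x + ψ x) where
  smooth := h.smooth.add k.smooth
  compact := h.compact.add k.compact
  zero_notMem := fun hx => (tsupport_add φ ψ hx).elim h.zero_notMem k.zero_notMem

theorem IsTestFun.const_mul {φ : Plane → ℂ} (c : ℂ) (h : IsTestFun φ) :
    IsTestFun (fun x => c * φ x) where
  smooth := contDiff_const.mul h.smooth
  compact := h.compact.mul_left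
  zero_notMem := fun hx => h.zero_notMem (tsupport_mul_subset_right (f := fun _ => c) hx)

/-- The graph of the covariant gradient `φ ↦ ∇φ + i (A_B + A_hmf) φ` on `C_c^∞(ℝ² \ {0})`,
as a subspace of `L² × (L²)²`. -/
def testGraph (α B₀ : ℝ) : Submodule ℂ (L2Plane × (Fin 2 → L2Plane)) where
  carrier := {p | ∃ φ : Plane → ℂ, IsTestFun φ ∧ p.1 =ᵐ[volume] φ ∧
    ∀ j, p.2 j =ᵐ[volume] covDeriv α B₀ j φ}
  add_mem' := by
    rintro p q ⟨φ, hφ, hp, hp'⟩ ⟨ψ, hψ, hq, hq'⟩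
    refine ⟨fun x => φ x + ψ x, hφ.add hψ, ?_, fun j => ?_⟩
    · filter_upwards [Lp.coeFn_add p.1 q.1, hp, hq] with x h1 h2 h3
      simp only [Prod.fst_add, Pi.add_apply] at h1 ⊢
      rw [h1, h2, h3]
    · filter_upwards [Lp.coeFn_add (p.2 j) (q.2 j), hp' j, hq' j] with x h1 h2 h3
      simp only [Prod.snd_add, Pi.add_apply] at h1 ⊢
      rw [h1, h2, h3]
      simp only [covDeriv]
      rw [fderiv_fun_add (hφ.differentiable x) (hψ.differentiable x)]
      simp only [add_apply]
      ring
  zero_mem' := by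
    refine ⟨fun _ => 0, isTestFun_zero, ?_, fun j => ?_⟩
    · exact Lp.coeFn_zero _ _ _
    · filter_upwards [Lp.coeFn_zero ℂ 2 (volume : Measure Plane)] with x h1
      simp [covDeriv]
  smul_mem' := by
    rintro c p ⟨φ, hφ, hp, hp'⟩
    refine ⟨fun x => c * φ x, hφ.const_mul c, ?_, fun j => ?_⟩
    · filter_upwards [Lp.coeFn_smul c p.1, hp] with x h1 h2
      simp [h1, h2]
    · filter_upwards [Lp.coeFn_smul c (p.2 j), hp' j] with x h1 h2
      simp only [Prod.smul_snd, Pi.smul_apply, smul_eq_mul] at h1 ⊢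
      rw [h1, h2]
      simp only [covDeriv]
      rw [fderiv_const_mul (hφ.differentiable x)]
      simp only [smul_apply, smul_eq_mul]
      ring

/-- The closure of the covariant gradient. Its elements are the pairs `(u, G)` with `u` in the
form domain, the completion of `C_c^∞(ℝ² \ {0})` in the form norm, and `G` the covariant
gradient of `u`. -/
def formGraph (α B₀ : ℝ) : Submodule ℂ (L2Plane × (Fin 2 → L2Plane)) :=
  (testGraph α B₀).topologicalClosure

/-- The graph of the operator associated with the closed quadratic form
`Q(u) = ∫ |∇u + i (A_B + A_hmf) u|²`: it holds `(u, g)` if and only if `u` is in the form domain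
and `Q(v, u) = ⟪v, g⟫` for all `v` in the form domain. -/
def hamiltonianGraph (α B₀ : ℝ) : Submodule ℂ (L2Plane × L2Plane) where
  carrier := {p | ∃ G : Fin 2 → L2Plane, (p.1, G) ∈ formGraph α B₀ ∧
    ∀ q ∈ formGraph α B₀, ∑ j, inner ℂ (q.2 j) (G j) = inner ℂ q.1 p.2}
  add_mem' := by
    rintro p q ⟨G, hG, hp⟩ ⟨F, hF, hq⟩
    refine ⟨G + F, (formGraph α B₀).add_mem hG hF, fun r hr => ?_⟩
    simp only [Pi.add_apply, inner_add_right, Finset.sum_add_distrib, Prod.snd_add, hp r hr,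
      hq r hr]
  zero_mem' := ⟨0, (formGraph α B₀).zero_mem, fun r _ => by simp⟩
  smul_mem' := by
    rintro c p ⟨G, hG, hp⟩
    refine ⟨c • G, (formGraph α B₀).smul_mem c hG, fun r hr => ?_⟩
    simp only [Pi.smul_apply, inner_smul_right, ← Finset.mul_sum, Prod.smul_snd, hp r hr]

theorem tsupport_covDeriv_subset (α B₀ : ℝ) (j : Fin 2) (φ : Plane → ℂ) :
    tsupport (covDeriv α B₀ j φ) ⊆ tsupport φ := by
  refine closure_minimal (fun x hx => ?_) (isClosed_tsupport φ)
  by_contra h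
  apply hx
  have h1 : fderiv ℝ φ x = 0 := by
    by_contra h2
    exact h (support_fderiv_subset ℝ h2)
  simp [covDeriv, h1, image_eq_zero_of_notMem_tsupport h]

theorem contDiffAt_potential (α B₀ : ℝ) (j : Fin 2) {x : Plane} (hx : x ≠ 0) :
    ContDiffAt ℝ ∞ (fun y => abPotential α y j + hmfPotential B₀ y j) x := by
  have h0 : ContDiffAt ℝ ∞ (fun y : Plane => y 0) x := by fun_prop
  have h1 : ContDiffAt ℝ ∞ (fun y : Plane => y 1) x := by fun_prop
  have h2 : ContDiffAt ℝ ∞ (fun y : Plane => ‖y‖ ^ 2) x := contDiffAt_id.norm_sq ℝ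
  have h3 : ‖x‖ ^ 2 ≠ 0 := by positivity
  fin_cases j
  · exact (contDiffAt_const.mul (h1.neg.div h2 h3)).add (contDiffAt_const.mul h1.neg)
  · exact (contDiffAt_const.mul (h0.div h2 h3)).add (contDiffAt_const.mul h0)

theorem IsTestFun.covDeriv {φ : Plane → ℂ} (h : IsTestFun φ) (α B₀ : ℝ) (j : Fin 2) :
    IsTestFun (covDeriv α B₀ j φ) where
  compact := h.compact.mono' ((subset_tsupport _).trans (tsupport_covDeriv_subset α B₀ j φ))
  zero_notMem := fun hx => h.zero_notMem (tsupport_covDeriv_subset α B₀ j φ hx)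
  smooth := by
    rw [contDiff_iff_contDiffAt]
    intro x
    by_cases hx : x ∈ tsupport φ
    · have hx0 : x ≠ 0 := fun h0 => h.zero_notMem (h0 ▸ hx)
      have h1 : ContDiffAt ℝ ∞ (fun y => fderiv ℝ φ y (EuclideanSpace.single j 1)) x :=
        ((h.smooth.fderiv_right (m := ∞) (by simp)).clm_apply contDiff_const).contDiffAt
      have h2 : ContDiffAt ℝ ∞ (fun y => ((abPotential α y j + hmfPotential B₀ y j : ℝ) : ℂ)) x :=
        Complex.ofRealCLM.contDiff.contDiffAt.comp x (contDiffAt_potential α B₀ j hx0)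
      exact h1.add ((contDiffAt_const.mul h2).mul h.smooth.contDiffAt)
    · have h1 : _root_.covDeriv α B₀ j φ =ᶠ[𝓝 x] fun _ => 0 :=
        notMem_tsupport_iff_eventuallyEq.1 fun h2 => hx (tsupport_covDeriv_subset α B₀ j φ h2)
      exact contDiffAt_const.congr_of_eventuallyEq h1

theorem IsTestFun.memLp {φ : Plane → ℂ} (h : IsTestFun φ) : MemLp φ 2 volume :=
  h.smooth.continuous.memLp_of_hasCompactSupport h.compact

theorem IsTestFun.conj {φ : Plane → ℂ} (h : IsTestFun φ) :
    IsTestFun (fun x => (starRingEnd ℂ) (φ x)) where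
  smooth := Complex.conjCLE.contDiff.comp h.smooth
  compact := h.compact.comp_left (g := starRingEnd ℂ) (map_zero _)
  zero_notMem := fun hx => h.zero_notMem
    (closure_mono (Function.support_comp_subset (g := starRingEnd ℂ) (map_zero _) φ) hx)

theorem IsTestFun.integrable_mul {φ ψ : Plane → ℂ} (h : IsTestFun φ) (k : IsTestFun ψ) :
    Integrable (fun x => φ x * ψ x) volume :=
  (h.smooth.continuous.mul k.smooth.continuous).integrable_of_hasCompactSupport
    (h.compact.mul_right (f' := ψ))

theorem IsTestFun.integrable_deriv_mul {φ ψ : Plane → ℂ} (h : IsTestFun φ) (k : IsTestFun ψ)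
    (v : Plane) : Integrable (fun x => fderiv ℝ φ x v * ψ x) volume := by
  have h1 : Continuous fun x => fderiv ℝ φ x v :=
    ((h.smooth.fderiv_right (m := ∞) (by simp)).clm_apply contDiff_const).continuous
  exact (h1.mul k.smooth.continuous).integrable_of_hasCompactSupport
    (k.compact.mul_left (f := fun x => fderiv ℝ φ x v))

theorem integral_covDeriv_mul_conj {φ ψ : Plane → ℂ} (h : IsTestFun φ) (k : IsTestFun ψ)
    (α B₀ : ℝ) (j : Fin 2) :
    ∫ x, covDeriv α B₀ j φ x * (starRingEnd ℂ) (ψ x) =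
      -∫ x, φ x * (starRingEnd ℂ) (covDeriv α B₀ j ψ x) := by
  set v : Plane := EuclideanSpace.single j 1 with hv
  have h1 := integral_mul_fderiv_eq_neg_fderiv_mul_of_integrable (μ := volume) (v := v)
    (h.integrable_deriv_mul k.conj v)
    (by simpa only [mul_comm] using k.conj.integrable_deriv_mul h v)
    (h.integrable_mul k.conj) (fun x _ => h.differentiable x) (fun x _ => k.conj.differentiable x)
  have h2 : ∀ x, fderiv ℝ (fun x => (starRingEnd ℂ) (ψ x)) x v =
      (starRingEnd ℂ) (fderiv ℝ ψ x v) := fun x => by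
    have := (Complex.conjCLE.toContinuousLinearMap.hasFDerivAt (x := ψ x)).comp x
      (k.differentiable x).hasFDerivAt
    have h3 : fderiv ℝ (fun x => (starRingEnd ℂ) (ψ x)) x = _ := this.fderiv
    rw [h3]
    simp
  have h4 : ∀ x, covDeriv α B₀ j φ x * (starRingEnd ℂ) (ψ x) +
      φ x * (starRingEnd ℂ) (covDeriv α B₀ j ψ x) =
      fderiv ℝ φ x v * (starRingEnd ℂ) (ψ x) +
      φ x * fderiv ℝ (fun x => (starRingEnd ℂ) (ψ x)) x v := fun x => by
    rw [h2]
    simp only [covDeriv, map_add, map_mul, Complex.conj_I, Complex.conj_ofReal]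
    ring
  have h5 := integral_add ((h.covDeriv α B₀ j).integrable_mul k.conj)
    (h.integrable_mul (k.covDeriv α B₀ j).conj)
  have h6 := integral_add (h.integrable_deriv_mul k.conj v)
    (show Integrable (fun x => φ x * fderiv ℝ (fun x => (starRingEnd ℂ) (ψ x)) x v) volume by
      simpa only [mul_comm] using k.conj.integrable_deriv_mul h v)
  simp only [h4] at h5
  rw [h6, h1] at h5
  linear_combination -h5

/-- The class in `L²` of a test function. -/
def IsTestFun.toL2 {φ : Plane → ℂ} (h : IsTestFun φ) : L2Plane := h.memLp.toLp φ

theorem IsTestFun.mem_testGraph {φ : Plane → ℂ} (h : IsTestFun φ) (α B₀ : ℝ) :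
    (h.toL2, fun j => (h.covDeriv α B₀ j).toL2) ∈ testGraph α B₀ :=
  ⟨φ, h, h.memLp.coeFn_toLp, fun j => (h.covDeriv α B₀ j).memLp.coeFn_toLp⟩

theorem IsTestFun.inner_toL2 {φ : Plane → ℂ} (h : IsTestFun φ) (g : L2Plane) :
    inner ℂ h.toL2 g = ∫ x, g x * (starRingEnd ℂ) (φ x) := by
  rw [L2.inner_def]
  refine integral_congr_ae ?_
  filter_upwards [h.memLp.coeFn_toLp] with x hx
  rw [IsTestFun.toL2, hx]
  simp [mul_comm]

theorem inner_covDeriv_formGraph {φ : Plane → ℂ} (h : IsTestFun φ) (α B₀ : ℝ)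
    {q : L2Plane × (Fin 2 → L2Plane)} (hq : q ∈ formGraph α B₀) (j : Fin 2) :
    inner ℂ (h.covDeriv α B₀ j).toL2 (q.2 j) =
      -inner ℂ ((h.covDeriv α B₀ j).covDeriv α B₀ j).toL2 q.1 := by
  have hc : IsClosed {q : L2Plane × (Fin 2 → L2Plane) |
      inner ℂ (h.covDeriv α B₀ j).toL2 (q.2 j) =
        -inner ℂ ((h.covDeriv α B₀ j).covDeriv α B₀ j).toL2 q.1} :=
    isClosed_eq (by fun_prop) (by fun_prop)
  refine closure_minimal ?_ hc hq
  rintro q ⟨ψ, k, hq1, hq2⟩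
  change inner ℂ (h.covDeriv α B₀ j).toL2 (q.2 j) =
    -inner ℂ ((h.covDeriv α B₀ j).covDeriv α B₀ j).toL2 q.1
  rw [IsTestFun.inner_toL2, IsTestFun.inner_toL2]
  refine Eq.trans (integral_congr_ae ?_) ((integral_covDeriv_mul_conj k (h.covDeriv α B₀ j)
    α B₀ j).trans (congrArg Neg.neg (integral_congr_ae ?_)))
  · filter_upwards [hq2 j] with x hx
    rw [hx]
  · filter_upwards [hq1] with x hx
    rw [hx]

theorem eq_zero_of_inner_testFun (g : L2Plane)
    (h : ∀ (φ : Plane → ℂ) (hφ : IsTestFun φ), inner ℂ hφ.toL2 g = 0) : g = 0 := by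
  have h1 : ∀ᵐ x ∂(volume : Measure Plane), x ∈ ({0} : Set Plane)ᶜ → g x = 0 := by
    refine isOpen_compl_singleton.ae_eq_zero_of_integral_contDiff_smul_eq_zero
      (((Lp.memLp g).locallyIntegrable (by norm_num)).locallyIntegrableOn _) ?_
    intro φ h1 h2 h3
    have hs : tsupport (fun x => (φ x : ℂ)) ⊆ tsupport φ :=
      closure_mono (Function.support_comp_subset (g := ((↑) : ℝ → ℂ)) Complex.ofReal_zero φ)
    have hφ : IsTestFun (fun x => (φ x : ℂ)) :=
      ⟨Complex.ofRealCLM.contDiff.comp h1, h2.comp_left Complex.ofReal_zero,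
        fun hx => h3 (hs hx) rfl⟩
    have h4 := h _ hφ
    rw [hφ.inner_toL2] at h4
    rw [← h4]
    refine integral_congr_ae (ae_of_all _ fun x => ?_)
    simp [mul_comm]
  refine (Lp.eq_zero_iff_ae_eq_zero).2 ?_
  filter_upwards [h1,
    measure_eq_zero_iff_ae_notMem.1 (measure_singleton (0 : Plane))] with x h2 h3
  exact h2 h3

/-- `hamiltonianGraph` is the graph of a function. -/
theorem hamiltonianGraph_single_valued (α B₀ : ℝ) (p : L2Plane × L2Plane)
    (hp : p ∈ hamiltonianGraph α B₀) (h0 : p.1 = 0) : p.2 = 0 := by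
  obtain ⟨G, hG, h⟩ := hp
  refine eq_zero_of_inner_testFun _ fun φ hφ => ?_
  rw [← h _ ((testGraph α B₀).le_topologicalClosure (hφ.mem_testGraph α B₀))]
  refine Finset.sum_eq_zero fun j _ => ?_
  rw [inner_covDeriv_formGraph hφ α B₀ hG j]
  simp [h0]

/-- The operator `H_{α,B₀} = -(∇ + i (A_B + A_hmf))²`, in the sense of the Friedrichs extension:
the (unbounded) operator on `L²(ℝ²)` whose graph is `hamiltonianGraph α B₀`. -/
def hamiltonian (α B₀ : ℝ) : L2Plane →ₗ.[ℂ] L2Plane :=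
  (hamiltonianGraph α B₀).toLinearPMap

theorem hamiltonian_graph (α B₀ : ℝ) : (hamiltonian α B₀).graph = hamiltonianGraph α B₀ :=
  Submodule.toLinearPMap_graph_eq _ (hamiltonianGraph_single_valued α B₀)

/-! ### The heat flow -/

/-- `S` is the strongly continuous semigroup `(e^{tA})_{t ≥ 0}`: its infinitesimal generator
is `A`. -/
structure IsSemigroupGeneratedBy (A : L2Plane →ₗ.[ℂ] L2Plane)
    (S : ℝ → L2Plane →L[ℂ] L2Plane) : Prop where
  map_zero : S 0 = ContinuousLinearMap.id ℂ L2Plane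
  map_add : ∀ s t : ℝ, 0 ≤ s → 0 ≤ t → S (s + t) = (S s).comp (S t)
  continuousOn : ∀ f : L2Plane, ContinuousOn (fun t => S t f) (Set.Ici 0)
  generator : ∀ u v : L2Plane, (u, v) ∈ A.graph ↔
    Tendsto (fun h : ℝ => h⁻¹ • (S h u - u)) (𝓝[>] 0) (𝓝 v)

/-- `u` solves `∂ₜ u + H u = 0` for `t > 0`, `u(0) = f`, in `L²(ℝ²)`. -/
structure IsHeatSolution (H : L2Plane →ₗ.[ℂ] L2Plane) (f : L2Plane) (u : ℝ → L2Plane) :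
    Prop where
  initial : u 0 = f
  continuousOn : ContinuousOn u (Set.Ici 0)
  equation : ∀ t : ℝ, 0 < t → ∃ h : u t ∈ H.domain, HasDerivAt u (-(H ⟨u t, h⟩)) t

/-! ### The heat kernel -/

/-- The modified Bessel function of the first kind `I_ν(z)`, for `ν ≥ 0` and `z ≥ 0`. -/
def besselI (ν z : ℝ) : ℝ :=
  ∑' m : ℕ, (z / 2) ^ (2 * (m : ℝ) + ν) / ((m.factorial : ℝ) * Real.Gamma ((m : ℝ) + ν + 1))

/-- The `k`-th term `e^{ik(θ₁ - θ₂ + itB₀)} I_{|k+α|}(B₀ r₁ r₂ / (2 sinh tB₀))`. -/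
def heatKernelTerm (α B₀ t r₁ θ₁ r₂ θ₂ : ℝ) (k : ℤ) : ℂ :=
  Complex.exp (Complex.I * k * (θ₁ - θ₂ + Complex.I * t * B₀)) *
    (besselI |(k : ℝ) + α| (B₀ * r₁ * r₂ / (2 * Real.sinh (t * B₀))) : ℂ)

/-- The heat kernel in polar coordinates. -/
def heatKernelPolar (α B₀ t r₁ θ₁ r₂ θ₂ : ℝ) : ℂ :=
  (B₀ * Real.exp (-(α * t * B₀)) / (4 * Real.pi * Real.sinh (t * B₀)) : ℝ) *
    (Real.exp (-(B₀ * (r₁ ^ 2 + r₂ ^ 2) * Real.cosh (t * B₀) / (4 * Real.sinh (t * B₀)))) : ℝ) *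
    ∑' k : ℤ, heatKernelTerm α B₀ t r₁ θ₁ r₂ θ₂ k

/-- The heat kernel `K_H(t; x, y)`. -/
def heatKernel (α B₀ t : ℝ) (x y : Plane) : ℂ :=
  heatKernelPolar α B₀ t ‖x‖ (planeArg x) ‖y‖ (planeArg y)

end

/-! The Hamiltonian is diagonalised, its semigroup is computed on a total family of Gaussians, and
the kernel is verified on that same family.

In the sector e^{ikθ}, put ν = |k + α| and ρ = r². On e^{ikθ} r^ν q(ρ) the operator acts as -4ρq'' -
4(ν + 1)q' + (B₀²ρ/4 + B₀(k + α))q (`mode_mem_hamiltonianGraph`). These modes lie in the form domain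
because a point has zero capacity in the plane: logarithmic cutoffs approximate a bounded function,
smooth off the origin, by test functions (`mem_formGraph_of_bounded`). For q = ρⁿe^{-sρ} this gives
a three-term formula (`gaussVec_mem_hamiltonianGraph`), which is used twice.

For s = B₀/4 the term raising n drops out. The operator is then triangular with distinct diagonal
entries B₀(2n + 1 + ν + k + α), so these vectors are combinations of eigenvectors. They are total
(`eq_zero_of_inner_gaussVec`), and the operator is closed and symmetric, so there is a Hilbert basis
of eigenvectors (`exists_hilbertBasis_hamiltonianGraph`). In it the operator is the maximal
multiplication by its eigenvalues λᵢ ≥ 0; generation, smoothing and uniqueness become statements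
about the scalars e^{-tλᵢ}.

For n = 0 and arbitrary s > 0 the formula shows that Gaussians stay Gaussians: the exponent solves
σ' = B₀²/4 - 4σ² and the amplitude solves a linear equation (`semigroup_gaussVec`). When the kernel
is integrated against such a Gaussian, angular orthogonality leaves one term of the series, and
Weber's integral gives the same result (`integral_heatKernel_mul_mode`). The kernel is square
integrable in y, so the identity passes to L² limits, and the Gaussians with n = 0 are already total
(`semigroup_ae_eq_integral_heatKernel`).

For the pointwise bound, I_{n+β} with 0 ≤ β ≤ 1 is dominated by 2I_n + I_{n+1}, and integer orders
are summed by the generating function e^{z cosh τ} (`summable_exp_mul_besselI_int`). This costs the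
factor e^{(⌈α⌉-α)tB₀}, and ⌈α⌉ ≤ 1 when α ≤ 1. -/

noncomputable section

/-! ### Diagonal operators in a Hilbert basis and the semigroups they generate. -/

section Diagonal

variable {ι E : Type*} [NormedAddCommGroup E] [InnerProductSpace ℂ E]

theorem HilbertBasis.summable_norm_repr_sq (b : HilbertBasis ι ℂ E) (f : E) :
    Summable fun i => ‖b.repr f i‖ ^ 2 := by
  have := (lp.memℓp (b.repr f)).summable (by norm_num)
  simpa using this

theorem HilbertBasis.norm_sq_eq_tsum (b : HilbertBasis ι ℂ E) (f : E) :
    ‖f‖ ^ 2 = ∑' i, ‖b.repr f i‖ ^ 2 := by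
  have h := lp.norm_rpow_eq_tsum (p := 2) (by norm_num) (b.repr f)
  rw [b.repr.norm_map] at h
  simpa using h

theorem HilbertBasis.ext_repr (b : HilbertBasis ι ℂ E) {f g : E}
    (h : ∀ i, b.repr f i = b.repr g i) : f = g :=
  b.repr.injective (lp.ext (funext h))

theorem HilbertBasis.exists_repr_eq (b : HilbertBasis ι ℂ E) (c : ι → ℂ)
    (hc : Summable fun i => ‖c i‖ ^ 2) : ∃ f : E, ∀ i, b.repr f i = c i := by
  have h : Memℓp c 2 := memℓp_gen (by simpa using hc)
  exact ⟨b.repr.symm ⟨c, h⟩, fun i => by simp⟩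

/-- Parseval turns the squared distance into a series, to which dominated convergence applies. All
norm limits for the diagonal semigroup reduce to scalar limits through this lemma. -/
theorem HilbertBasis.tendsto_of_dominated (b : HilbertBasis ι ℂ E) {A : Type*} {l : Filter A}
    {F : A → E} {f : E} {bound : ι → ℝ} (hs : Summable bound)
    (h : ∀ i, Tendsto (fun a => b.repr (F a) i) l (𝓝 (b.repr f i)))
    (hb : ∀ᶠ a in l, ∀ i, ‖b.repr (F a) i - b.repr f i‖ ^ 2 ≤ bound i) :
    Tendsto F l (𝓝 f) := by
  rw [tendsto_iff_norm_sub_tendsto_zero]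
  have h1 : Tendsto (fun a => ‖F a - f‖ ^ 2) l (𝓝 0) := by
    have h2 := tendsto_tsum_of_dominated_convergence (𝓕 := l)
      (f := fun a i => ‖b.repr (F a) i - b.repr f i‖ ^ 2) (g := fun _ => (0 : ℝ)) hs
      (fun i => by
        have := ((h i).sub_const (b.repr f i)).norm.pow 2
        simpa using this)
      (by
        filter_upwards [hb] with a ha i
        rw [Real.norm_of_nonneg (by positivity)]
        exact ha i)
    rw [tsum_zero] at h2
    refine h2.congr fun a => ?_
    rw [b.norm_sq_eq_tsum]
    simp
  have h3 := h1.sqrt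
  simpa using h3

/-- The operator that multiplies the `i`-th coordinate by `m i`, for `‖m i‖ ≤ 1`. -/
def HilbertBasis.diag (b : HilbertBasis ι ℂ E) (m : ι → ℂ) (hm : ∀ i, ‖m i‖ ≤ 1) : E →L[ℂ] E :=
  have hle : ∀ f : E, ∀ i, ‖m i * b.repr f i‖ ^ 2 ≤ ‖b.repr f i‖ ^ 2 := fun f i => by
    rw [norm_mul]
    gcongr
    exact mul_le_of_le_one_left (norm_nonneg _) (hm i)
  have hs : ∀ f : E, Memℓp (fun i => m i * b.repr f i) 2 := fun f => memℓp_gen (by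
    simpa using Summable.of_nonneg_of_le (fun i => by positivity) (hle f)
      (b.summable_norm_repr_sq f))
  LinearMap.mkContinuous
    { toFun := fun f => b.repr.symm ⟨fun i => m i * b.repr f i, hs f⟩
      map_add' := fun f g => b.ext_repr fun i => by
        simp only [map_add, lp.coeFn_add, Pi.add_apply, LinearIsometryEquiv.apply_symm_apply,
          mul_add]
      map_smul' := fun c f => b.ext_repr fun i => by simp [mul_left_comm] } 1 (fun f => by
    rw [one_mul]
    refine le_of_sq_le_sq ?_ (norm_nonneg _)
    rw [b.norm_sq_eq_tsum, b.norm_sq_eq_tsum]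
    refine Summable.tsum_le_tsum (fun i => ?_) (b.summable_norm_repr_sq _)
      (b.summable_norm_repr_sq _)
    simpa using hle f i)

@[simp]
theorem HilbertBasis.repr_diag (b : HilbertBasis ι ℂ E) (m : ι → ℂ) (hm : ∀ i, ‖m i‖ ≤ 1)
    (f : E) (i : ι) : b.repr (b.diag m hm f) i = m i * b.repr f i := by
  simp [HilbertBasis.diag]

theorem norm_exp_neg_max_le (lam : ι → ℝ) (h0 : ∀ i, 0 ≤ lam i) (t : ℝ) (i : ι) :
    ‖((Real.exp (-(max t 0 * lam i)) : ℝ) : ℂ)‖ ≤ 1 := by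
  rw [Complex.norm_real, Real.norm_of_nonneg (Real.exp_pos _).le, Real.exp_le_one_iff]
  have := mul_nonneg (le_max_right t 0) (h0 i)
  linarith

/-- The semigroup with the eigenvalues `e^{-t lam i}`. -/
def HilbertBasis.semigroup (b : HilbertBasis ι ℂ E) (lam : ι → ℝ) (h0 : ∀ i, 0 ≤ lam i) (t : ℝ) :
    E →L[ℂ] E :=
  b.diag (fun i => ((Real.exp (-(max t 0 * lam i)) : ℝ) : ℂ)) (norm_exp_neg_max_le lam h0 t)

variable (b : HilbertBasis ι ℂ E) (lam : ι → ℝ) (h0 : ∀ i, 0 ≤ lam i)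

theorem HilbertBasis.repr_semigroup {t : ℝ} (ht : 0 ≤ t) (f : E) (i : ι) :
    b.repr (b.semigroup lam h0 t f) i = ((Real.exp (-(t * lam i)) : ℝ) : ℂ) * b.repr f i := by
  rw [HilbertBasis.semigroup, HilbertBasis.repr_diag, max_eq_left ht]

theorem HilbertBasis.semigroup_zero : b.semigroup lam h0 0 = ContinuousLinearMap.id ℂ E := by
  ext f
  exact b.ext_repr fun i => by simp [b.repr_semigroup lam h0 le_rfl]

theorem HilbertBasis.semigroup_add {s t : ℝ} (hs : 0 ≤ s) (ht : 0 ≤ t) :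
    b.semigroup lam h0 (s + t) = (b.semigroup lam h0 s).comp (b.semigroup lam h0 t) := by
  ext f
  refine b.ext_repr fun i => ?_
  rw [ContinuousLinearMap.comp_apply, b.repr_semigroup lam h0 (add_nonneg hs ht),
    b.repr_semigroup lam h0 hs, b.repr_semigroup lam h0 ht, ← mul_assoc, ← Complex.ofReal_mul,
    ← Real.exp_add]
  ring_nf

theorem HilbertBasis.continuous_semigroup (f : E) : Continuous fun t => b.semigroup lam h0 t f := by
  rw [continuous_iff_continuousAt]
  intro t
  refine b.tendsto_of_dominated (bound := fun i => 4 * ‖b.repr f i‖ ^ 2)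
    ((b.summable_norm_repr_sq f).mul_left 4) (fun i => ?_) (Eventually.of_forall fun s i => ?_)
  · simp only [HilbertBasis.semigroup, HilbertBasis.repr_diag]
    have : Continuous fun s : ℝ => ((Real.exp (-(max s 0 * lam i)) : ℝ) : ℂ) * b.repr f i := by
      fun_prop
    exact this.tendsto t
  · simp only [HilbertBasis.semigroup, HilbertBasis.repr_diag]
    rw [← sub_mul, norm_mul, mul_pow]
    gcongr
    have h1 := norm_sub_le ((Real.exp (-(max s 0 * lam i)) : ℝ) : ℂ)
      ((Real.exp (-(max t 0 * lam i)) : ℝ) : ℂ)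
    have h2 := norm_exp_neg_max_le lam h0 s i
    have h3 := norm_exp_neg_max_le lam h0 t i
    nlinarith [norm_nonneg (((Real.exp (-(max s 0 * lam i)) : ℝ) : ℂ) -
      ((Real.exp (-(max t 0 * lam i)) : ℝ) : ℂ))]

theorem abs_exp_neg_sub_one_le {x : ℝ} (hx : 0 ≤ x) : |Real.exp (-x) - 1| ≤ x := by
  rw [abs_le]
  have := Real.add_one_le_exp (-x)
  have h2 : Real.exp (-x) ≤ 1 := Real.exp_le_one_iff.2 (by linarith)
  constructor <;> linarith

/-- Each coordinate of the difference quotient tends to -λᵢuᵢ, so a limit can only be the diagonal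
operator. Conversely |e^{-x} - 1| ≤ x keeps the error in coordinate i below 2λᵢ|uᵢ| = 2|vᵢ|, whose
square is the dominating sequence; no condition beyond v ∈ E is needed, so the generator has the
maximal domain. -/
theorem HilbertBasis.semigroup_generator (u v : E) :
    (∀ i, b.repr v i = -(lam i * b.repr u i)) ↔
      Tendsto (fun h : ℝ => h⁻¹ • (b.semigroup lam h0 h u - u)) (𝓝[>] 0) (𝓝 v) := by
  have hc : ∀ (h : ℝ), 0 < h → ∀ i, b.repr (h⁻¹ • (b.semigroup lam h0 h u - u)) i =
      ((h⁻¹ * (Real.exp (-(h * lam i)) - 1) : ℝ) : ℂ) * b.repr u i := fun h hh i => by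
    have e : h⁻¹ • (b.semigroup lam h0 h u - u) =
      ((h⁻¹ : ℝ) : ℂ) • (b.semigroup lam h0 h u - u) := (Complex.coe_smul _ _).symm
    rw [e, map_smul, map_sub]
    simp only [lp.coeFn_smul, lp.coeFn_sub, Pi.smul_apply, Pi.sub_apply, smul_eq_mul]
    rw [b.repr_semigroup lam h0 hh.le]
    push_cast
    ring
  have hlim : ∀ i, Tendsto (fun h : ℝ => b.repr (h⁻¹ • (b.semigroup lam h0 h u - u)) i) (𝓝[>] 0)
      (𝓝 (-(lam i * b.repr u i))) := fun i => by
    have h1 : HasDerivAt (fun h : ℝ => Real.exp (-(h * lam i))) (-lam i) 0 := by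
      have := (((hasDerivAt_id (0 : ℝ)).mul_const (lam i)).neg).exp
      simpa using this
    have h2 := h1.tendsto_slope_zero_right
    have h3 : Tendsto (fun h : ℝ => ((h⁻¹ * (Real.exp (-(h * lam i)) - 1) : ℝ) : ℂ) * b.repr u i)
        (𝓝[>] 0) (𝓝 ((-lam i : ℝ) * b.repr u i)) := by
      refine Tendsto.mul_const _ ((Complex.continuous_ofReal.tendsto _).comp ?_)
      simpa using h2
    have h4 : ((-lam i : ℝ) : ℂ) * b.repr u i = -(lam i * b.repr u i) := by push_cast; ring
    rw [h4] at h3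
    refine h3.congr' ?_
    filter_upwards [self_mem_nhdsWithin] with h hh
    exact (hc h hh i).symm
  constructor
  · intro huv
    refine b.tendsto_of_dominated (bound := fun i => 4 * ‖b.repr v i‖ ^ 2)
      ((b.summable_norm_repr_sq v).mul_left 4) (fun i => huv i ▸ hlim i) ?_
    filter_upwards [self_mem_nhdsWithin] with h hh i
    have hh : 0 < h := hh
    rw [hc h hh, huv]
    have e : ((h⁻¹ * (Real.exp (-(h * lam i)) - 1) : ℝ) : ℂ) * b.repr u i -
        -(lam i * b.repr u i) =
        ((h⁻¹ * (Real.exp (-(h * lam i)) - 1) + lam i : ℝ) : ℂ) * b.repr u i := by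
      push_cast; ring
    rw [e, norm_mul, norm_neg, norm_mul, Complex.norm_real, Complex.norm_real]
    have h5 : ‖h⁻¹ * (Real.exp (-(h * lam i)) - 1) + lam i‖ ≤ 2 * ‖lam i‖ := by
      refine (norm_add_le _ _).trans ?_
      rw [norm_mul, Real.norm_of_nonneg (inv_pos.2 hh).le, Real.norm_of_nonneg (h0 i)]
      have := abs_exp_neg_sub_one_le (mul_nonneg hh.le (h0 i))
      have h6 : h⁻¹ * ‖Real.exp (-(h * lam i)) - 1‖ ≤ h⁻¹ * (h * lam i) := by
        gcongr
        exact this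
      rw [inv_mul_cancel_left₀ hh.ne'] at h6
      linarith
    have h7 : ‖h⁻¹ * (Real.exp (-(h * lam i)) - 1) + lam i‖ * ‖b.repr u i‖ ≤
        2 * (‖lam i‖ * ‖b.repr u i‖) := by
      rw [← mul_assoc]; gcongr
    calc _ ≤ (2 * (‖lam i‖ * ‖b.repr u i‖)) ^ 2 := by gcongr
      _ = _ := by ring
  · intro ht i
    have h1 : Continuous fun x : E => b.repr x i := by
      simp only [b.repr_apply_apply]
      fun_prop
    exact tendsto_nhds_unique ((h1.tendsto v).comp ht) (hlim i)

/-- Smoothing: λe^{-tλ} ≤ 1/t uniformly in λ ≥ 0, so for t > 0 the orbit of every f is in the domain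
and is differentiable there. -/
theorem HilbertBasis.exists_semigroup_deriv {t : ℝ} (ht : 0 < t) (f : E) :
    ∃ v : E, (∀ i, b.repr v i = lam i * b.repr (b.semigroup lam h0 t f) i) ∧
      HasDerivAt (fun s => b.semigroup lam h0 s f) (-v) t := by
  have hmul : ∀ (x : ℝ), 0 ≤ x → ∀ s : ℝ, 0 < s → x * Real.exp (-(s * x)) ≤ s⁻¹ := by
    intro x hx s hs
    have h1 := Real.add_one_le_exp (s * x)
    rw [Real.exp_neg, ← div_eq_mul_inv, div_le_iff₀ (Real.exp_pos _)]
    have : x = s⁻¹ * (s * x) := by field_simp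
    have h2 : s⁻¹ * (s * x) ≤ s⁻¹ * Real.exp (s * x) := by gcongr; linarith
    linarith
  obtain ⟨v, hv⟩ := b.exists_repr_eq
    (fun i => lam i * b.repr (b.semigroup lam h0 t f) i) (by
      refine Summable.of_nonneg_of_le (fun i => by positivity) (fun i => ?_)
        ((b.summable_norm_repr_sq f).mul_left (t⁻¹ ^ 2))
      rw [b.repr_semigroup lam h0 ht.le, ← mul_assoc, norm_mul, mul_pow, ← Complex.ofReal_mul,
        Complex.norm_real, Real.norm_of_nonneg (mul_nonneg (h0 i) (Real.exp_pos _).le)]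
      have h1 := hmul _ (h0 i) t ht
      have h2 := mul_nonneg (h0 i) (Real.exp_pos (-(t * lam i))).le
      gcongr)
  refine ⟨v, hv, ?_⟩
  rw [hasDerivAt_iff_tendsto_slope]
  have hc : ∀ s : ℝ, 0 < s → ∀ i, b.repr (slope (fun s => b.semigroup lam h0 s f) t s) i =
      ((slope (fun s => Real.exp (-(s * lam i))) t s : ℝ) : ℂ) * b.repr f i := fun s hs i => by
    have e : slope (fun s => b.semigroup lam h0 s f) t s =
      (((s - t)⁻¹ : ℝ) : ℂ) • (b.semigroup lam h0 s f - b.semigroup lam h0 t f) := by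
      rw [slope_def_module, Complex.coe_smul]
    rw [e, map_smul, map_sub, slope_def_module]
    simp only [lp.coeFn_smul, lp.coeFn_sub, Pi.smul_apply, Pi.sub_apply, smul_eq_mul]
    rw [b.repr_semigroup lam h0 hs.le, b.repr_semigroup lam h0 ht.le]
    push_cast
    ring
  have hder : ∀ i s, HasDerivAt (fun s : ℝ => Real.exp (-(s * lam i)))
      (-(lam i * Real.exp (-(s * lam i)))) s := fun i s => by
    have := (((hasDerivAt_id s).mul_const (lam i)).neg).exp
    refine this.congr_deriv ?_
    simp
    ring
  refine b.tendsto_of_dominated (bound := fun i => (2 * (t / 2)⁻¹) ^ 2 * ‖b.repr f i‖ ^ 2)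
      ((b.summable_norm_repr_sq f).mul_left _) (fun i => ?_) ?_
  · have h1 : Tendsto (fun s => ((slope (fun s => Real.exp (-(s * lam i))) t s : ℝ) : ℂ) *
        b.repr f i) (𝓝[≠] t) (𝓝 (((-(lam i * Real.exp (-(t * lam i))) : ℝ) : ℂ) * b.repr f i)) :=
      (((Complex.continuous_ofReal.tendsto _).comp
        (hasDerivAt_iff_tendsto_slope.1 (hder i t)))).mul_const _
    have h2 : b.repr (-v) i = ((-(lam i * Real.exp (-(t * lam i))) : ℝ) : ℂ) * b.repr f i := by
      rw [map_neg, lp.coeFn_neg, Pi.neg_apply, hv, b.repr_semigroup lam h0 ht.le]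
      push_cast; ring
    rw [h2]
    refine h1.congr' ?_
    filter_upwards [nhdsWithin_le_nhds (lt_mem_nhds ht)] with s hs
    rw [hc s hs]
  · filter_upwards [nhdsWithin_le_nhds (lt_mem_nhds (half_lt_self ht))] with s hs i
    have ht2 : 0 < t / 2 := half_pos ht
    have h2 : b.repr (-v) i = ((-(lam i * Real.exp (-(t * lam i))) : ℝ) : ℂ) * b.repr f i := by
      rw [map_neg, lp.coeFn_neg, Pi.neg_apply, hv, b.repr_semigroup lam h0 ht.le]
      push_cast; ring
    rw [hc s (ht2.trans hs), h2, ← sub_mul, norm_mul, mul_pow, ← Complex.ofReal_sub,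
      Complex.norm_real]
    gcongr
    -- On [t/2, ∞) the scalar derivatives are bounded by 2/t independently of i. By the mean value
    -- inequality so are the slopes; slope plus derivative give the factor 2 in the dominating
    -- sequence.
    have hbd : ∀ x ∈ Set.Ici (t / 2), ‖-(lam i * Real.exp (-(x * lam i)))‖ ≤ (t / 2)⁻¹ := by
      intro x hx
      rw [norm_neg, Real.norm_of_nonneg (mul_nonneg (h0 i) (Real.exp_pos _).le)]
      have hx0 : 0 < x := ht2.trans_le hx
      exact (hmul _ (h0 i) x hx0).trans (inv_anti₀ ht2 hx)
    have h3 : ‖slope (fun s => Real.exp (-(s * lam i))) t s‖ ≤ (t / 2)⁻¹ := by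
      have h4 := (convex_Ici (t / 2)).norm_image_sub_le_of_norm_hasDerivWithin_le
        (fun x _ => (hder i x).hasDerivWithinAt) hbd
        (show t ∈ Set.Ici (t / 2) from (half_lt_self ht).le) (show s ∈ Set.Ici (t / 2) from hs.le)
      rw [slope_def_module, norm_smul, norm_inv]
      rcases eq_or_ne s t with rfl | hst
      · simp; positivity
      · have : 0 < ‖s - t‖ := norm_pos_iff.2 (sub_ne_zero.2 hst)
        rw [inv_mul_le_iff₀ this]
        linarith
    have h5 := hbd t (half_lt_self ht).le
    exact (norm_sub_le _ _).trans (by linarith)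

/-- Integrating factor e^{tc}. The equation is assumed only for t > 0, so the initial value is
recovered from right continuity at 0. It serves both the evolution of Gaussians and uniqueness of
the heat flow. -/
theorem eq_exp_mul_of_hasDerivAt {φ : ℝ → ℂ} {c : ℝ} (hc : ContinuousOn φ (Set.Ici 0))
    (hd : ∀ t, 0 < t → HasDerivAt φ (-(c * φ t)) t) {t : ℝ} (ht : 0 ≤ t) :
    φ t = ((Real.exp (-(t * c)) : ℝ) : ℂ) * φ 0 := by
  have hE : ∀ s : ℝ, HasDerivAt (fun s : ℝ => ((Real.exp (s * c) : ℝ) : ℂ))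
      ((Real.exp (s * c) : ℝ) * c) s := fun s => by
    have := (((hasDerivAt_id s).mul_const c).exp).ofReal_comp
    refine this.congr_deriv ?_
    push_cast
    simp
  set g : ℝ → ℂ := fun x => ((Real.exp (x * c) : ℝ) : ℂ) * φ x with hg
  have hgd : ∀ x ∈ Set.Ioi (0 : ℝ), HasDerivAt g 0 x := fun x hx => by
    refine ((hE x).mul (hd x hx)).congr_deriv ?_
    ring
  rcases ht.eq_or_lt with rfl | ht
  · simp
  have h1 : ∀ x ∈ Set.Ioi (0 : ℝ), g x = g t := fun x hx =>
    isOpen_Ioi.is_const_of_deriv_eq_zero isPreconnected_Ioi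
      (fun y hy => (hgd y hy).differentiableAt.differentiableWithinAt)
      (fun y hy => (hgd y hy).deriv) hx ht
  have hg0 : Tendsto g (𝓝[>] 0) (𝓝 (g 0)) := by
    have h3 : Tendsto φ (𝓝[>] 0) (𝓝 (φ 0)) :=
      (hc 0 Set.self_mem_Ici).mono_left (nhdsWithin_mono _ Set.Ioi_subset_Ici_self)
    exact ((hE 0).continuousAt.tendsto.mono_left nhdsWithin_le_nhds).mul h3
  have h2 : g t = g 0 := by
    refine tendsto_nhds_unique (tendsto_const_nhds.congr' ?_) hg0
    filter_upwards [self_mem_nhdsWithin] with x hx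
    exact (h1 x hx).symm
  simp only [hg] at h2
  rw [zero_mul, Real.exp_zero, Complex.ofReal_one, one_mul] at h2
  rw [← h2, ← mul_assoc, ← Complex.ofReal_mul, ← Real.exp_add]
  simp

end Diagonal

/-! ### Eigenvector bases of closed symmetric linear relations. -/

section Eigen

variable {E : Type*} [NormedAddCommGroup E] [InnerProductSpace ℂ E]

/-- The eigenspace of a linear relation. -/
def relEigenspace (G : Submodule ℂ (E × E)) (c : ℝ) : Submodule ℂ E where
  carrier := {u | (u, (c : ℂ) • u) ∈ G}
  add_mem' := fun {u v} hu hv => by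
    have := G.add_mem hu hv
    simpa [smul_add] using this
  zero_mem' := by
    change ((0 : E), (c : ℂ) • (0 : E)) ∈ G
    rw [smul_zero]
    exact G.zero_mem
  smul_mem' := fun a u hu => by
    have := G.smul_mem a hu
    simpa [smul_comm a] using this

theorem mem_relEigenspace {G : Submodule ℂ (E × E)} {c : ℝ} {u : E} :
    u ∈ relEigenspace G c ↔ (u, (c : ℂ) • u) ∈ G := Iff.rfl

theorem isClosed_relEigenspace {G : Submodule ℂ (E × E)} (hG : IsClosed (G : Set (E × E)))
    (c : ℝ) : IsClosed (relEigenspace G c : Set E) :=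
  hG.preimage (f := fun u : E => (u, (c : ℂ) • u)) (by fun_prop)

theorem orthogonalFamily_relEigenspace {G : Submodule ℂ (E × E)}
    (hs : ∀ p ∈ G, ∀ q ∈ G, inner ℂ q.1 p.2 = inner ℂ q.2 p.1) :
    OrthogonalFamily ℂ (fun c : ℝ => relEigenspace G c)
      fun c => (relEigenspace G c).subtypeₗᵢ := by
  intro c d hcd u v
  have h := hs _ (mem_relEigenspace.1 v.2) _ (mem_relEigenspace.1 u.2)
  simp only [inner_smul_left, inner_smul_right, Complex.conj_ofReal] at h
  have h1 : ((d : ℂ) - c) * inner ℂ (u : E) (v : E) = 0 := by rw [sub_mul, h, sub_self]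
  have h2 : (d : ℂ) - c ≠ 0 := by
    rw [← Complex.ofReal_sub, Complex.ofReal_ne_zero, sub_ne_zero]
    exact hcd.symm
  exact (mul_eq_zero.1 h1).resolve_left h2

/-- Closedness makes each eigenspace complete, so it has its own Hilbert basis; symmetry makes
different eigenspaces orthogonal; `hd` says that together they are total. Infinite multiplicities
are allowed. -/
theorem exists_hilbertBasis_relEigenspace.{u} {E : Type u} [NormedAddCommGroup E]
    [InnerProductSpace ℂ E] [CompleteSpace E] {G : Submodule ℂ (E × E)}
    (hG : IsClosed (G : Set (E × E)))
    (hs : ∀ p ∈ G, ∀ q ∈ G, inner ℂ q.1 p.2 = inner ℂ q.2 p.1)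
    (hd : ∀ u : E, (∀ c : ℝ, ∀ x ∈ relEigenspace G c, inner ℂ x u = 0) → u = 0) :
    ∃ (ι : Type u) (b : HilbertBasis ι ℂ E) (lam : ι → ℝ),
      ∀ i, (b i, (lam i : ℂ) • b i) ∈ G := by
  have hc : ∀ c : ℝ, CompleteSpace (relEigenspace G c) := fun c =>
    (isClosed_relEigenspace hG c).completeSpace_coe
  choose w β hβ using fun c : ℝ => exists_hilbertBasis ℂ (relEigenspace G c)
  have ho := (orthogonalFamily_relEigenspace hs).orthonormal_sigma_orthonormal
    (fun c => (β c).orthonormal)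
  have hbot : (Submodule.span ℂ (Set.range fun a : Σ c : ℝ, w c =>
      (relEigenspace G a.1).subtypeₗᵢ (β a.1 a.2)))ᗮ = ⊥ := by
    rw [Submodule.eq_bot_iff]
    intro u hu
    refine hd u fun c x hx => ?_
    have h1 : IsClosed {y : relEigenspace G c | inner ℂ (y : E) u = 0} :=
      isClosed_eq (by fun_prop) continuous_const
    have h2 : Dense (Submodule.span ℂ (Set.range (β c)) : Set (relEigenspace G c)) := by
      rw [Submodule.dense_iff_topologicalClosure_eq_top]
      exact (β c).dense_span
    have h3 : (Submodule.span ℂ (Set.range (β c)) : Set (relEigenspace G c)) ⊆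
        {y : relEigenspace G c | inner ℂ (y : E) u = 0} := by
      intro y hy
      induction hy using Submodule.span_induction with
      | mem y hy =>
        obtain ⟨i, rfl⟩ := hy
        exact (Submodule.mem_orthogonal _ _).1 hu _ (Submodule.subset_span ⟨⟨c, i⟩, rfl⟩)
      | zero => simp
      | add y z _ _ hy hz =>
        simp only [Set.mem_ofPred_eq] at hy hz ⊢
        rw [Submodule.coe_add, inner_add_left, hy, hz, add_zero]
      | smul a y _ hy =>
        simp only [Set.mem_ofPred_eq] at hy ⊢
        rw [Submodule.coe_smul, inner_smul_left, hy, mul_zero]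
    exact closure_minimal h3 h1 (h2 ⟨x, hx⟩)
  refine ⟨Σ c : ℝ, w c, HilbertBasis.mkOfOrthogonalEqBot ho hbot, fun a => a.1, fun a => ?_⟩
  rw [HilbertBasis.coe_mkOfOrthogonalEqBot]
  exact (β a.1 a.2).2

/-- Pairing with an eigenvector and using symmetry gives the coordinates of v. Conversely, when the
coordinates match, (u, v) is a limit of finite combinations of the pairs (bᵢ, λᵢbᵢ), and closedness
applies. -/
theorem mem_iff_repr_of_hilbertBasis {ι : Type*} {G : Submodule ℂ (E × E)}
    (hG : IsClosed (G : Set (E × E)))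
    (hs : ∀ p ∈ G, ∀ q ∈ G, inner ℂ q.1 p.2 = inner ℂ q.2 p.1)
    (b : HilbertBasis ι ℂ E) (lam : ι → ℝ) (hb : ∀ i, (b i, (lam i : ℂ) • b i) ∈ G) (u v : E) :
    (u, v) ∈ G ↔ ∀ i, b.repr v i = lam i * b.repr u i := by
  constructor
  · intro h i
    have := hs _ h _ (hb i)
    simpa [b.repr_apply_apply, inner_smul_left] using this
  · intro h
    have h1 : HasSum (fun i => b.repr u i • (b i, (lam i : ℂ) • b i)) (u, v) := by
      convert (b.hasSum_repr u).prodMk (b.hasSum_repr v) using 2 with i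
      rw [h, Prod.smul_mk, smul_smul, mul_comm (lam i : ℂ)]
    exact hG.mem_of_tendsto h1
      (Eventually.of_forall fun s => G.sum_mem fun i _ => G.smul_mem _ (hb i))

/-- The relation acts on the vectors v n by a bidiagonal matrix with distinct diagonal entries, and
such a matrix is diagonalisable. At n = 0 the truncated index n - 1 is harmless because c 0 = 0. -/
theorem mem_span_relEigenspace {G : Submodule ℂ (E × E)} {v : ℕ → E} {lam c : ℕ → ℝ}
    (hlam : Function.Injective lam)
    (hv : ∀ n, (v n, (lam n : ℂ) • v n - (c n : ℂ) • v (n - 1)) ∈ G) (hc : c 0 = 0) (n : ℕ) :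
    v n ∈ Submodule.span ℂ (⋃ j ∈ Set.Iic n, (relEigenspace G (lam j) : Set E)) := by
  induction n with
  | zero =>
    refine Submodule.subset_span (Set.mem_biUnion (Set.mem_Iic.2 le_rfl) ?_)
    have := hv 0
    rw [hc] at this
    simpa [mem_relEigenspace] using this
  | succ n ih =>
    -- On the span of the lower eigenspaces, the difference of lam (n + 1) and the operator is
    -- inverted by dividing each eigenvector by a nonzero gap. Subtracting the solution y from v (n
    -- + 1) removes the lower term and leaves an eigenvector.
    have h1 : ∀ x ∈ Submodule.span ℂ (⋃ j ∈ Set.Iic n, (relEigenspace G (lam j) : Set E)),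
        ∃ y ∈ Submodule.span ℂ (⋃ j ∈ Set.Iic n, (relEigenspace G (lam j) : Set E)),
          (y, (lam (n + 1) : ℂ) • y - x) ∈ G := by
      intro x hx
      induction hx using Submodule.span_induction with
      | mem x hx =>
        simp only [Set.mem_iUnion, exists_prop] at hx
        obtain ⟨j, hj, hx⟩ := hx
        have hne : ((lam (n + 1) : ℂ) - lam j) ≠ 0 := by
          rw [← Complex.ofReal_sub, Complex.ofReal_ne_zero, sub_ne_zero]
          intro h
          have := hlam h
          simp only [Set.mem_Iic] at hj
          omega
        refine ⟨((lam (n + 1) : ℂ) - lam j)⁻¹ • x, Submodule.smul_mem _ _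
          (Submodule.subset_span (Set.mem_biUnion hj hx)), ?_⟩
        have h2 := G.smul_mem ((lam (n + 1) : ℂ) - lam j)⁻¹ (mem_relEigenspace.1 hx)
        convert h2 using 1
        rw [Prod.smul_mk]
        congr 1
        have : x = ((lam (n + 1) : ℂ) - lam j)⁻¹ • ((lam (n + 1) : ℂ) - lam j) • x := by
          rw [smul_smul, inv_mul_cancel₀ hne, one_smul]
        conv_lhs => rw [this]
        rw [← this]
        conv_lhs => arg 2; rw [this]
        rw [smul_comm (lam (n + 1) : ℂ), ← smul_sub, sub_smul, sub_sub_cancel]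
      | zero => exact ⟨0, Submodule.zero_mem _, by
        rw [smul_zero, sub_zero]
        exact G.zero_mem⟩
      | add x x' _ _ hx hx' =>
        obtain ⟨y, hy, h⟩ := hx
        obtain ⟨y', hy', h'⟩ := hx'
        refine ⟨y + y', Submodule.add_mem _ hy hy', ?_⟩
        convert G.add_mem h h' using 1
        rw [Prod.mk_add_mk, smul_add]
        congr 1
        abel
      | smul a x _ hx =>
        obtain ⟨y, hy, h⟩ := hx
        refine ⟨a • y, Submodule.smul_mem _ _ hy, ?_⟩
        convert G.smul_mem a h using 1
        rw [Prod.smul_mk, smul_sub, smul_comm]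
    obtain ⟨y, hy, h⟩ := h1 _ (Submodule.smul_mem _ (c (n + 1) : ℂ) ih)
    have hmono : Submodule.span ℂ (⋃ j ∈ Set.Iic n, (relEigenspace G (lam j) : Set E)) ≤
        Submodule.span ℂ (⋃ j ∈ Set.Iic (n + 1), (relEigenspace G (lam j) : Set E)) :=
      Submodule.span_mono (Set.biUnion_subset_biUnion_left (Set.Iic_subset_Iic.2 n.le_succ))
    have h2 : v (n + 1) - y ∈ relEigenspace G (lam (n + 1)) := by
      rw [mem_relEigenspace]
      have := G.sub_mem (hv (n + 1)) h
      simpa [smul_sub] using this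
    have h3 := Submodule.add_mem _ (Submodule.subset_span
      (Set.mem_biUnion (Set.mem_Iic.2 (le_refl (n + 1))) h2)) (hmono hy)
    simpa using h3

end Eigen

/-! ### Closedness, symmetry and positivity of the Hamiltonian. -/

theorem isClosed_formGraph (α B₀ : ℝ) :
    IsClosed (formGraph α B₀ : Set (L2Plane × (Fin 2 → L2Plane))) :=
  Submodule.isClosed_topologicalClosure _

theorem hamiltonianGraph_symm (α B₀ : ℝ) (p : L2Plane × L2Plane) (hp : p ∈ hamiltonianGraph α B₀)
    (q : L2Plane × L2Plane) (hq : q ∈ hamiltonianGraph α B₀) :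
    inner ℂ q.1 p.2 = inner ℂ q.2 p.1 := by
  obtain ⟨G, hG, h⟩ := hp
  obtain ⟨F, hF, k⟩ := hq
  rw [← h _ hF, ← inner_conj_symm q.2 p.1, ← k _ hG, map_sum]
  exact Finset.sum_congr rfl fun j _ => (inner_conj_symm _ _).symm

/-- Testing the form identity with the eigenvector itself gives ∑ ‖Gⱼ‖² = c‖u‖². -/
theorem nonneg_of_mem_hamiltonianGraph (α B₀ : ℝ) {u : L2Plane} (hu : u ≠ 0) {c : ℝ}
    (h : (u, (c : ℂ) • u) ∈ hamiltonianGraph α B₀) : 0 ≤ c := by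
  obtain ⟨G, hG, h⟩ := h
  have h1 := h _ hG
  simp only [inner_smul_right, inner_self_eq_norm_sq_to_K] at h1
  have h2 : ∑ j, ‖G j‖ ^ 2 = c * ‖u‖ ^ 2 := by
    rw [← Complex.ofReal_inj]
    push_cast
    exact h1
  have h3 : 0 ≤ ∑ j, ‖G j‖ ^ 2 := Finset.sum_nonneg fun j _ => by positivity
  rw [h2] at h3
  exact nonneg_of_mul_nonneg_left h3 (by positivity)

/-- The point is that convergence of (u, Hu) controls the gradients. Testing the form identity on a
difference with that same difference gives ‖G_m - G_n‖² = ⟪u_m - u_n, Hu_m - Hu_n⟫, so the gradients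
are Cauchy and the limit inherits the identity. -/
theorem isClosed_hamiltonianGraph (α B₀ : ℝ) :
    IsClosed (hamiltonianGraph α B₀ : Set (L2Plane × L2Plane)) := by
  refine IsSeqClosed.isClosed fun p q hp hpq => ?_
  choose G hG h using hp
  have hd : ∀ m n, ∑ j, ‖G m j - G n j‖ ^ 2 ≤
      ‖(p m).1 - (p n).1‖ * ‖(p m).2 - (p n).2‖ := fun m n => by
    have h1 := (formGraph α B₀).sub_mem (hG m) (hG n)
    have h2 : ∑ j, inner ℂ (G m j - G n j) (G m j - G n j) =
        inner ℂ ((p m).1 - (p n).1) ((p m).2 - (p n).2) := by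
      have e1 := h m _ h1
      have e2 := h n _ h1
      simp only [Prod.snd_sub, Prod.fst_sub, Pi.sub_apply] at e1 e2
      rw [inner_sub_right ((p m).1 - (p n).1), ← e1, ← e2, ← Finset.sum_sub_distrib]
      exact Finset.sum_congr rfl fun j _ => inner_sub_right _ _ _
    simp only [inner_self_eq_norm_sq_to_K] at h2
    have h3 : ((∑ j, ‖G m j - G n j‖ ^ 2 : ℝ) : ℂ) =
        inner ℂ ((p m).1 - (p n).1) ((p m).2 - (p n).2) := by rw [← h2]; push_cast; rfl
    have h4 := norm_inner_le_norm (𝕜 := ℂ) ((p m).1 - (p n).1) ((p m).2 - (p n).2)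
    rw [← h3, Complex.norm_real] at h4
    exact (le_abs_self _).trans h4
  have hc1 : CauchySeq fun n => (p n).1 := ((continuous_fst.tendsto q).comp hpq).cauchySeq
  have hc2 : CauchySeq fun n => (p n).2 := ((continuous_snd.tendsto q).comp hpq).cauchySeq
  have hc : ∀ j, CauchySeq fun n => G n j := fun j => by
    rw [Metric.cauchySeq_iff] at hc1 hc2 ⊢
    intro ε hε
    obtain ⟨N, hN⟩ := hc1 ε hε
    obtain ⟨M, hM⟩ := hc2 ε hε
    refine ⟨max N M, fun m hm n hn => ?_⟩
    have h1 := hN m ((le_max_left _ _).trans hm) n ((le_max_left _ _).trans hn)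
    have h2 := hM m ((le_max_right _ _).trans hm) n ((le_max_right _ _).trans hn)
    rw [dist_eq_norm] at h1 h2 ⊢
    refine lt_of_pow_lt_pow_left₀ 2 hε.le ?_
    calc ‖G m j - G n j‖ ^ 2 ≤ ∑ j, ‖G m j - G n j‖ ^ 2 :=
          Finset.single_le_sum (f := fun j => ‖G m j - G n j‖ ^ 2)
            (fun i _ => by positivity) (Finset.mem_univ j)
      _ ≤ _ := hd m n
      _ < ε ^ 2 := by rw [sq]; gcongr
  choose F hF using fun j => cauchySeq_tendsto_of_complete (hc j)
  have hlim : Tendsto G atTop (𝓝 F) := tendsto_pi_nhds.2 hF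
  refine ⟨F, ?_, fun r hr => ?_⟩
  · exact (isClosed_formGraph α B₀).mem_of_tendsto
      (((continuous_fst.tendsto q).comp hpq).prodMk_nhds hlim) (Eventually.of_forall hG)
  · have h1 : Tendsto (fun n => ∑ j, inner ℂ (r.2 j) (G n j)) atTop
        (𝓝 (∑ j, inner ℂ (r.2 j) (F j))) :=
      tendsto_finsetSum _ fun j _ => tendsto_const_nhds.inner (hF j)
    have h2 : Tendsto (fun n => inner ℂ r.1 (p n).2) atTop (𝓝 (inner ℂ r.1 q.2)) :=
      tendsto_const_nhds.inner ((continuous_snd.tendsto q).comp hpq)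
    refine tendsto_nhds_unique h1 (h2.congr fun n => (h n r hr).symm)

/-! ### A logarithmic cutoff -/

/-- A smooth bump function that is `1` on `[-1, 1]` and `0` off `[-2, 2]`. -/
def smoothBump (s : ℝ) : ℝ := Real.smoothTransition (2 + s) * Real.smoothTransition (2 - s)

theorem smoothBump_eq_one {s : ℝ} (h : |s| ≤ 1) : smoothBump s = 1 := by
  rw [abs_le] at h
  rw [smoothBump, Real.smoothTransition.one_of_one_le (by linarith),
    Real.smoothTransition.one_of_one_le (by linarith), one_mul]

theorem smoothBump_eq_zero {s : ℝ} (h : 2 ≤ |s|) : smoothBump s = 0 := by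
  rw [smoothBump]
  rcases le_abs.1 h with h | h
  · rw [Real.smoothTransition.zero_of_nonpos (x := 2 - s) (by linarith), mul_zero]
  · rw [Real.smoothTransition.zero_of_nonpos (x := 2 + s) (by linarith), zero_mul]

theorem smoothBump_nonneg (s : ℝ) : 0 ≤ smoothBump s :=
  mul_nonneg (Real.smoothTransition.nonneg _) (Real.smoothTransition.nonneg _)

theorem smoothBump_le_one (s : ℝ) : smoothBump s ≤ 1 :=
  mul_le_one₀ (Real.smoothTransition.le_one _) (Real.smoothTransition.nonneg _)
    (Real.smoothTransition.le_one _)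

theorem contDiff_smoothBump : ContDiff ℝ ∞ smoothBump :=
  (Real.smoothTransition.contDiff.comp (contDiff_const.add contDiff_id)).mul
    (Real.smoothTransition.contDiff.comp (contDiff_const.sub contDiff_id))

theorem tsupport_smoothBump_subset : tsupport smoothBump ⊆ Set.Icc (-2) 2 := by
  refine closure_minimal (fun s hs => ?_) isClosed_Icc
  have h : |s| < 2 := by
    by_contra h
    exact hs (smoothBump_eq_zero (not_lt.1 h))
  exact ⟨(abs_lt.1 h).1.le, (abs_lt.1 h).2.le⟩

theorem exists_norm_deriv_smoothBump_le : ∃ C, 0 ≤ C ∧ ∀ s, ‖deriv smoothBump s‖ ≤ C := by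
  have hc : HasCompactSupport smoothBump :=
    HasCompactSupport.of_support_subset_isCompact isCompact_Icc
      ((subset_tsupport _).trans tsupport_smoothBump_subset)
  obtain ⟨C, hC⟩ := (contDiff_smoothBump.continuous_deriv (by simp)).bounded_above_of_compact_support
    hc.deriv
  exact ⟨C, (norm_nonneg _).trans (hC 0), hC⟩

/-- A cutoff function that vanishes near the origin and near infinity. -/
def logCutoff (n : ℝ) (x : Plane) : ℝ :=
  if x = 0 then 0 else smoothBump (Real.log (‖x‖ ^ 2) / n)

theorem logCutoff_nonneg (n : ℝ) (x : Plane) : 0 ≤ logCutoff n x := by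
  rw [logCutoff]; split_ifs
  exacts [le_rfl, smoothBump_nonneg _]

theorem logCutoff_le_one (n : ℝ) (x : Plane) : logCutoff n x ≤ 1 := by
  rw [logCutoff]; split_ifs
  exacts [zero_le_one, smoothBump_le_one _]

theorem logCutoff_eventuallyEq {n : ℝ} {x : Plane} (hx : x ≠ 0) :
    logCutoff n =ᶠ[𝓝 x] fun y => smoothBump (Real.log (‖y‖ ^ 2) / n) := by
  filter_upwards [isOpen_ne.mem_nhds hx] with y hy
  rw [logCutoff, if_neg hy]

theorem logCutoff_eq_zero {n : ℝ} (hn : 0 < n) {x : Plane} (hx : ‖x‖ ≤ Real.exp (-n)) :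
    logCutoff n x = 0 := by
  rw [logCutoff]; split_ifs with h
  · rfl
  · refine smoothBump_eq_zero ?_
    have h1 : 0 < ‖x‖ := norm_pos_iff.2 h
    have h2 : Real.log ‖x‖ ≤ -n := (Real.log_le_iff_le_exp h1).2 hx
    rw [Real.log_pow, abs_div, abs_of_pos hn, le_div_iff₀ hn]
    refine le_trans ?_ (neg_le_abs _)
    push_cast
    linarith

theorem logCutoff_eq_zero' {n : ℝ} (hn : 0 < n) {x : Plane} (hx : Real.exp n ≤ ‖x‖) :
    logCutoff n x = 0 := by
  rw [logCutoff]; split_ifs with h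
  · rfl
  · refine smoothBump_eq_zero ?_
    have h1 : 0 < ‖x‖ := norm_pos_iff.2 h
    have h2 : n ≤ Real.log ‖x‖ := (Real.le_log_iff_exp_le h1).2 hx
    rw [Real.log_pow, abs_div, abs_of_pos hn, le_div_iff₀ hn]
    refine le_trans ?_ (le_abs_self _)
    push_cast
    linarith

theorem contDiff_logCutoff {n : ℝ} (hn : 0 < n) : ContDiff ℝ ∞ (logCutoff n) := by
  rw [contDiff_iff_contDiffAt]
  intro x
  by_cases hx : x = 0
  · have : logCutoff n =ᶠ[𝓝 x] fun _ => 0 := by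
      have h1 : Metric.ball (0 : Plane) (Real.exp (-n)) ∈ 𝓝 x := by
        rw [hx]; exact Metric.ball_mem_nhds _ (Real.exp_pos _)
      filter_upwards [h1] with y hy
      exact logCutoff_eq_zero hn (mem_ball_zero_iff.1 hy).le
    exact contDiffAt_const.congr_of_eventuallyEq this
  · refine ContDiffAt.congr_of_eventuallyEq ?_ (logCutoff_eventuallyEq hx)
    have h2 : ContDiffAt ℝ ∞ (fun y : Plane => ‖y‖ ^ 2) x := contDiffAt_id.norm_sq ℝ
    have h3 : ‖x‖ ^ 2 ≠ 0 := pow_ne_zero 2 (norm_ne_zero_iff.2 hx)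
    exact contDiff_smoothBump.contDiffAt.comp x ((h2.log h3).div_const n)

theorem tsupport_logCutoff_subset {n : ℝ} (hn : 0 < n) :
    tsupport (logCutoff n) ⊆ Metric.closedBall 0 (Real.exp n) \ Metric.ball 0 (Real.exp (-n)) := by
  refine closure_minimal (fun x hx => ⟨?_, fun h => ?_⟩)
    (Metric.isClosed_closedBall.sdiff Metric.isOpen_ball)
  · rw [mem_closedBall_zero_iff]
    by_contra h
    exact hx (logCutoff_eq_zero' hn (not_le.1 h).le)
  · exact hx (logCutoff_eq_zero hn (mem_ball_zero_iff.1 h).le)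

/-- The gradient of log(|x|²)/n has norm 2/(n|x|). The gain 1/n over a scaling-invariant cutoff is
what makes the cutoff error vanish in dimension two. -/
theorem exists_norm_fderiv_logCutoff_le : ∃ C, 0 ≤ C ∧ ∀ n : ℝ, 0 < n → ∀ x : Plane, x ≠ 0 →
    ‖fderiv ℝ (logCutoff n) x‖ ≤ C / (n * ‖x‖) := by
  obtain ⟨C, hC0, hC⟩ := exists_norm_deriv_smoothBump_le
  refine ⟨2 * C, by positivity, fun n hn x hx => ?_⟩
  have hx0 : 0 < ‖x‖ := norm_pos_iff.2 hx
  have h1 : HasFDerivAt (fun y : Plane => ‖y‖ ^ 2) (2 • innerSL ℝ x) x :=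
    (hasStrictFDerivAt_norm_sq x).hasFDerivAt
  have h2 := (h1.log (by positivity)).mul_const n⁻¹
  have h3 := ((contDiff_smoothBump.differentiable (by simp)) _).hasDerivAt.comp_hasFDerivAt x h2
  have h4 : fderiv ℝ (logCutoff n) x = _ :=
    ((h3.congr_of_eventuallyEq (f₁ := logCutoff n)
      (by simpa only [div_eq_mul_inv] using! logCutoff_eventuallyEq hx)).fderiv)
  rw [h4, norm_smul, norm_smul, norm_smul, norm_inv, norm_inv, norm_pow, norm_norm,
    Real.norm_of_nonneg hn.le]
  have h5 : ‖2 • innerSL ℝ x‖ ≤ 2 * ‖x‖ := by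
    rw [two_smul, two_mul]
    exact (norm_add_le _ _).trans (by rw [innerSL_apply_norm])
  calc _ ≤ C * (n⁻¹ * ((‖x‖ ^ 2)⁻¹ * (2 * ‖x‖))) := by gcongr; exact hC _
    _ = _ := by field_simp

theorem fderiv_logCutoff_eq_zero {n : ℝ} (hn : 0 < n) {x : Plane} (hx : ‖x‖ < Real.exp (-n)) :
    fderiv ℝ (logCutoff n) x = 0 := by
  have : logCutoff n =ᶠ[𝓝 x] fun _ => 0 := by
    have h1 : Metric.ball (0 : Plane) (Real.exp (-n)) ∈ 𝓝 x :=
      Metric.isOpen_ball.mem_nhds (mem_ball_zero_iff.2 hx)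
    filter_upwards [h1] with y hy
    exact logCutoff_eq_zero hn (mem_ball_zero_iff.1 hy).le
  rw [this.fderiv_eq]
  simp

theorem logCutoff_eventually_eq_one {x : Plane} (hx : x ≠ 0) :
    ∀ᶠ n : ℝ in atTop, logCutoff n x = 1 := by
  filter_upwards [eventually_ge_atTop |Real.log (‖x‖ ^ 2)|, eventually_gt_atTop 0] with n hn hn0
  rw [logCutoff, if_neg hx]
  refine smoothBump_eq_one ?_
  rw [abs_div, abs_of_pos hn0, div_le_one hn0]
  exact hn

/-- Equality near each point of K, rather than on K alone, makes the derivatives agree as well. -/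
theorem exists_logCutoff_eq_one {K : Set Plane} (hK : IsCompact K) (h0 : (0 : Plane) ∉ K) :
    ∃ n : ℝ, 0 < n ∧ ∀ x ∈ K, logCutoff n =ᶠ[𝓝 x] fun _ => 1 := by
  have hc : ContinuousOn (fun x : Plane => Real.log (‖x‖ ^ 2)) K := by
    refine ContinuousOn.log (by fun_prop) fun x hx => ?_
    have : x ≠ 0 := fun h => h0 (h ▸ hx)
    exact pow_ne_zero 2 (norm_ne_zero_iff.2 this)
  obtain ⟨C, hC⟩ := hK.exists_bound_of_continuousOn hc
  refine ⟨|C| + 1, by positivity, fun x hx => ?_⟩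
  have hx0 : x ≠ 0 := fun h => h0 (h ▸ hx)
  have h1 : ContinuousAt (fun x : Plane => |Real.log (‖x‖ ^ 2)|) x := by
    refine (ContinuousAt.log (by fun_prop) ?_).abs
    exact pow_ne_zero 2 (norm_ne_zero_iff.2 hx0)
  have h2 : |Real.log (‖x‖ ^ 2)| < |C| + 1 :=
    (hC x hx).trans_lt ((le_abs_self C).trans_lt (lt_add_one _))
  filter_upwards [h1.eventually_lt_const h2, isOpen_ne.mem_nhds hx0] with y hy hy0
  rw [logCutoff, if_neg hy0]
  refine smoothBump_eq_one ?_
  rw [abs_div, abs_of_pos (by positivity : 0 < |C| + 1), div_le_one (by positivity)]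
  exact hy.le

/-! ### Elements of the form domain -/

theorem norm_toLp_sq {f : Plane → ℂ} (hf : MemLp f 2 volume) :
    ‖hf.toLp f‖ ^ 2 = ∫ x, ‖f x‖ ^ 2 := by
  have h1 : ((‖hf.toLp f‖ ^ 2 : ℝ) : ℂ) = inner ℂ (hf.toLp f) (hf.toLp f) := by
    rw [inner_self_eq_norm_sq_to_K]
    push_cast
    rfl
  rw [L2.inner_def] at h1
  have h2 : ∫ x, inner ℂ (hf.toLp f x) (hf.toLp f x) = ∫ x, ((‖f x‖ ^ 2 : ℝ) : ℂ) := by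
    refine integral_congr_ae ?_
    filter_upwards [hf.coeFn_toLp] with x hx
    rw [hx, inner_self_eq_norm_sq_to_K]
    push_cast
    rfl
  rw [h2, integral_complex_ofReal] at h1
  exact_mod_cast h1

theorem tendsto_toLp_of_dominated {F : ℕ → Plane → ℂ} {f : Plane → ℂ}
    (hF : ∀ n, MemLp (F n) 2 volume) (hf : MemLp f 2 volume) {bound : Plane → ℝ}
    (hb : Integrable bound volume) (h1 : ∀ n, ∀ᵐ x ∂volume, ‖F n x - f x‖ ^ 2 ≤ bound x)
    (h2 : ∀ᵐ x ∂volume, Tendsto (fun n => F n x) atTop (𝓝 (f x))) :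
    Tendsto (fun n => (hF n).toLp (F n)) atTop (𝓝 (hf.toLp f)) := by
  rw [tendsto_iff_norm_sub_tendsto_zero]
  have h3 : Tendsto (fun n => ‖(hF n).toLp (F n) - hf.toLp f‖ ^ 2) atTop (𝓝 0) := by
    have h4 : ∀ n, ‖(hF n).toLp (F n) - hf.toLp f‖ ^ 2 = ∫ x, ‖F n x - f x‖ ^ 2 := fun n => by
      rw [← MemLp.toLp_sub, norm_toLp_sq]
      rfl
    simp only [h4]
    have h5 := tendsto_integral_of_dominated_convergence (f := fun _ => (0 : ℝ)) bound
      (F := fun n x => ‖F n x - f x‖ ^ 2)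
      (fun n => (((hF n).sub hf).aestronglyMeasurable.norm.pow 2)) hb
      (fun n => by
        filter_upwards [h1 n] with x hx
        rwa [Real.norm_of_nonneg (by positivity)])
      (by
        filter_upwards [h2] with x hx
        have := (hx.sub_const (f x)).norm.pow 2
        simpa using this)
    simpa using h5
  simpa using h3.sqrt

theorem support_logCutoff_smul_subset (n : ℝ) (v : Plane → ℂ) :
    Function.support (fun x => logCutoff n x • v x) ⊆ Function.support (logCutoff n) :=
  fun x hx h => hx (by simp [h])

theorem IsTestFun.logCutoff_smul {v : Plane → ℂ} (hv : ∀ x, x ≠ 0 → ContDiffAt ℝ ∞ v x) {n : ℝ}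
    (hn : 0 < n) : IsTestFun (fun x => logCutoff n x • v x) where
  smooth := by
    rw [contDiff_iff_contDiffAt]
    intro x
    by_cases hx : x = 0
    · have h1 : (fun y => logCutoff n y • v y) =ᶠ[𝓝 x] fun _ => 0 := by
        have h1 : Metric.ball (0 : Plane) (Real.exp (-n)) ∈ 𝓝 x := by
          rw [hx]; exact Metric.ball_mem_nhds _ (Real.exp_pos _)
        filter_upwards [h1] with y hy
        rw [logCutoff_eq_zero hn (mem_ball_zero_iff.1 hy).le, zero_smul]
      exact contDiffAt_const.congr_of_eventuallyEq h1
    · exact (contDiff_logCutoff hn).contDiffAt.smul (hv x hx)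
  compact := by
    refine HasCompactSupport.of_support_subset_isCompact (isCompact_closedBall 0 (Real.exp n)) ?_
    refine (support_logCutoff_smul_subset n v).trans ((subset_tsupport _).trans ?_)
    exact (tsupport_logCutoff_subset hn).trans Set.sdiff_subset
  zero_notMem := fun h => by
    have h1 : tsupport (fun x => logCutoff n x • v x) ⊆ tsupport (logCutoff n) :=
      closure_mono (support_logCutoff_smul_subset n v)
    exact (tsupport_logCutoff_subset hn (h1 h)).2 (Metric.mem_ball_self (Real.exp_pos _))

theorem covDeriv_smul (α B₀ : ℝ) (j : Fin 2) {χ : Plane → ℝ} {v : Plane → ℂ} {x : Plane}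
    (hχ : DifferentiableAt ℝ χ x) (hv : DifferentiableAt ℝ v x) :
    covDeriv α B₀ j (fun y => χ y • v y) x =
      χ x • covDeriv α B₀ j v x + fderiv ℝ χ x (EuclideanSpace.single j 1) • v x := by
  rw [covDeriv, covDeriv, fderiv_fun_smul hχ hv]
  simp only [add_apply, smul_apply, ContinuousLinearMap.smulRight_apply, Complex.real_smul]
  ring

theorem covDeriv_congr (α B₀ : ℝ) (j : Fin 2) {v w : Plane → ℂ} {x : Plane} (h : v =ᶠ[𝓝 x] w) :
    covDeriv α B₀ j v =ᶠ[𝓝 x] covDeriv α B₀ j w := by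
  filter_upwards [h.eventuallyEq_nhds] with y hy
  rw [covDeriv, covDeriv, hy.fderiv_eq, hy.self_of_nhds]

theorem ae_ne_zero_plane : ∀ᵐ x ∂(volume : Measure Plane), x ≠ 0 :=
  measure_eq_zero_iff_ae_notMem.1 (measure_singleton (0 : Plane))

/-- In polar coordinates the integrand becomes 1/r on [e^{-n}, 1], whose integral is n. The inner
radius is that of the disc where the cutoff vanishes. -/
theorem integral_inv_sq_annulus {n : ℝ} (hn : 0 < n) :
    Integrable (fun x : Plane => (Set.Icc (Real.exp (-n)) 1).indicator (fun r => (r ^ 2)⁻¹) ‖x‖) ∧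
    ∫ x : Plane, (Set.Icc (Real.exp (-n)) 1).indicator (fun r => (r ^ 2)⁻¹) ‖x‖ =
      2 * (volume : Measure Plane).real (Metric.ball 0 1) * n := by
  have h1 : Real.exp (-n) ≤ 1 := Real.exp_le_one_iff.2 (by linarith)
  have h0 : 0 < Real.exp (-n) := Real.exp_pos _
  have h2 : ∀ y ∈ Set.Ioi (0 : ℝ), y ^ (Module.finrank ℝ Plane - 1) •
      (Set.Icc (Real.exp (-n)) 1).indicator (fun r => (r ^ 2)⁻¹) y =
      (Set.Icc (Real.exp (-n)) 1).indicator (fun r => r⁻¹) y := fun y hy => by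
    have hy : 0 < y := hy
    rw [finrank_euclideanSpace_fin]
    by_cases h : y ∈ Set.Icc (Real.exp (-n)) 1
    · rw [Set.indicator_of_mem h, Set.indicator_of_mem h, smul_eq_mul]
      field_simp
      norm_num
    · rw [Set.indicator_of_notMem h, Set.indicator_of_notMem h, smul_zero]
  have h3 : IntegrableOn (fun r : ℝ => r⁻¹) (Set.Icc (Real.exp (-n)) 1) := by
    refine ContinuousOn.integrableOn_Icc (continuousOn_inv₀.mono fun r hr => ?_)
    exact (h0.trans_le hr.1).ne'
  constructor
  · rw [integrable_fun_norm_addHaar, integrableOn_congr_fun h2 measurableSet_Ioi]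
    exact ((integrable_indicator_iff measurableSet_Icc).2 h3).integrableOn
  · rw [integral_fun_norm_addHaar, setIntegral_congr_fun measurableSet_Ioi h2,
      setIntegral_indicator measurableSet_Icc, finrank_euclideanSpace_fin]
    have h4 : Set.Ioi 0 ∩ Set.Icc (Real.exp (-n)) 1 = Set.Icc (Real.exp (-n)) 1 :=
      Set.inter_eq_right.2 fun r hr => h0.trans_le hr.1
    rw [h4, integral_Icc_eq_integral_Ioc, ← intervalIntegral.integral_of_le h1,
      integral_inv_of_pos h0 one_pos, one_div, ← Real.exp_neg, neg_neg, Real.log_exp]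
    simp [mul_assoc]

/-- Multiply v by the logarithmic cutoffs χ_n. The covariant gradient of χ_n v is χ_n times that of
v plus an error ∇χ_n v, and the error tends to 0 in L². Boundedness near the origin is what this
requires of v. -/
theorem mem_formGraph_of_bounded {α B₀ : ℝ} {v : Plane → ℂ}
    (hs : ∀ x, x ≠ 0 → ContDiffAt ℝ ∞ v x) (hv : MemLp v 2 volume)
    (hd : ∀ j, MemLp (covDeriv α B₀ j v) 2 volume) {M : ℝ} (hM : ∀ x, ‖v x‖ ≤ M) :
    (hv.toLp v, fun j => (hd j).toLp (covDeriv α B₀ j v)) ∈ formGraph α B₀ := by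
  set N : ℕ → ℝ := fun n => (n : ℝ) + 1 with hN
  have hN0 : ∀ n, 0 < N n := fun n => by positivity
  have hNt : Tendsto N atTop atTop :=
    tendsto_atTop_add_const_right _ _ tendsto_natCast_atTop_atTop
  have hcut : ∀ {w : Plane → ℂ}, MemLp w 2 volume →
      ∀ n, MemLp (fun x => logCutoff (N n) x • w x) 2 volume := fun hw n =>
    hw.mono ((contDiff_logCutoff (hN0 n)).continuous.aestronglyMeasurable.smul
      hw.aestronglyMeasurable) (ae_of_all _ fun x => by
        rw [norm_smul, Real.norm_of_nonneg (logCutoff_nonneg _ _)]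
        exact mul_le_of_le_one_left (norm_nonneg _) (logCutoff_le_one _ _))
  have hlim : ∀ {w : Plane → ℂ} (hw : MemLp w 2 volume),
      Tendsto (fun n => (hcut hw n).toLp _) atTop (𝓝 (hw.toLp w)) := fun {w} hw => by
    refine tendsto_toLp_of_dominated (hcut hw) hw (hw.integrable_norm_pow (by norm_num))
      (fun n => ae_of_all _ fun x => ?_) ?_
    · have e : logCutoff (N n) x • w x - w x = (logCutoff (N n) x - 1) • w x := by
        rw [sub_smul, one_smul]
      rw [e, norm_smul]
      have h1 : ‖logCutoff (N n) x - 1‖ ≤ 1 := by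
        have h1 := logCutoff_nonneg (N n) x
        have h2 := logCutoff_le_one (N n) x
        rw [Real.norm_eq_abs, abs_le]
        constructor <;> linarith
      have h2 := mul_le_of_le_one_left (norm_nonneg (w x)) h1
      gcongr
    · filter_upwards [ae_ne_zero_plane] with x hx
      refine tendsto_const_nhds.congr' ?_
      filter_upwards [hNt.eventually (logCutoff_eventually_eq_one hx)] with n hn
      rw [hn, one_smul]
  have htest : ∀ n, IsTestFun (fun x => logCutoff (N n) x • v x) := fun n =>
    IsTestFun.logCutoff_smul hs (hN0 n)
  obtain ⟨C, hC0, hC⟩ := exists_norm_fderiv_logCutoff_le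
  have hder : ∀ j n, covDeriv α B₀ j (fun x => logCutoff (N n) x • v x) =ᵐ[volume]
      (fun x => logCutoff (N n) x • covDeriv α B₀ j v x) +
      fun x => fderiv ℝ (logCutoff (N n)) x (EuclideanSpace.single j 1) • v x := fun j n => by
    filter_upwards [ae_ne_zero_plane] with x hx
    exact covDeriv_smul α B₀ j ((contDiff_logCutoff (hN0 n)).differentiable (by simp) x)
      ((hs x hx).differentiableAt (by simp))
  have hE : ∀ j n, MemLp (fun x => fderiv ℝ (logCutoff (N n)) x (EuclideanSpace.single j 1) • v x)
      2 volume := fun j n => by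
    have h1 := ((htest n).covDeriv α B₀ j).memLp.sub (hcut (hd j) n)
    refine h1.ae_eq ?_
    filter_upwards [hder j n] with x hx
    rw [Pi.sub_apply, hx]
    simp
  -- Inside the unit disc |v| ≤ M and |∇χ_n|² ≤ C²/(n²|x|²), with integral of order n/n² = 1/n;
  -- outside it |∇χ_n| ≤ C/n and v is square integrable.
  have hEn : ∀ j n, ‖(hE j n).toLp _‖ ^ 2 ≤ C ^ 2 * (M ^ 2 *
      (2 * (volume : Measure Plane).real (Metric.ball 0 1))) * (N n)⁻¹ +
      C ^ 2 * (∫ x, ‖v x‖ ^ 2) * (N n)⁻¹ ^ 2 := fun j n => by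
    obtain ⟨hi, hi'⟩ := integral_inv_sq_annulus (hN0 n)
    have hv2 : Integrable (fun x => ‖v x‖ ^ 2) volume := by
      simpa using hv.integrable_norm_pow (by norm_num)
    rw [norm_toLp_sq]
    have h1 : ∫ x, ‖fderiv ℝ (logCutoff (N n)) x (EuclideanSpace.single j 1) • v x‖ ^ 2 ≤
        ∫ x, ((C ^ 2 * (N n)⁻¹ ^ 2 * M ^ 2) *
          (Set.Icc (Real.exp (-N n)) 1).indicator (fun r => (r ^ 2)⁻¹) ‖x‖ +
          (C ^ 2 * (N n)⁻¹ ^ 2) * ‖v x‖ ^ 2) := by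
      refine integral_mono_ae (by simpa using (hE j n).integrable_norm_pow (by norm_num))
        ((hi.const_mul _).add (hv2.const_mul _)) ?_
      filter_upwards [ae_ne_zero_plane] with x hx
      have hx0 : 0 < ‖x‖ := norm_pos_iff.2 hx
      have h2 : ‖fderiv ℝ (logCutoff (N n)) x (EuclideanSpace.single j 1)‖ ≤
          C * ((N n)⁻¹ * ‖x‖⁻¹) := by
        have h3 := (fderiv ℝ (logCutoff (N n)) x).le_opNorm (EuclideanSpace.single j 1)
        rw [PiLp.norm_single, norm_one, mul_one] at h3
        refine h3.trans ((hC _ (hN0 n) x hx).trans_eq ?_)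
        rw [div_eq_mul_inv, mul_inv]
      have hind : 0 ≤ (Set.Icc (Real.exp (-N n)) 1).indicator (fun r => (r ^ 2)⁻¹) ‖x‖ :=
        Set.indicator_nonneg (fun r _ => by positivity) _
      rw [norm_smul, mul_pow]
      rcases lt_or_ge ‖x‖ (Real.exp (-N n)) with h4 | h4
      · rw [fderiv_logCutoff_eq_zero (hN0 n) h4]
        simp only [zero_apply, norm_zero, ne_eq, OfNat.ofNat_ne_zero, not_false_eq_true, zero_pow,
          zero_mul]
        have := hN0 n
        positivity
      · rcases le_total ‖x‖ 1 with h5 | h5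
        · rw [Set.indicator_of_mem (Set.mem_Icc.2 ⟨h4, h5⟩)]
          calc _ ≤ (C * ((N n)⁻¹ * ‖x‖⁻¹)) ^ 2 * M ^ 2 := by gcongr; exact hM x
            _ = C ^ 2 * (N n)⁻¹ ^ 2 * M ^ 2 * (‖x‖ ^ 2)⁻¹ := by ring
            _ ≤ _ := le_add_of_nonneg_right (by positivity)
        · calc _ ≤ (C * ((N n)⁻¹ * 1)) ^ 2 * ‖v x‖ ^ 2 := by
                gcongr
                refine h2.trans ?_
                have := hN0 n
                gcongr
                exact inv_le_one_of_one_le₀ h5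
            _ = (C ^ 2 * (N n)⁻¹ ^ 2) * ‖v x‖ ^ 2 := by ring
            _ ≤ _ := le_add_of_nonneg_left (by positivity)
    refine h1.trans_eq ?_
    rw [integral_add (hi.const_mul _) (hv2.const_mul _), integral_const_mul, integral_const_mul,
      hi']
    have := (hN0 n).ne'
    field_simp
  have hE0 : ∀ j, Tendsto (fun n => (hE j n).toLp _) atTop (𝓝 0) := fun j => by
    rw [tendsto_zero_iff_norm_tendsto_zero]
    have h1 : Tendsto (fun n => (N n)⁻¹) atTop (𝓝 0) := tendsto_inv_atTop_zero.comp hNt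
    have h2 := (h1.const_mul (C ^ 2 * (M ^ 2 *
      (2 * (volume : Measure Plane).real (Metric.ball 0 1))))).add
      ((h1.pow 2).const_mul (C ^ 2 * (∫ x, ‖v x‖ ^ 2)))
    have h3 : Tendsto (fun n => ‖(hE j n).toLp _‖ ^ 2) atTop (𝓝 0) :=
      squeeze_zero (fun n => by positivity) (hEn j) (by simpa using h2)
    simpa using h3.sqrt
  refine (isClosed_formGraph α B₀).mem_of_tendsto (b := atTop) (f := fun n =>
    ((htest n).toL2, fun j => ((htest n).covDeriv α B₀ j).toL2)) ?_ (Eventually.of_forall fun n =>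
      (testGraph α B₀).le_topologicalClosure ((htest n).mem_testGraph α B₀))
  refine Tendsto.prodMk_nhds (hlim hv) (tendsto_pi_nhds.2 fun j => ?_)
  have h1 := (hlim (hd j)).add (hE0 j)
  rw [add_zero] at h1
  refine h1.congr fun n => ?_
  rw [← MemLp.toLp_add, IsTestFun.toL2, MemLp.toLp_eq_toLp_iff]
  exact (hder j n).symm

/-- The form identity is closed in the test pair, so it suffices to take test functions φ. Their
supports avoid the origin, where v may be singular, and integration by parts gives the classical
expression. -/
theorem mem_hamiltonianGraph_of_smooth {α B₀ : ℝ} {v w : Plane → ℂ}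
    (hs : ∀ x, x ≠ 0 → ContDiffAt ℝ ∞ v x) (hv : MemLp v 2 volume)
    (hd : ∀ j, MemLp (covDeriv α B₀ j v) 2 volume) {M : ℝ} (hM : ∀ x, ‖v x‖ ≤ M)
    (hw : MemLp w 2 volume)
    (h : ∀ x, x ≠ 0 → ∑ j, covDeriv α B₀ j (covDeriv α B₀ j v) x = -w x) :
    (hv.toLp v, hw.toLp w) ∈ hamiltonianGraph α B₀ := by
  refine ⟨fun j => (hd j).toLp _, mem_formGraph_of_bounded hs hv hd hM, ?_⟩
  have hc : IsClosed {q : L2Plane × (Fin 2 → L2Plane) |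
      ∑ j, inner ℂ (q.2 j) ((hd j).toLp (covDeriv α B₀ j v)) = inner ℂ q.1 (hw.toLp w)} :=
    isClosed_eq (by fun_prop) (by fun_prop)
  refine closure_minimal ?_ hc
  rintro q ⟨φ, k, hq1, hq2⟩
  change ∑ j, inner ℂ (q.2 j) ((hd j).toLp (covDeriv α B₀ j v)) = inner ℂ q.1 (hw.toLp w)
  obtain ⟨n, hn, hn1⟩ := exists_logCutoff_eq_one k.compact k.zero_notMem
  -- Near the support of φ this agrees with v, but it is a test function, so integration by parts
  -- between test functions applies.
  set ψ : Plane → ℂ := fun x => logCutoff n x • v x with hψ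
  have kψ : IsTestFun ψ := IsTestFun.logCutoff_smul hs hn
  have hloc : ∀ x ∈ tsupport φ, ψ =ᶠ[𝓝 x] v := fun x hx => by
    filter_upwards [hn1 x hx] with y hy
    rw [hψ]
    simp [hy]
  have h1 : ∀ j, inner ℂ (q.2 j) ((hd j).toLp (covDeriv α B₀ j v)) =
      -∫ x, covDeriv α B₀ j (covDeriv α B₀ j ψ) x * (starRingEnd ℂ) (φ x) := fun j => by
    rw [integral_covDeriv_mul_conj (kψ.covDeriv α B₀ j) k, neg_neg, L2.inner_def]
    refine integral_congr_ae ?_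
    filter_upwards [hq2 j, (hd j).coeFn_toLp] with x h1 h2
    rw [h1, h2, RCLike.inner_apply]
    by_cases hx : x ∈ tsupport φ
    · rw [(covDeriv_congr α B₀ j (hloc x hx)).self_of_nhds]
    · rw [image_eq_zero_of_notMem_tsupport fun h => hx (tsupport_covDeriv_subset α B₀ j φ h)]
      simp
  rw [Finset.sum_congr rfl fun j _ => h1 j, Finset.sum_neg_distrib, ← integral_finsetSum,
    ← integral_neg, L2.inner_def]
  · refine integral_congr_ae ?_
    filter_upwards [hq1, hw.coeFn_toLp] with x h1 h2
    rw [h1, h2, RCLike.inner_apply, ← Finset.sum_mul]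
    by_cases hx : x ∈ tsupport φ
    · have hx0 : x ≠ 0 := fun h => k.zero_notMem (h ▸ hx)
      have h3 := h x hx0
      rw [← neg_eq_iff_eq_neg] at h3
      rw [← h3, neg_mul]
      congr 2
      exact Finset.sum_congr rfl fun j _ =>
        (covDeriv_congr α B₀ j (covDeriv_congr α B₀ j (hloc x hx))).self_of_nhds
    · rw [image_eq_zero_of_notMem_tsupport hx]
      simp
  · intro j _
    exact ((kψ.covDeriv α B₀ j).covDeriv α B₀ j).integrable_mul k.conj

/-! ### Functions of the form `z^k h(|z|²)` -/

/-- The identification of the plane with `ℂ`. -/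
def planeComplex : Plane →L[ℝ] ℂ :=
  Complex.ofRealCLM.comp (EuclideanSpace.proj (0 : Fin 2)) +
    Complex.I • Complex.ofRealCLM.comp (EuclideanSpace.proj (1 : Fin 2))

theorem planeComplex_apply (x : Plane) : planeComplex x = (x 0 : ℂ) + Complex.I * (x 1 : ℂ) := by
  simp [planeComplex]

theorem planeComplex_eq_mk (x : Plane) : planeComplex x = ⟨x 0, x 1⟩ := by
  rw [planeComplex_apply]
  apply Complex.ext <;> simp

theorem plane_norm_sq (x : Plane) : ‖x‖ ^ 2 = x 0 ^ 2 + x 1 ^ 2 := by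
  rw [EuclideanSpace.norm_sq_eq, Fin.sum_univ_two]
  simp

theorem norm_planeComplex (x : Plane) : ‖planeComplex x‖ = ‖x‖ := by
  rw [← sq_eq_sq₀ (norm_nonneg _) (norm_nonneg _), planeComplex_eq_mk, Complex.sq_norm,
    Complex.normSq_mk, plane_norm_sq]
  ring

theorem planeComplex_ne_zero {x : Plane} (hx : x ≠ 0) : planeComplex x ≠ 0 := by
  rw [← norm_ne_zero_iff, norm_planeComplex]
  exact norm_ne_zero_iff.2 hx

/-- The function `z^k h(|z|²)` on the plane. -/
def zpowRadial (k : ℤ) (h : ℝ → ℝ) (x : Plane) : ℂ := planeComplex x ^ k * (h (‖x‖ ^ 2) : ℂ)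

/-- The vectors `1, i`. -/
def complexUnit (j : Fin 2) : ℂ := planeComplex (EuclideanSpace.single j 1)

theorem complexUnit_zero : complexUnit 0 = 1 := by simp [complexUnit, planeComplex_apply]

theorem complexUnit_one : complexUnit 1 = Complex.I := by simp [complexUnit, planeComplex_apply]

theorem hasFDerivAt_zpowRadial (k : ℤ) {h : ℝ → ℝ} {h' : ℝ} {x : Plane} (hx : x ≠ 0)
    (hh : HasDerivAt h h' (‖x‖ ^ 2)) :
    ∃ L : Plane →L[ℝ] ℂ, HasFDerivAt (zpowRadial k h) L x ∧ ∀ j,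
      L (EuclideanSpace.single j 1) = k * complexUnit j * planeComplex x ^ (k - 1) *
        (h (‖x‖ ^ 2) : ℂ) + 2 * (x j : ℂ) * planeComplex x ^ k * (h' : ℂ) := by
  have h1 : HasFDerivAt (fun y : Plane => ‖y‖ ^ 2) (2 • innerSL ℝ x) x :=
    (hasStrictFDerivAt_norm_sq x).hasFDerivAt
  have h2 := Complex.ofRealCLM.hasFDerivAt.comp x (hh.comp_hasFDerivAt x h1)
  have h3 := (hasDerivAt_zpow k (planeComplex x)
    (Or.inl (planeComplex_ne_zero hx))).complexToReal_fderiv.comp x planeComplex.hasFDerivAt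
  refine ⟨_, h3.mul h2, fun j => ?_⟩
  have h4 : inner ℝ x (EuclideanSpace.single j (1 : ℝ)) = x j := by
    rw [EuclideanSpace.inner_single_right]
    simp
  simp [complexUnit, h4]
  ring

theorem fderiv_zpowRadial (k : ℤ) {h : ℝ → ℝ} {h' : ℝ} {x : Plane} (hx : x ≠ 0)
    (hh : HasDerivAt h h' (‖x‖ ^ 2)) (j : Fin 2) :
    fderiv ℝ (zpowRadial k h) x (EuclideanSpace.single j 1) =
      k * complexUnit j * planeComplex x ^ (k - 1) *
        (h (‖x‖ ^ 2) : ℂ) + 2 * (x j : ℂ) * planeComplex x ^ k * (h' : ℂ) := by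
  obtain ⟨L, hL, hL'⟩ := hasFDerivAt_zpowRadial k hx hh
  rw [hL.fderiv, hL' j]

theorem contDiffAt_zpowRadial (k : ℤ) {h : ℝ → ℝ} {x : Plane} (hx : x ≠ 0)
    (hh : ContDiffAt ℝ ∞ h (‖x‖ ^ 2)) : ContDiffAt ℝ ∞ (zpowRadial k h) x := by
  have h1 : ContDiffAt ℝ ∞ (fun y : Plane => planeComplex y ^ k) x := by
    have h0 := planeComplex_ne_zero hx
    have h2 : ContDiffAt ℝ ∞ (fun y : Plane => planeComplex y) x := planeComplex.contDiff.contDiffAt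
    cases k with
    | ofNat n => simpa using h2.pow n
    | negSucc n =>
      simp only [zpow_negSucc]
      exact (h2.pow (n + 1)).inv (pow_ne_zero _ h0)
  have h2 : ContDiffAt ℝ ∞ (fun y : Plane => ‖y‖ ^ 2) x := contDiffAt_id.norm_sq ℝ
  exact h1.mul (Complex.ofRealCLM.contDiff.contDiffAt.comp x
    (ContDiffAt.comp x (f := fun y : Plane => ‖y‖ ^ 2) hh h2))

/-- The vector field `(-x₂, x₁)`. -/
def rotField (x : Plane) : Fin 2 → ℝ := ![-(x 1), x 0]

/-- The angular profile of the potential: `A = (α / ρ + B₀ / 2) (-x₂, x₁)`, `ρ = |x|²`. -/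
def angularProfile (α B₀ ρ : ℝ) : ℝ := α / ρ + B₀ / 2

theorem potential_eq (α B₀ : ℝ) (x : Plane) (j : Fin 2) :
    abPotential α x j + hmfPotential B₀ x j = rotField x j * angularProfile α B₀ (‖x‖ ^ 2) := by
  fin_cases j <;> simp [abPotential, hmfPotential, rotField, angularProfile] <;> ring

theorem covDeriv_zpowRadial (α B₀ : ℝ) (k : ℤ) {h : ℝ → ℝ} {h' : ℝ} {x : Plane} (hx : x ≠ 0)
    (hh : HasDerivAt h h' (‖x‖ ^ 2)) (j : Fin 2) :
    covDeriv α B₀ j (zpowRadial k h) x =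
      k * complexUnit j * planeComplex x ^ (k - 1) * (h (‖x‖ ^ 2) : ℂ) +
      2 * (x j : ℂ) * (planeComplex x ^ k * (h' : ℂ)) +
      Complex.I * (rotField x j : ℂ) *
        (planeComplex x ^ k * ((angularProfile α B₀ (‖x‖ ^ 2) * h (‖x‖ ^ 2) : ℝ) : ℂ)) := by
  rw [covDeriv, fderiv_zpowRadial k hx hh, potential_eq, zpowRadial]
  push_cast
  ring

/-- With A = a(ρ)(-x₂, x₁), the Laplacian of z^k h contributes 4ρh'' + 4(k + 1)h', the cross term
2iA·∇ contributes -2ka h because z^k has angular derivative ik z^k, and -|A|² contributes -a²ρh.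
There is no further term since A is divergence free. -/
theorem sum_covDeriv_covDeriv_zpowRadial (α B₀ : ℝ) (k : ℤ) {h h' : ℝ → ℝ} {h'' : ℝ} {x : Plane}
    (hx : x ≠ 0) (hh : ∀ ρ, 0 < ρ → HasDerivAt h (h' ρ) ρ)
    (hh' : HasDerivAt h' h'' (‖x‖ ^ 2)) :
    ∑ j, covDeriv α B₀ j (covDeriv α B₀ j (zpowRadial k h)) x =
      planeComplex x ^ k * ((4 * ‖x‖ ^ 2 * h'' + 4 * (k + 1) * h' (‖x‖ ^ 2) -
        (2 * k * angularProfile α B₀ (‖x‖ ^ 2) + angularProfile α B₀ (‖x‖ ^ 2) ^ 2 * ‖x‖ ^ 2) *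
          h (‖x‖ ^ 2) : ℝ) : ℂ) := by
  have hρ : 0 < ‖x‖ ^ 2 := pow_pos (norm_pos_iff.2 hx) 2
  set a : ℝ → ℝ := angularProfile α B₀ with ha
  have hda : HasDerivAt a (-α / (‖x‖ ^ 2) ^ 2) (‖x‖ ^ 2) := by
    have := ((hasDerivAt_const (‖x‖ ^ 2) α).div (hasDerivAt_id (‖x‖ ^ 2)) hρ.ne').add_const (B₀ / 2)
    refine this.congr_deriv ?_
    simp
  have hdah := hda.mul (hh _ hρ)
  -- A first covariant derivative is again a combination of functions z^l g(|z|²) with linear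
  -- coefficients, so the same derivative formula can be applied again.
  have hloc : ∀ j, covDeriv α B₀ j (zpowRadial k h) =ᶠ[𝓝 x] fun y =>
      (k * complexUnit j) * zpowRadial (k - 1) h y + 2 * (y j : ℂ) * zpowRadial k h' y +
        Complex.I * (rotField y j : ℂ) * zpowRadial k (a * h) y := fun j => by
    filter_upwards [isOpen_ne.mem_nhds hx] with y hy
    rw [covDeriv_zpowRadial α B₀ k hy (hh _ (pow_pos (norm_pos_iff.2 hy) 2))]
    simp only [zpowRadial, Pi.mul_apply, mul_assoc, ha]
  obtain ⟨L1, hL1, e1⟩ := hasFDerivAt_zpowRadial (k - 1) hx (hh _ hρ)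
  obtain ⟨L2, hL2, e2⟩ := hasFDerivAt_zpowRadial k hx hh'
  obtain ⟨L3, hL3, e3⟩ := hasFDerivAt_zpowRadial k hx hdah
  have hcoord : ∀ j : Fin 2, HasFDerivAt (fun y : Plane => (y j : ℂ))
      (Complex.ofRealCLM.comp (EuclideanSpace.proj j)) x := fun j =>
    (Complex.ofRealCLM.comp (EuclideanSpace.proj j)).hasFDerivAt
  -- The j-th component of the rotation field does not depend on the j-th coordinate; this is where
  -- divergence freeness enters.
  have hrot : ∀ j : Fin 2, ∃ L : Plane →L[ℝ] ℂ, HasFDerivAt (fun y : Plane => (rotField y j : ℂ)) L x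
      ∧ L (EuclideanSpace.single j 1) = 0 := fun j => by
    fin_cases j
    · refine ⟨-(Complex.ofRealCLM.comp (EuclideanSpace.proj 1)), ?_, by simp⟩
      have := (hcoord 1).neg
      simpa [rotField] using! this
    · refine ⟨(Complex.ofRealCLM.comp (EuclideanSpace.proj 0)), ?_, by simp⟩
      have := (hcoord 0)
      simpa [rotField] using! this
  have hcov : ∀ j, covDeriv α B₀ j (covDeriv α B₀ j (zpowRadial k h)) x =
      (k * complexUnit j) * L1 (EuclideanSpace.single j 1) + 2 * zpowRadial k h' x +
      2 * (x j : ℂ) * L2 (EuclideanSpace.single j 1) +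
      Complex.I * (rotField x j : ℂ) * L3 (EuclideanSpace.single j 1) +
      Complex.I * ((rotField x j * a (‖x‖ ^ 2) : ℝ) : ℂ) *
        ((k * complexUnit j) * zpowRadial (k - 1) h x + 2 * (x j : ℂ) * zpowRadial k h' x +
        Complex.I * (rotField x j : ℂ) * zpowRadial k (a * h) x) := fun j => by
    obtain ⟨R, hR, hR0⟩ := hrot j
    have hF := ((hL1.const_mul (k * complexUnit j)).add (((hcoord j).const_mul 2).mul hL2)).add
      ((hR.const_mul Complex.I).mul hL3)
    rw [(covDeriv_congr α B₀ j (hloc j)).self_of_nhds, covDeriv, potential_eq]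
    have e : fderiv ℝ (fun y => (k * complexUnit j) * zpowRadial (k - 1) h y +
        2 * (y j : ℂ) * zpowRadial k h' y +
        Complex.I * (rotField y j : ℂ) * zpowRadial k (a * h) y) x = _ := hF.fderiv
    rw [e]
    simp [hR0]
    ring
  rw [Fin.sum_univ_two, hcov, hcov, e1, e1, e2, e2, e3, e3]
  have hz := planeComplex_ne_zero hx
  have hk1 : planeComplex x ^ (k - 1) = planeComplex x ^ (k - 2) * planeComplex x := by
    rw [← zpow_add_one₀ hz]; ring_nf
  have hk : planeComplex x ^ k = planeComplex x ^ (k - 2) * planeComplex x ^ 2 := by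
    rw [← zpow_natCast, ← zpow_add₀ hz]; norm_num
  -- Every power of z is written as z^{k-2} times a polynomial; what remains is a polynomial
  -- identity in the two coordinates and I.
  have hk2 : k - 1 - 1 = k - 2 := by ring
  simp only [zpowRadial, hk2, hk1, hk, complexUnit_zero, complexUnit_one]
  generalize planeComplex x ^ (k - 2) = p
  simp only [plane_norm_sq, rotField, Matrix.cons_val_zero, Matrix.cons_val_one, Pi.mul_apply,
    planeComplex_apply]
  generalize h (x 0 ^ 2 + x 1 ^ 2) = u0
  generalize h' (x 0 ^ 2 + x 1 ^ 2) = u1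
  generalize a (x 0 ^ 2 + x 1 ^ 2) = a0
  generalize x 0 = s
  generalize x 1 = t
  push_cast
  have hI3 : Complex.I ^ 3 = -Complex.I := Complex.I_pow_three
  ring_nf
  simp only [Complex.I_sq, hI3, Complex.I_pow_four]
  ring

/-! ### Angular modes -/

/-- The function `e^{ikθ} r^{|k + α|} q(r²)`. -/
def mode (α : ℝ) (k : ℤ) (q : ℝ → ℝ) (x : Plane) : ℂ :=
  Complex.exp (Complex.I * k * planeArg x) * ((‖x‖ ^ |(k : ℝ) + α| * q (‖x‖ ^ 2) : ℝ) : ℂ)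

theorem planeArg_eq (x : Plane) : planeArg x = (planeComplex x).arg := by
  rw [planeArg, planeComplex_eq_mk]

theorem measurable_planeArg : Measurable planeArg := by
  have : planeArg = fun x => (planeComplex x).arg := funext planeArg_eq
  rw [this]
  exact Complex.measurable_arg.comp planeComplex.continuous.measurable

theorem norm_exp_I_int_mul (k : ℤ) (θ : ℝ) : ‖Complex.exp (Complex.I * k * θ)‖ = 1 := by
  have : Complex.I * k * θ = ((k * θ : ℝ) : ℂ) * Complex.I := by push_cast; ring
  rw [this, Complex.norm_exp_ofReal_mul_I]

theorem norm_mode (α : ℝ) (k : ℤ) (q : ℝ → ℝ) (x : Plane) :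
    ‖mode α k q x‖ = ‖x‖ ^ |(k : ℝ) + α| * |q (‖x‖ ^ 2)| := by
  rw [mode, norm_mul, norm_exp_I_int_mul, one_mul, Complex.norm_real, norm_mul,
    Real.norm_of_nonneg (by positivity), Real.norm_eq_abs]

/-- Since e^{ikθ} = z^k / r^k, the power r^ν e^{ikθ} equals z^k ρ^{(ν-k)/2}. This removes the
discontinuous argument, so modes are smooth off the origin, including across the cut. -/
theorem mode_eq_zpowRadial (α : ℝ) (k : ℤ) (q : ℝ → ℝ) {x : Plane} (hx : x ≠ 0) :
    mode α k q x = zpowRadial k (fun ρ => ρ ^ ((|(k : ℝ) + α| - k) / 2) * q ρ) x := by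
  have hx0 : 0 < ‖x‖ := norm_pos_iff.2 hx
  have h1 : planeComplex x = ‖x‖ * Complex.exp (planeArg x * Complex.I) := by
    rw [planeArg_eq, ← norm_planeComplex, Complex.norm_mul_exp_arg_mul_I]
  have h2 : (‖x‖ ^ 2) ^ ((|(k : ℝ) + α| - k) / 2) = ‖x‖ ^ |(k : ℝ) + α| * ‖x‖ ^ (-k) := by
    rw [← Real.rpow_intCast, ← Real.rpow_add hx0, ← Real.rpow_natCast, ← Real.rpow_mul hx0.le]
    congr 1
    push_cast
    ring
  rw [mode, zpowRadial, h1, mul_zpow, ← Complex.exp_int_mul, h2]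
  push_cast
  have h3 : (‖x‖ : ℂ) ^ k * (‖x‖ : ℂ) ^ (-k) = 1 := by
    rw [← zpow_add₀ (by exact_mod_cast hx0.ne'), add_neg_cancel, zpow_zero]
  have h4 : Complex.I * k * (planeArg x : ℂ) = k * (planeArg x * Complex.I) := by ring
  rw [h4]
  linear_combination (-(Complex.exp (k * (planeArg x * Complex.I))) *
    ((‖x‖ ^ |(k : ℝ) + α| : ℝ) : ℂ) * q (‖x‖ ^ 2)) * h3

theorem mode_eventuallyEq (α : ℝ) (k : ℤ) (q : ℝ → ℝ) {x : Plane} (hx : x ≠ 0) :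
    mode α k q =ᶠ[𝓝 x] zpowRadial k (fun ρ => ρ ^ ((|(k : ℝ) + α| - k) / 2) * q ρ) := by
  filter_upwards [isOpen_ne.mem_nhds hx] with y hy
  exact mode_eq_zpowRadial α k q hy

theorem measurable_mode (α : ℝ) (k : ℤ) {q : ℝ → ℝ} (hq : Measurable q) :
    Measurable (mode α k q) := by
  have h1 : Measurable fun x : Plane => (planeArg x : ℂ) :=
    Complex.measurable_ofReal.comp measurable_planeArg
  have h2 : Measurable fun x : Plane => ‖x‖ ^ |(k : ℝ) + α| * q (‖x‖ ^ 2) :=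
    (measurable_norm.pow_const _).mul (hq.comp (measurable_norm.pow_const 2))
  exact (Complex.measurable_exp.comp (h1.const_mul _)).mul (Complex.measurable_ofReal.comp h2)

theorem integrable_rpow_mul_exp_neg_sq {a s : ℝ} (ha : -2 < a) (hs : 0 < s) :
    Integrable (fun x : Plane => ‖x‖ ^ a * Real.exp (-s * ‖x‖ ^ 2)) volume := by
  rw [integrable_fun_norm_addHaar volume (f := fun r => r ^ a * Real.exp (-s * r ^ 2)),
    finrank_euclideanSpace_fin]
  refine (integrableOn_rpow_mul_exp_neg_mul_sq hs (show -1 < a + 1 by linarith)).congr_fun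
    (fun r hr => ?_) measurableSet_Ioi
  have hr : 0 < r := hr
  simp only [Nat.add_one_sub_one, pow_one, smul_eq_mul]
  rw [Real.rpow_add_one hr.ne']
  ring

theorem memLp_rpow_mul_exp_neg_sq {a s : ℝ} (ha : -1 < a) (hs : 0 < s) :
    MemLp (fun x : Plane => ‖x‖ ^ a * Real.exp (-s * ‖x‖ ^ 2)) 2 volume := by
  have hm : Measurable fun x : Plane => ‖x‖ ^ a * Real.exp (-s * ‖x‖ ^ 2) :=
    (measurable_norm.pow_const _).mul
      (Real.measurable_exp.comp ((measurable_norm.pow_const 2).const_mul _))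
  rw [memLp_two_iff_integrable_sq hm.aestronglyMeasurable]
  refine (integrable_rpow_mul_exp_neg_sq (a := 2 * a) (s := 2 * s) (by linarith)
    (by linarith)).congr ?_
  filter_upwards [ae_ne_zero_plane] with x hx
  rw [mul_pow, ← Real.exp_nat_mul, mul_comm 2 a, ← Real.rpow_mul_natCast (norm_nonneg x) a 2]
  push_cast
  ring_nf

theorem memLp_mode (α : ℝ) (k : ℤ) {q : ℝ → ℝ} (hq : Measurable q) {C s : ℝ} (hs : 0 < s)
    (hC : ∀ ρ, 0 ≤ ρ → |q ρ| ≤ C * Real.exp (-s * ρ)) : MemLp (mode α k q) 2 volume := by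
  have h1 := (memLp_rpow_mul_exp_neg_sq (a := |(k : ℝ) + α|)
    (by linarith [abs_nonneg ((k : ℝ) + α)]) hs).const_mul C
  refine h1.mono (measurable_mode α k hq).aestronglyMeasurable (ae_of_all _ fun x => ?_)
  rw [norm_mode]
  refine le_trans ?_ (le_abs_self _)
  calc _ ≤ ‖x‖ ^ |(k : ℝ) + α| * (C * Real.exp (-s * ‖x‖ ^ 2)) := by
        gcongr; exact hC _ (by positivity)
    _ = _ := by ring

/-- From log r ≤ r one gets r^ν ≤ e^{νr}; completing the square in νr - sr² gives the bound. It
supplies the boundedness required of form-domain elements. -/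
theorem rpow_mul_exp_neg_sq_le {ν s r : ℝ} (hν : 0 ≤ ν) (hs : 0 < s) (hr : 0 ≤ r) :
    r ^ ν * Real.exp (-s * r ^ 2) ≤ Real.exp (ν ^ 2 / (4 * s)) := by
  have h1 : r ^ ν ≤ Real.exp (ν * r) := by
    rcases hr.eq_or_lt with rfl | hr
    · rw [mul_zero, Real.exp_zero]
      exact Real.rpow_le_one le_rfl zero_le_one hν
    · rw [Real.rpow_def_of_pos hr, Real.exp_le_exp, mul_comm]
      have := Real.log_le_sub_one_of_pos hr
      gcongr
      linarith
  calc _ ≤ Real.exp (ν * r) * Real.exp (-s * r ^ 2) := by gcongr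
    _ = Real.exp (ν * r + -s * r ^ 2) := (Real.exp_add _ _).symm
    _ ≤ _ := by
      rw [Real.exp_le_exp, le_div_iff₀ (by positivity)]
      nlinarith [sq_nonneg (ν - 2 * s * r)]

theorem measurable_covDeriv (α B₀ : ℝ) (j : Fin 2) {v : Plane → ℂ} (hv : Measurable v) :
    Measurable (covDeriv α B₀ j v) := by
  have h0 : ∀ i : Fin 2, Measurable fun x : Plane => x i := fun i =>
    (EuclideanSpace.proj i : Plane →L[ℝ] ℝ).continuous.measurable
  have h1 : Measurable fun x : Plane => rotField x j := by
    fin_cases j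
    · exact (h0 1).neg
    · exact h0 0
  have h2 : Measurable fun x : Plane => angularProfile α B₀ (‖x‖ ^ 2) :=
    ((measurable_norm.pow_const 2).const_div _).add_const _
  have h3 : Measurable fun x => abPotential α x j + hmfPotential B₀ x j := by
    simp only [potential_eq]
    exact h1.mul h2
  exact (measurable_fderiv_apply_const ℝ v _).add
    (((Complex.measurable_ofReal.comp h3).const_mul _).mul hv)

theorem abs_coord_le_norm (x : Plane) (j : Fin 2) : |x j| ≤ ‖x‖ := by
  simpa using PiLp.norm_apply_le x j

theorem abs_rotField_le_norm (x : Plane) (j : Fin 2) : |rotField x j| ≤ ‖x‖ := by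
  fin_cases j
  · simpa [rotField] using abs_coord_le_norm x 1
  · simpa [rotField] using abs_coord_le_norm x 0

theorem complexUnit_div (x : Plane) (hx : x ≠ 0) (j : Fin 2) :
    complexUnit j = planeComplex x * ((x j : ℂ) + Complex.I * rotField x j) / (‖x‖ ^ 2 : ℝ) := by
  have h1 : ((‖x‖ ^ 2 : ℝ) : ℂ) ≠ 0 := by
    exact_mod_cast pow_ne_zero 2 (norm_ne_zero_iff.2 hx)
  rw [eq_div_iff h1, plane_norm_sq, planeComplex_apply]
  have hI := Complex.I_sq
  fin_cases j
  · simp [complexUnit_zero, rotField]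
    linear_combination (x 1 : ℂ) ^ 2 * hI
  · simp [complexUnit_one, rotField]
    linear_combination -(x 1 : ℂ) * (x 0 : ℂ) * hI

theorem hasDerivAt_rpow_mul {q : ℝ → ℝ} {q' m ρ : ℝ} (hρ : 0 < ρ) (hq : HasDerivAt q q' ρ) :
    HasDerivAt (fun ρ => ρ ^ m * q ρ) (ρ ^ m * (m / ρ * q ρ + q')) ρ := by
  refine ((Real.hasDerivAt_rpow_const (Or.inl hρ.ne')).mul hq).congr_deriv ?_
  rw [Real.rpow_sub_one hρ.ne']
  ring

/-- The radial derivative gives the coefficient ν and the angular derivative with the flux gives k +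
α, of modulus ν. Hence the whole 1/r singularity carries the factor ν. -/
theorem norm_covDeriv_mode_le (α B₀ : ℝ) (k : ℤ) {q : ℝ → ℝ} {q' : ℝ} {x : Plane} (hx : x ≠ 0)
    (hq : HasDerivAt q q' (‖x‖ ^ 2)) (j : Fin 2) :
    ‖covDeriv α B₀ j (mode α k q) x‖ ≤ ‖x‖ ^ |(k : ℝ) + α| *
      ((2 * |(k : ℝ) + α| / ‖x‖ + |B₀| / 2 * ‖x‖) * |q (‖x‖ ^ 2)| + 2 * ‖x‖ * |q'|) := by
  have hx0 : 0 < ‖x‖ := norm_pos_iff.2 hx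
  have hρ : 0 < ‖x‖ ^ 2 := by positivity
  set ν := |(k : ℝ) + α| with hν
  set m := (ν - k) / 2 with hm
  have hz := planeComplex_ne_zero hx
  have hρc : ((‖x‖ ^ 2 : ℝ) : ℂ) ≠ 0 := by exact_mod_cast hρ.ne'
  have e1 : covDeriv α B₀ j (mode α k q) x =
      (planeComplex x ^ k * (((‖x‖ ^ 2) ^ m : ℝ) : ℂ)) *
      ((((ν * x j : ℝ) : ℂ) + Complex.I * (((k + α) * rotField x j : ℝ) : ℂ)) *
        ((q (‖x‖ ^ 2) / ‖x‖ ^ 2 : ℝ) : ℂ) +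
        ((2 * x j * q' : ℝ) : ℂ) +
        Complex.I * ((rotField x j * (B₀ / 2) * q (‖x‖ ^ 2) : ℝ) : ℂ)) := by
    rw [(covDeriv_congr α B₀ j (mode_eventuallyEq α k q hx)).self_of_nhds,
      covDeriv_zpowRadial α B₀ k hx (hasDerivAt_rpow_mul hρ hq), zpow_sub_one₀ hz]
    have e2 : (k : ℂ) * complexUnit j * (planeComplex x ^ k * (planeComplex x)⁻¹) =
        planeComplex x ^ k * (k * (((x j : ℂ) + Complex.I * rotField x j) / (‖x‖ ^ 2 : ℝ))) := by
      rw [complexUnit_div x hx j]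
      field_simp
    rw [e2]
    have e3 : (ν : ℂ) = 2 * m + k := by rw [hm]; push_cast; ring
    simp only [angularProfile]
    push_cast
    push_cast at hρc
    rw [e3]
    field_simp
    ring
  have e4 : ‖planeComplex x ^ k * (((‖x‖ ^ 2) ^ m : ℝ) : ℂ)‖ = ‖x‖ ^ ν := by
    have := mode_eq_zpowRadial α k (fun _ => 1) hx
    rw [zpowRadial] at this
    simp only [mul_one] at this
    rw [hm, hν, ← this, norm_mode]
    simp
  rw [e1, norm_mul, e4]
  gcongr
  have h1 := abs_coord_le_norm x j
  have h2 := abs_rotField_le_norm x j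
  have hν0 : 0 ≤ ν := abs_nonneg _
  have e5 : ‖(((ν * x j : ℝ) : ℂ) + Complex.I * (((k + α) * rotField x j : ℝ) : ℂ)) *
        ((q (‖x‖ ^ 2) / ‖x‖ ^ 2 : ℝ) : ℂ)‖ ≤ 2 * ν / ‖x‖ * |q (‖x‖ ^ 2)| := by
    rw [norm_mul, Complex.norm_real, Real.norm_eq_abs, abs_div, abs_of_pos hρ]
    have h3 : ‖((ν * x j : ℝ) : ℂ) + Complex.I * (((k + α) * rotField x j : ℝ) : ℂ)‖ ≤
        2 * ν * ‖x‖ := by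
      refine (norm_add_le _ _).trans ?_
      rw [norm_mul, Complex.norm_I, one_mul, Complex.norm_real, Complex.norm_real,
        Real.norm_eq_abs, Real.norm_eq_abs, abs_mul, abs_mul, abs_of_nonneg hν0, ← hν]
      have h4 : ν * |x j| ≤ ν * ‖x‖ := by gcongr
      have h5 : ν * |rotField x j| ≤ ν * ‖x‖ := by gcongr
      linarith
    calc _ ≤ 2 * ν * ‖x‖ * (|q (‖x‖ ^ 2)| / ‖x‖ ^ 2) := by gcongr
      _ = _ := by field_simp
  have e6 : ‖((2 * x j * q' : ℝ) : ℂ)‖ ≤ 2 * ‖x‖ * |q'| := by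
    rw [Complex.norm_real, Real.norm_eq_abs, abs_mul, abs_mul, abs_two]
    gcongr
  have e7 : ‖Complex.I * ((rotField x j * (B₀ / 2) * q (‖x‖ ^ 2) : ℝ) : ℂ)‖ ≤
      |B₀| / 2 * ‖x‖ * |q (‖x‖ ^ 2)| := by
    rw [norm_mul, Complex.norm_I, one_mul, Complex.norm_real, Real.norm_eq_abs, abs_mul, abs_mul,
      abs_div, abs_two]
    calc _ ≤ ‖x‖ * (|B₀| / 2) * |q (‖x‖ ^ 2)| := by gcongr
      _ = _ := by ring
  have e8 := (norm_add_le _ _).trans (add_le_add e5 e6)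
  refine (norm_add_le _ _).trans ((add_le_add e8 e7).trans_eq ?_)
  ring

theorem memLp_covDeriv_mode (α B₀ : ℝ) (k : ℤ) {q q' : ℝ → ℝ} (hqm : Measurable q)
    (hq : ∀ ρ, 0 < ρ → HasDerivAt q (q' ρ) ρ) {C s : ℝ} (hs : 0 < s)
    (hC : ∀ ρ, 0 ≤ ρ → |q ρ| ≤ C * Real.exp (-s * ρ))
    (hC' : ∀ ρ, 0 ≤ ρ → |q' ρ| ≤ C * Real.exp (-s * ρ)) (j : Fin 2) :
    MemLp (covDeriv α B₀ j (mode α k q)) 2 volume := by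
  set ν := |(k : ℝ) + α| with hν
  have hν0 : 0 ≤ ν := abs_nonneg _
  have hC0 : 0 ≤ C := by
    have := (abs_nonneg _).trans (hC 0 le_rfl)
    simpa using this
  have h1 : MemLp (fun x : Plane => 2 * ν * C * (‖x‖ ^ (ν - 1) * Real.exp (-s * ‖x‖ ^ 2)))
      2 volume := by
    -- For ν = 0 the function r^{ν-1} is not square integrable at the origin, but its coefficient
    -- vanishes; for ν > 0 it is.
    rcases hν0.eq_or_lt with h | h
    · rw [← h]; simp
    · exact (memLp_rpow_mul_exp_neg_sq (by linarith) hs).const_mul _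
  have h2 : MemLp (fun x : Plane => (|B₀| / 2 + 2) * C *
      (‖x‖ ^ (ν + 1) * Real.exp (-s * ‖x‖ ^ 2))) 2 volume :=
    (memLp_rpow_mul_exp_neg_sq (by linarith) hs).const_mul _
  refine (h1.add h2).mono
    (measurable_covDeriv α B₀ j (measurable_mode α k hqm)).aestronglyMeasurable ?_
  filter_upwards [ae_ne_zero_plane] with x hx
  have hx0 : 0 < ‖x‖ := norm_pos_iff.2 hx
  refine (norm_covDeriv_mode_le α B₀ k hx (hq _ (by positivity)) j).trans
    (le_trans ?_ (le_abs_self _))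
  rw [← hν, Pi.add_apply, Real.rpow_sub_one hx0.ne', Real.rpow_add_one hx0.ne']
  calc _ ≤ ‖x‖ ^ ν * ((2 * ν / ‖x‖ + |B₀| / 2 * ‖x‖) * (C * Real.exp (-s * ‖x‖ ^ 2)) +
        2 * ‖x‖ * (C * Real.exp (-s * ‖x‖ ^ 2))) := by
        gcongr
        · exact hC _ (by positivity)
        · exact hC' _ (by positivity)
    _ = _ := by ring

/-- Substituting h = ρ^{(ν-k)/2} q into the formula for z^k h, the singular terms in 1/ρ cancel
because ν² = (k + α)². The decay hypotheses put the mode and its covariant gradient in L² and keep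
the mode bounded. -/
theorem mode_mem_hamiltonianGraph (α B₀ : ℝ) (k : ℤ) {q q' q'' w : ℝ → ℝ}
    (hqs : ContDiff ℝ ∞ q) (hq : ∀ ρ, 0 < ρ → HasDerivAt q (q' ρ) ρ)
    (hq' : ∀ ρ, 0 < ρ → HasDerivAt q' (q'' ρ) ρ) {C s : ℝ} (hs : 0 < s)
    (hC : ∀ ρ, 0 ≤ ρ → |q ρ| ≤ C * Real.exp (-s * ρ))
    (hC' : ∀ ρ, 0 ≤ ρ → |q' ρ| ≤ C * Real.exp (-s * ρ))
    (hw : ∀ ρ, 0 < ρ → w ρ = -4 * ρ * q'' ρ - 4 * (|(k : ℝ) + α| + 1) * q' ρ +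
      (B₀ ^ 2 / 4 * ρ + B₀ * (k + α)) * q ρ)
    (hv : MemLp (mode α k q) 2 volume) (hw2 : MemLp (mode α k w) 2 volume) :
    (hv.toLp _, hw2.toLp _) ∈ hamiltonianGraph α B₀ := by
  set ν := |(k : ℝ) + α| with hν
  have hν0 : 0 ≤ ν := abs_nonneg _
  have hC0 : 0 ≤ C := by
    have := (abs_nonneg _).trans (hC 0 le_rfl)
    simpa using this
  refine mem_hamiltonianGraph_of_smooth (M := C * Real.exp (ν ^ 2 / (4 * s)))
    (fun x hx => ?_) hv
    (memLp_covDeriv_mode α B₀ k hqs.continuous.measurable hq hs hC hC') (fun x => ?_) hw2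
    (fun x hx => ?_)
  · refine ContDiffAt.congr_of_eventuallyEq ?_ (mode_eventuallyEq α k q hx)
    have hρ : 0 < ‖x‖ ^ 2 := pow_pos (norm_pos_iff.2 hx) 2
    exact contDiffAt_zpowRadial k hx
      ((Real.contDiffAt_rpow_const_of_ne hρ.ne').mul hqs.contDiffAt)
  · rw [norm_mode]
    calc _ ≤ ‖x‖ ^ ν * (C * Real.exp (-s * ‖x‖ ^ 2)) := by
          gcongr; exact hC _ (by positivity)
      _ = C * (‖x‖ ^ ν * Real.exp (-s * ‖x‖ ^ 2)) := by ring
      _ ≤ _ := by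
        gcongr
        exact rpow_mul_exp_neg_sq_le hν0 hs (norm_nonneg _)
  · have hx0 : 0 < ‖x‖ := norm_pos_iff.2 hx
    have hρ : 0 < ‖x‖ ^ 2 := pow_pos hx0 2
    set m := (ν - k) / 2 with hm
    have hd1 : ∀ ρ, 0 < ρ → HasDerivAt (fun ρ => ρ ^ m * q ρ)
        (ρ ^ m * (m / ρ * q ρ + q' ρ)) ρ := fun ρ hρ => hasDerivAt_rpow_mul hρ (hq ρ hρ)
    have hd2 : ∀ ρ, 0 < ρ → HasDerivAt (fun ρ => ρ ^ m * (m / ρ * q ρ + q' ρ))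
        (ρ ^ m * (m / ρ * (m / ρ * q ρ + q' ρ) +
          (-m / ρ ^ 2 * q ρ + m / ρ * q' ρ + q'' ρ))) ρ := fun ρ hρ => by
      refine hasDerivAt_rpow_mul hρ ((HasDerivAt.mul ?_ (hq ρ hρ)).add (hq' ρ hρ))
      refine ((hasDerivAt_const ρ m).div (hasDerivAt_id ρ) hρ.ne').congr_deriv ?_
      simp
    rw [Finset.sum_congr rfl fun j _ => (covDeriv_congr α B₀ j
      (covDeriv_congr α B₀ j (mode_eventuallyEq α k q hx))).self_of_nhds,
      sum_covDeriv_covDeriv_zpowRadial α B₀ k hx hd1 (hd2 _ hρ), mode_eq_zpowRadial α k w hx,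
      zpowRadial, ← mul_neg, ← Complex.ofReal_neg]
    congr 2
    rw [hw _ hρ, angularProfile]
    have hν2 : ν ^ 2 = (k + α) ^ 2 := by rw [hν, sq_abs]
    rw [← hν, ← hm]
    have e : ν = 2 * m + k := by rw [hm]; ring
    rw [e] at hν2 ⊢
    generalize (‖x‖ ^ 2) ^ m = p
    generalize q (‖x‖ ^ 2) = u0
    generalize q' (‖x‖ ^ 2) = u1
    generalize q'' (‖x‖ ^ 2) = u2
    generalize ‖x‖ ^ 2 = ρ at *
    field_simp
    linear_combination (16 * p * u0) * hν2

/-! ### Gaussian modes -/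

/-- The function `ρ^n e^{-sρ}`. -/
def gaussMono (n : ℕ) (s ρ : ℝ) : ℝ := ρ ^ n * Real.exp (-s * ρ)

theorem gaussMono_nonneg {n : ℕ} {s ρ : ℝ} (hρ : 0 ≤ ρ) : 0 ≤ gaussMono n s ρ := by
  rw [gaussMono]; positivity

theorem contDiff_gaussMono (n : ℕ) (s : ℝ) : ContDiff ℝ ∞ (gaussMono n s) :=
  (contDiff_id.pow n).mul (Real.contDiff_exp.comp (contDiff_const.mul contDiff_id))

theorem measurable_gaussMono (n : ℕ) (s : ℝ) : Measurable (gaussMono n s) :=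
  (contDiff_gaussMono n s).continuous.measurable

theorem hasDerivAt_gaussMono (n : ℕ) (s ρ : ℝ) :
    HasDerivAt (gaussMono n s) (n * gaussMono (n - 1) s ρ - s * gaussMono n s ρ) ρ := by
  have h1 : HasDerivAt (fun ρ => Real.exp (-s * ρ)) (Real.exp (-s * ρ) * (-s)) ρ := by
    simpa using ((hasDerivAt_id ρ).const_mul (-s)).exp
  refine ((hasDerivAt_pow n ρ).mul h1).congr_deriv ?_
  simp only [gaussMono]
  ring

theorem hasDerivAt_gaussMono_param (n : ℕ) (s ρ : ℝ) :
    HasDerivAt (fun s => gaussMono n s ρ) (-gaussMono (n + 1) s ρ) s := by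
  have h1 : HasDerivAt (fun s : ℝ => Real.exp (-s * ρ)) (Real.exp (-s * ρ) * (-1 * ρ)) s :=
    (((hasDerivAt_id s).neg).mul_const ρ).exp
  refine (h1.const_mul (ρ ^ n)).congr_deriv ?_
  simp only [gaussMono]
  ring

theorem gaussMono_anti {n : ℕ} {s s' ρ : ℝ} (hρ : 0 ≤ ρ) (h : s' ≤ s) :
    gaussMono n s ρ ≤ gaussMono n s' ρ := by
  rw [gaussMono, gaussMono]
  gcongr

/-- Half of the exponential absorbs the power, by (sρ/2)ⁿ/n! ≤ e^{sρ/2}. -/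
theorem exists_gaussMono_le (n : ℕ) {s : ℝ} (hs : 0 < s) :
    ∃ C, 0 ≤ C ∧ ∀ ρ, 0 ≤ ρ → |gaussMono n s ρ| ≤ C * Real.exp (-(s / 2) * ρ) := by
  refine ⟨n.factorial * (2 / s) ^ n, by positivity, fun ρ hρ => ?_⟩
  rw [abs_of_nonneg (gaussMono_nonneg hρ), gaussMono]
  have h1 := Real.pow_div_factorial_le_exp (x := s / 2 * ρ) (by positivity) n
  rw [div_le_iff₀ (by positivity), mul_pow] at h1
  have h2 : ρ ^ n = (2 / s) ^ n * ((s / 2) ^ n * ρ ^ n) := by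
    rw [← mul_assoc, ← mul_pow]
    field_simp
    rw [one_pow, mul_one]
  have h3 : Real.exp (-s * ρ) = Real.exp (-(s / 2) * ρ) * Real.exp (-(s / 2) * ρ) := by
    rw [← Real.exp_add]; ring_nf
  have h4 : Real.exp (s / 2 * ρ) * Real.exp (-(s / 2) * ρ) = 1 := by
    rw [← Real.exp_add]; simp
  calc _ = (2 / s) ^ n * ((s / 2) ^ n * ρ ^ n) * Real.exp (-s * ρ) := by rw [← h2]
    _ ≤ (2 / s) ^ n * (Real.exp (s / 2 * ρ) * n.factorial) * Real.exp (-s * ρ) := by gcongr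
    _ = _ := by
      rw [h3]
      linear_combination ((2 / s) ^ n * n.factorial * Real.exp (-(s / 2) * ρ)) * h4

theorem memLp_mode_gaussMono (α : ℝ) (k : ℤ) (n : ℕ) {s : ℝ} (hs : 0 < s) :
    MemLp (mode α k (gaussMono n s)) 2 volume := by
  obtain ⟨C, -, hC⟩ := exists_gaussMono_le n hs
  exact memLp_mode α k (measurable_gaussMono n s) (half_pos hs) hC

/-- The class in `L²` of `e^{ikθ} r^{|k + α|} r^{2n} e^{-s r²}`. -/
def gaussVec (α : ℝ) (k : ℤ) (n : ℕ) (s : ℝ) : L2Plane :=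
  if hs : 0 < s then (memLp_mode_gaussMono α k n hs).toLp _ else 0

theorem gaussVec_eq (α : ℝ) (k : ℤ) (n : ℕ) {s : ℝ} (hs : 0 < s) :
    gaussVec α k n s = (memLp_mode_gaussMono α k n hs).toLp _ := by
  rw [gaussVec, dif_pos hs]

theorem coeFn_gaussVec (α : ℝ) (k : ℤ) (n : ℕ) {s : ℝ} (hs : 0 < s) :
    gaussVec α k n s =ᵐ[volume] mode α k (gaussMono n s) := by
  rw [gaussVec_eq α k n hs]
  exact MemLp.coeFn_toLp _

/-- The radial operator applied to ρⁿe^{-sρ}. The coefficient of the raised vector vanishes exactly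
when 4s² = B₀²/4, which makes the family triangular at s = B₀/4. For n = 0 the lowering term is
absent, and s may be left free for the flow. -/
theorem gaussVec_mem_hamiltonianGraph (α B₀ : ℝ) (k : ℤ) (n : ℕ) {s : ℝ} (hs : 0 < s) :
    (gaussVec α k n s,
      ((8 * s * n + 4 * (|(k : ℝ) + α| + 1) * s + B₀ * (k + α) : ℝ) : ℂ) • gaussVec α k n s
      - ((4 * n * (n + |(k : ℝ) + α|) : ℝ) : ℂ) • gaussVec α k (n - 1) s +
      ((B₀ ^ 2 / 4 - 4 * s ^ 2 : ℝ) : ℂ) • gaussVec α k (n + 1) s) ∈ hamiltonianGraph α B₀ := by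
  set ν := |(k : ℝ) + α| with hν
  set c0 : ℝ := 8 * s * n + 4 * (ν + 1) * s + B₀ * (k + α) with hc0
  set c1 : ℝ := 4 * n * (n + ν) with hc1
  set c2 : ℝ := B₀ ^ 2 / 4 - 4 * s ^ 2 with hc2
  set w : ℝ → ℝ := fun ρ => c0 * gaussMono n s ρ - c1 * gaussMono (n - 1) s ρ +
    c2 * gaussMono (n + 1) s ρ with hw
  have hmw : mode α k w = ((c0 : ℂ) • mode α k (gaussMono n s) -
      (c1 : ℂ) • mode α k (gaussMono (n - 1) s)) + (c2 : ℂ) • mode α k (gaussMono (n + 1) s) := by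
    ext x
    simp only [mode, hw, Pi.add_apply, Pi.sub_apply, Pi.smul_apply, smul_eq_mul]
    push_cast
    ring
  have m0 := memLp_mode_gaussMono α k n hs
  have m1 := memLp_mode_gaussMono α k (n - 1) hs
  have m2 := memLp_mode_gaussMono α k (n + 1) hs
  have hw2 : MemLp (mode α k w) 2 volume := by
    rw [hmw]
    exact ((m0.const_smul (c0 : ℂ)).sub (m1.const_smul (c1 : ℂ))).add (m2.const_smul (c2 : ℂ))
  obtain ⟨C, hC0, hC⟩ := exists_gaussMono_le n hs
  obtain ⟨C', hC0', hC'⟩ := exists_gaussMono_le (n - 1) hs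
  have key := mode_mem_hamiltonianGraph α B₀ k (q := gaussMono n s)
    (q' := fun ρ => n * gaussMono (n - 1) s ρ - s * gaussMono n s ρ)
    (q'' := fun ρ => n * ((n - 1 : ℕ) * gaussMono (n - 1 - 1) s ρ - s * gaussMono (n - 1) s ρ) -
      s * (n * gaussMono (n - 1) s ρ - s * gaussMono n s ρ)) (w := w)
    (C := C + (n * C' + s * C)) (contDiff_gaussMono n s) (fun ρ _ => hasDerivAt_gaussMono n s ρ)
    (fun ρ _ => ((hasDerivAt_gaussMono (n - 1) s ρ).const_mul _).sub
      ((hasDerivAt_gaussMono n s ρ).const_mul _)) (half_pos hs)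
    (fun ρ hρ => (hC ρ hρ).trans ?_) (fun ρ hρ => ?_) (fun ρ hρ => ?_) m0 hw2
  · convert key using 2
    · rw [gaussVec_eq α k n hs]
    · rw [gaussVec_eq α k n hs, gaussVec_eq α k _ hs, gaussVec_eq α k _ hs,
        ← MemLp.toLp_const_smul, ← MemLp.toLp_const_smul, ← MemLp.toLp_const_smul,
        ← MemLp.toLp_sub, ← MemLp.toLp_add]
      exact MemLp.toLp_congr _ _ (ae_of_all _ fun x => by rw [hmw])
  · gcongr
    have : 0 ≤ n * C' + s * C := by positivity
    linarith
  · have h1 := hC ρ hρ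
    have h2 := hC' ρ hρ
    refine (abs_sub _ _).trans ?_
    rw [abs_mul, abs_mul, Nat.abs_cast, abs_of_pos hs]
    calc _ ≤ n * (C' * Real.exp (-(s / 2) * ρ)) + s * (C * Real.exp (-(s / 2) * ρ)) := by gcongr
      _ = (n * C' + s * C) * Real.exp (-(s / 2) * ρ) := by ring
      _ ≤ _ := mul_le_mul_of_nonneg_right (by linarith) (Real.exp_pos _).le
  · simp only [hw, hc0, hc1, hc2, ← hν, gaussMono]
    rcases n with _ | _ | n
    · simp
      ring
    · simp
      ring
    · simp only [Nat.add_sub_cancel, Nat.cast_add, Nat.cast_one]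
      ring

theorem hasDerivAt_mode_gaussMono (α : ℝ) (k : ℤ) (n : ℕ) (s : ℝ) (x : Plane) :
    HasDerivAt (fun s => mode α k (gaussMono n s) x) (-mode α k (gaussMono (n + 1) s) x) s := by
  simp only [mode]
  refine ((((hasDerivAt_gaussMono_param n s (‖x‖ ^ 2)).const_mul
    (‖x‖ ^ |(k : ℝ) + α|)).ofReal_comp).const_mul _).congr_deriv ?_
  push_cast
  ring

theorem norm_mode_gaussMono_anti (α : ℝ) (k : ℤ) (n : ℕ) {s s' : ℝ} (h : s' ≤ s) (x : Plane) :
    ‖mode α k (gaussMono n s) x‖ ≤ ‖mode α k (gaussMono n s') x‖ := by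
  rw [norm_mode, norm_mode, abs_of_nonneg (gaussMono_nonneg (by positivity)),
    abs_of_nonneg (gaussMono_nonneg (by positivity))]
  gcongr
  exact gaussMono_anti (by positivity) h

theorem inner_gaussVec (α : ℝ) (k : ℤ) (n : ℕ) {s : ℝ} (hs : 0 < s) (f : L2Plane) :
    inner ℂ f (gaussVec α k n s) =
      ∫ x, mode α k (gaussMono n s) x * (starRingEnd ℂ) (f x) := by
  rw [L2.inner_def]
  refine integral_congr_ae ?_
  filter_upwards [coeFn_gaussVec α k n hs] with x hx
  rw [hx, RCLike.inner_apply]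

theorem integrable_mode_mul_conj (α : ℝ) (k : ℤ) (n : ℕ) {s : ℝ} (hs : 0 < s) (f : L2Plane) :
    Integrable (fun x => mode α k (gaussMono n s) x * (starRingEnd ℂ) (f x)) volume :=
  (memLp_mode_gaussMono α k n hs).integrable_mul (Lp.memLp f).star

/-- Differentiation in s brings down -ρ, that is, raises n. Near s the derivative is dominated by
the same mode with exponent s/2. -/
theorem hasDerivAt_inner_gaussVec (α : ℝ) (k : ℤ) (n : ℕ) {s : ℝ} (hs : 0 < s) (f : L2Plane) :
    HasDerivAt (fun s => inner ℂ f (gaussVec α k n s)) (-inner ℂ f (gaussVec α k (n + 1) s)) s := by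
  have hs2 : 0 < s / 2 := half_pos hs
  have hnhd : Set.Ioi (s / 2) ∈ 𝓝 s := Ioi_mem_nhds (half_lt_self hs)
  have h1 := hasDerivAt_integral_of_dominated_loc_of_deriv_le (μ := (volume : Measure Plane))
    (F := fun s x => mode α k (gaussMono n s) x * (starRingEnd ℂ) (f x))
    (F' := fun s x => -mode α k (gaussMono (n + 1) s) x * (starRingEnd ℂ) (f x))
    (bound := fun x => ‖mode α k (gaussMono (n + 1) (s / 2)) x * (starRingEnd ℂ) (f x)‖)
    (x₀ := s) hnhd
    (by
      filter_upwards [hnhd] with t ht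
      exact (integrable_mode_mul_conj α k n (hs2.trans ht) f).aestronglyMeasurable)
    (integrable_mode_mul_conj α k n hs f)
    (by
      simpa only [neg_mul] using!
        (integrable_mode_mul_conj α k (n + 1) hs f).neg.aestronglyMeasurable)
    (ae_of_all _ fun x t ht => by
      rw [norm_mul, norm_mul, norm_neg]
      gcongr
      exact norm_mode_gaussMono_anti α k (n + 1) (le_of_lt ht) x)
    (integrable_mode_mul_conj α k (n + 1) hs2 f).norm
    (ae_of_all _ fun x t _ => (hasDerivAt_mode_gaussMono α k n t x).mul_const _)
  have h2 := h1.2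
  simp only [neg_mul] at h2
  rw [integral_neg, ← inner_gaussVec α k (n + 1) hs f] at h2
  refine h2.congr_of_eventuallyEq ?_
  filter_upwards [hnhd] with t ht
  exact inner_gaussVec α k n (hs2.trans ht) f

/-! ### The evolution of the Gaussian modes -/

/-- The denominator `s sinh τ + (B₀ / 4) cosh τ`. -/
def flowDen (B₀ s τ : ℝ) : ℝ := s * Real.sinh τ + B₀ / 4 * Real.cosh τ

/-- The numerator `s cosh τ + (B₀ / 4) sinh τ`. -/
def flowNum (B₀ s τ : ℝ) : ℝ := s * Real.cosh τ + B₀ / 4 * Real.sinh τ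

/-- The Gaussian exponent at time `t`. -/
def flowExp (B₀ s t : ℝ) : ℝ := B₀ / 4 * (flowNum B₀ s (t * B₀) / flowDen B₀ s (t * B₀))

/-- The amplitude at time `t`. -/
def flowAmp (ν κ B₀ s t : ℝ) : ℝ :=
  Real.exp (-(t * B₀ * κ)) * (B₀ / 4 / flowDen B₀ s (t * B₀)) ^ (ν + 1)

theorem flowDen_pos {B₀ s τ : ℝ} (hB : 0 < B₀) (hs : 0 < s) (hτ : 0 ≤ τ) : 0 < flowDen B₀ s τ := by
  have := Real.sinh_nonneg_iff.2 hτ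
  have := Real.cosh_pos τ
  rw [flowDen]; positivity

theorem flowNum_pos {B₀ s τ : ℝ} (hB : 0 < B₀) (hs : 0 < s) (hτ : 0 ≤ τ) : 0 < flowNum B₀ s τ := by
  have := Real.sinh_nonneg_iff.2 hτ
  have := Real.cosh_pos τ
  rw [flowNum]; positivity

theorem flowExp_pos {B₀ s t : ℝ} (hB : 0 < B₀) (hs : 0 < s) (ht : 0 ≤ t) : 0 < flowExp B₀ s t := by
  have h1 := flowDen_pos hB hs (mul_nonneg ht hB.le)
  have h2 := flowNum_pos hB hs (mul_nonneg ht hB.le)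
  rw [flowExp]; positivity

theorem flowExp_zero {B₀ s : ℝ} (hB : 0 < B₀) : flowExp B₀ s 0 = s := by
  simp [flowExp, flowNum, flowDen]
  field_simp

theorem flowAmp_zero {ν κ B₀ s : ℝ} (hB : 0 < B₀) : flowAmp ν κ B₀ s 0 = 1 := by
  simp [flowAmp, flowDen, hB.ne']

theorem hasDerivAt_flowDen (B₀ s t : ℝ) :
    HasDerivAt (fun t => flowDen B₀ s (t * B₀)) (flowNum B₀ s (t * B₀) * B₀) t := by
  have h0 : HasDerivAt (fun t => t * B₀) B₀ t := by simpa using (hasDerivAt_id t).mul_const B₀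
  refine ((h0.sinh.const_mul s).add (h0.cosh.const_mul (B₀ / 4))).congr_deriv ?_
  rw [flowNum]; ring

theorem hasDerivAt_flowNum (B₀ s t : ℝ) :
    HasDerivAt (fun t => flowNum B₀ s (t * B₀)) (flowDen B₀ s (t * B₀) * B₀) t := by
  have h0 : HasDerivAt (fun t => t * B₀) B₀ t := by simpa using (hasDerivAt_id t).mul_const B₀
  refine ((h0.cosh.const_mul s).add (h0.sinh.const_mul (B₀ / 4))).congr_deriv ?_
  rw [flowDen]; ring

/-- The denominator and numerator satisfy D' = B₀N and N' = B₀D, so N/D solves a Riccati equation.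
Its right-hand side is the coefficient of the raised vector in `gaussVec_mem_hamiltonianGraph`. -/
theorem hasDerivAt_flowExp {B₀ s t : ℝ} (hB : 0 < B₀) (hs : 0 < s) (ht : 0 ≤ t) :
    HasDerivAt (flowExp B₀ s) (B₀ ^ 2 / 4 - 4 * flowExp B₀ s t ^ 2) t := by
  have hD := (flowDen_pos hB hs (mul_nonneg ht hB.le)).ne'
  refine (((hasDerivAt_flowNum B₀ s t).div (hasDerivAt_flowDen B₀ s t) hD).const_mul
    (B₀ / 4)).congr_deriv ?_
  rw [flowExp]
  generalize flowDen B₀ s (t * B₀) = D at *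
  generalize flowNum B₀ s (t * B₀) = N at *
  field_simp

theorem hasDerivAt_flowAmp {ν κ B₀ s t : ℝ} (hB : 0 < B₀) (hs : 0 < s) (ht : 0 ≤ t) :
    HasDerivAt (flowAmp ν κ B₀ s)
      (-(4 * (ν + 1) * flowExp B₀ s t + B₀ * κ) * flowAmp ν κ B₀ s t) t := by
  have hD := flowDen_pos hB hs (mul_nonneg ht hB.le)
  have h1 : HasDerivAt (fun t => Real.exp (-(t * B₀ * κ)))
      (Real.exp (-(t * B₀ * κ)) * (-(B₀ * κ))) t := by
    have := ((((hasDerivAt_id t).mul_const B₀).mul_const κ).neg).exp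
    simpa using this
  have h2 : HasDerivAt (fun t => B₀ / 4 / flowDen B₀ s (t * B₀)) _ t :=
    (hasDerivAt_const t (B₀ / 4)).div (hasDerivAt_flowDen B₀ s t) hD.ne'
  have hpos : 0 < B₀ / 4 / flowDen B₀ s (t * B₀) := by positivity
  refine (h1.mul (h2.rpow_const (p := ν + 1) (Or.inl hpos.ne'))).congr_deriv ?_
  rw [Real.rpow_sub_one hpos.ne', flowAmp, flowExp]
  field_simp
  ring

/-- Each coordinate of the proposed evolution is shown to solve φ' = -λᵢφ with the correct initial
value. The derivative of the exponent accounts for the raised vector and that of the amplitude for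
the diagonal term. -/
theorem semigroup_gaussVec {α B₀ : ℝ} (hB : 0 < B₀) {ι : Type*} (b : HilbertBasis ι ℂ L2Plane)
    (lam : ι → ℝ) (h0 : ∀ i, 0 ≤ lam i)
    (hb : ∀ i, (b i, (lam i : ℂ) • b i) ∈ hamiltonianGraph α B₀) (k : ℤ) {s t : ℝ} (hs : 0 < s)
    (ht : 0 ≤ t) : b.semigroup lam h0 t (gaussVec α k 0 s) =
      (flowAmp |(k : ℝ) + α| (k + α) B₀ s t : ℂ) • gaussVec α k 0 (flowExp B₀ s t) := by
  set ν := |(k : ℝ) + α| with hν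
  refine b.ext_repr fun i => ?_
  rw [b.repr_semigroup lam h0 ht, map_smul, lp.coeFn_smul, Pi.smul_apply, smul_eq_mul,
    b.repr_apply_apply, b.repr_apply_apply]
  set φ : ℝ → ℂ := fun t => (flowAmp ν (k + α) B₀ s t : ℂ) *
    inner ℂ (b i) (gaussVec α k 0 (flowExp B₀ s t)) with hφ
  have hd : ∀ t, 0 ≤ t → HasDerivAt φ (-(lam i * φ t)) t := fun t ht => by
    have hσ := flowExp_pos hB hs ht
    have h1 := (hasDerivAt_inner_gaussVec α k 0 hσ (b i)).scomp t (hasDerivAt_flowExp hB hs ht)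
    have h2 := (hasDerivAt_flowAmp (ν := ν) (κ := k + α) hB hs ht).ofReal_comp
    refine (h2.mul h1).congr_deriv ?_
    -- Symmetry moves the operator from the Gaussian to the eigenvector bᵢ, producing λᵢ.
    have h3 := hamiltonianGraph_symm α B₀ _ (gaussVec_mem_hamiltonianGraph α B₀ k 0 hσ) _ (hb i)
    simp only [inner_add_right, inner_sub_right, inner_smul_right, inner_smul_left,
      Complex.conj_ofReal, Function.comp_apply, Complex.real_smul, hφ, ← hν] at h3 ⊢
    push_cast at h3 ⊢
    simp only [mul_zero, zero_mul, sub_zero, zero_add] at h3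
    linear_combination -(flowAmp ν (k + α) B₀ s t : ℂ) * h3
  have h4 := eq_exp_mul_of_hasDerivAt (c := lam i)
    (fun x hx => (hd x hx).continuousAt.continuousWithinAt) (fun x hx => hd x hx.le) ht
  simp only [hφ, flowAmp_zero hB, flowExp_zero hB, Complex.ofReal_one, one_mul] at h4
  exact h4.symm

/-! ### Integrable functions orthogonal to a separating family -/

section Separating

variable {Ω E : Type*} [MeasurableSpace Ω] [MeasurableSpace E] {μ : Measure Ω}

theorem integral_map_withDensity_ofReal {X : Ω → E} (hX : Measurable X) {g : Ω → ℝ}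
    (hg : Integrable g μ) {a : E → ℂ} (ha : Measurable a) :
    ∫ y, a y ∂((μ.withDensity fun p => ENNReal.ofReal (g p)).map X) =
      ∫ p, a (X p) * ((max (g p) 0 : ℝ) : ℂ) ∂μ := by
  rw [integral_map hX.aemeasurable ha.aestronglyMeasurable,
    integral_withDensity_eq_integral_toReal_smul₀ hg.aemeasurable.ennreal_ofReal
      (ae_of_all _ fun _ => ENNReal.ofReal_lt_top)]
  refine integral_congr_ae (ae_of_all _ fun p => ?_)
  simp only [ENNReal.toReal_ofReal', Complex.real_smul]
  rw [mul_comm]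

theorem integrable_comp_mul {X : Ω → E} (hX : Measurable X) {F : Ω → ℂ} (hF : Integrable F μ)
    {a : E → ℂ} (ha : Measurable a) {C : ℝ} (hC : ∀ x, ‖a x‖ ≤ C) :
    Integrable (fun p => a (X p) * F p) μ :=
  hF.bdd_mul (c := C) (ha.comp hX).aestronglyMeasurable (ae_of_all _ fun _ => hC _)

theorem integral_sub_map_withDensity {X : Ω → E} (hX : Measurable X) {g : Ω → ℝ}
    (hg : Integrable g μ) {a : E → ℂ} (ha : Measurable a) {C : ℝ} (hC : ∀ x, ‖a x‖ ≤ C) :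
    ∫ y, a y ∂((μ.withDensity fun p => ENNReal.ofReal (g p)).map X) -
      ∫ y, a y ∂((μ.withDensity fun p => ENNReal.ofReal (-g p)).map X) =
      ∫ p, a (X p) * (g p : ℂ) ∂μ := by
  rw [integral_map_withDensity_ofReal hX hg ha,
    integral_map_withDensity_ofReal (g := fun p => -g p) hX hg.neg ha, ← integral_sub]
  · refine integral_congr_ae (ae_of_all _ fun p => ?_)
    simp only
    rw [← mul_sub, ← Complex.ofReal_sub]
    congr 2
    rcases le_total 0 (g p) with h | h
    · rw [max_eq_left h, max_eq_right (neg_nonpos.2 h), sub_zero]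
    · rw [max_eq_right h, max_eq_left (neg_nonneg.2 h), zero_sub, neg_neg]
  · exact integrable_comp_mul hX hg.pos_part.ofReal ha hC
  · exact integrable_comp_mul hX hg.neg.pos_part.ofReal ha hC

/-- Split F into real and imaginary parts, which uses conjugation invariance of T, and each real
function into positive and negative parts. Their push-forwards under X are finite measures that T
does not distinguish, hence equal, so all bounded measurable functions of X are annihilated. -/
theorem integral_comp_mul_eq_zero_of_separating {T : Set (E → ℂ)}
    (hT : ∀ a ∈ T, Measurable a ∧ ∃ C, ∀ x, ‖a x‖ ≤ C)
    (hconj : ∀ a ∈ T, (fun x => (starRingEnd ℂ) (a x)) ∈ T)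
    (hsep : ∀ (P P' : Measure E) [IsFiniteMeasure P] [IsFiniteMeasure P'],
      (∀ a ∈ T, ∫ x, a x ∂P = ∫ x, a x ∂P') → P = P')
    {X : Ω → E} (hX : Measurable X) {F : Ω → ℂ} (hF : Integrable F μ)
    (h0 : ∀ a ∈ T, ∫ p, a (X p) * F p ∂μ = 0) {χ : E → ℂ} (hχ : Measurable χ) {C : ℝ}
    (hC : ∀ x, ‖χ x‖ ≤ C) : ∫ p, χ (X p) * F p ∂μ = 0 := by
  have hreal : ∀ g : Ω → ℝ, Integrable g μ → (∀ a ∈ T, ∫ p, a (X p) * (g p : ℂ) ∂μ = 0) →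
      ∫ p, χ (X p) * (g p : ℂ) ∂μ = 0 := fun g hg h => by
    have f1 : IsFiniteMeasure (μ.withDensity fun p => ENNReal.ofReal (g p)) :=
      isFiniteMeasure_withDensity_ofReal hg.2
    have f2 : IsFiniteMeasure (μ.withDensity fun p => ENNReal.ofReal (-g p)) :=
      isFiniteMeasure_withDensity_ofReal hg.neg.2
    rw [← integral_sub_map_withDensity hX hg hχ hC, sub_eq_zero]
    rw [hsep ((μ.withDensity fun p => ENNReal.ofReal (g p)).map X)
      ((μ.withDensity fun p => ENNReal.ofReal (-g p)).map X) fun a ha => ?_]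
    obtain ⟨ha1, D, hD⟩ := hT a ha
    rw [← sub_eq_zero, integral_sub_map_withDensity hX hg ha1 hD, h a ha]
  have hbar : ∀ a ∈ T, ∫ p, a (X p) * (starRingEnd ℂ) (F p) ∂μ = 0 := fun a ha => by
    have h1 := congrArg (starRingEnd ℂ) (h0 _ (hconj a ha))
    rw [← integral_conj, map_zero] at h1
    rw [← h1]
    refine integral_congr_ae (ae_of_all _ fun p => ?_)
    simp
  have hFc : Integrable (fun p => (starRingEnd ℂ) (F p)) μ :=
    (Complex.conjCLE.toContinuousLinearMap.integrable_comp hF)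
  have e1 : ∀ p, ((F p).re : ℂ) = (1 / 2 : ℂ) * (F p + (starRingEnd ℂ) (F p)) := fun p => by
    rw [Complex.add_conj]; push_cast; ring
  have e2 : ∀ p, ((F p).im : ℂ) = (-Complex.I / 2) * (F p - (starRingEnd ℂ) (F p)) := fun p => by
    rw [Complex.sub_conj]
    push_cast
    linear_combination ((F p).im : ℂ) * Complex.I_sq
  have hre := hreal (fun p => (F p).re) hF.re fun a ha => by
    obtain ⟨ha1, D, hD⟩ := hT a ha
    have h1 : ∀ p, a (X p) * ((F p).re : ℂ) = (1 / 2 : ℂ) * (a (X p) * F p) +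
        (1 / 2 : ℂ) * (a (X p) * (starRingEnd ℂ) (F p)) := fun p => by rw [e1]; ring
    simp only [h1]
    rw [integral_add ((integrable_comp_mul hX hF ha1 hD).const_mul _)
      ((integrable_comp_mul hX hFc ha1 hD).const_mul _), integral_const_mul, integral_const_mul,
      h0 a ha, hbar a ha]
    simp
  have him := hreal (fun p => (F p).im) hF.im fun a ha => by
    obtain ⟨ha1, D, hD⟩ := hT a ha
    have h1 : ∀ p, a (X p) * ((F p).im : ℂ) = (-Complex.I / 2) * (a (X p) * F p) +
        (Complex.I / 2) * (a (X p) * (starRingEnd ℂ) (F p)) := fun p => by rw [e2]; ring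
    simp only [h1]
    rw [integral_add ((integrable_comp_mul hX hF ha1 hD).const_mul _)
      ((integrable_comp_mul hX hFc ha1 hD).const_mul _), integral_const_mul, integral_const_mul,
      h0 a ha, hbar a ha]
    simp
  have h1 : ∀ p, χ (X p) * F p = χ (X p) * ((F p).re : ℂ) +
      Complex.I * (χ (X p) * ((F p).im : ℂ)) := fun p => by
    conv_lhs => rw [← Complex.re_add_im (F p)]
    ring
  have i1 : Integrable (fun p => ((F p).re : ℂ)) μ := hF.re.ofReal
  have i2 : Integrable (fun p => ((F p).im : ℂ)) μ := hF.im.ofReal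
  simp only [h1]
  rw [integral_add (integrable_comp_mul hX i1 hχ hC)
    ((integrable_comp_mul hX i2 hχ hC).const_mul _), integral_const_mul, hre, him]
  simp

/-- The integral is analytic in the half plane Re z < ε. Its power series at 0 has the moments as
coefficients, so it vanishes on a disc, hence everywhere by the identity theorem. -/
theorem integral_cexp_mul_eq_zero_of_moments {X : Ω → ℝ} (hX : Measurable X) (hX0 : ∀ p, 0 ≤ X p)
    {F : Ω → ℂ} (hFm : AEStronglyMeasurable F μ) {ε : ℝ} (hε : 0 < ε)
    (hF : Integrable (fun p => ((Real.exp (ε * X p) : ℝ) : ℂ) * F p) μ)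
    (hmom : ∀ n : ℕ, ∫ p, (X p : ℂ) ^ n * F p ∂μ = 0) (z : ℂ) (hz : z.re < ε) :
    ∫ p, Complex.exp (z * X p) * F p ∂μ = 0 := by
  set U : Set ℂ := {z | z.re < ε} with hU
  have hUo : IsOpen U := isOpen_lt Complex.continuous_re continuous_const
  have hUc : IsPreconnected U := (convex_halfSpace_re_lt ε).isPreconnected
  have hXc : Measurable fun p => (X p : ℂ) := Complex.measurable_ofReal.comp hX
  have hmeas : ∀ z : ℂ, AEStronglyMeasurable (fun p => Complex.exp (z * X p) * F p) μ := fun z =>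
    (Complex.measurable_exp.comp (hXc.const_mul z)).aestronglyMeasurable.mul hFm
  have hnorm : ∀ (z : ℂ) (p : Ω), ‖Complex.exp (z * X p)‖ = Real.exp (z.re * X p) := fun z p => by
    rw [Complex.norm_exp]; simp
  have hint : ∀ z ∈ U, Integrable (fun p => Complex.exp (z * X p) * F p) μ := fun z hz => by
    refine hF.mono (hmeas z) (ae_of_all _ fun p => ?_)
    rw [norm_mul, norm_mul, hnorm, Complex.norm_real, Real.norm_of_nonneg (Real.exp_pos _).le]
    have := hX0 p
    have hz : z.re < ε := hz
    gcongr
  have hdiff : DifferentiableOn ℂ (fun z => ∫ p, Complex.exp (z * X p) * F p ∂μ) U := by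
    intro z hz
    have hz : z.re < ε := hz
    -- The midpoint leaves a gap ε - c, which absorbs the factor X of the derivative: X ≤ (ε -
    -- c)⁻¹e^{(ε-c)X}.
    set c := (z.re + ε) / 2 with hc
    have hcε : c < ε := by rw [hc]; linarith
    have hnhd : {w : ℂ | w.re < c} ∈ 𝓝 z :=
      (isOpen_lt Complex.continuous_re continuous_const).mem_nhds
        (show z.re < c by rw [hc]; linarith)
    have h1 := hasDerivAt_integral_of_dominated_loc_of_deriv_le (μ := μ)
      (F := fun z p => Complex.exp (z * X p) * F p)
      (F' := fun z p => Complex.exp (z * X p) * X p * F p)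
      (bound := fun p => (ε - c)⁻¹ * ‖((Real.exp (ε * X p) : ℝ) : ℂ) * F p‖) (x₀ := z) hnhd
      (Eventually.of_forall hmeas) (hint z hz)
      (((Complex.measurable_exp.comp (hXc.const_mul z)).mul hXc).aestronglyMeasurable.mul hFm)
      (ae_of_all _ fun p w hw => by
        have hw : w.re < c := hw
        have hX0 := hX0 p
        have hεc : 0 < ε - c := sub_pos.2 hcε
        rw [norm_mul, norm_mul, norm_mul, hnorm, Complex.norm_real, Complex.norm_real,
          Real.norm_of_nonneg (Real.exp_pos _).le, Real.norm_of_nonneg hX0, ← mul_assoc]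
        refine mul_le_mul_of_nonneg_right ?_ (norm_nonneg _)
        have h2 : (ε - c) * X p ≤ Real.exp ((ε - c) * X p) := by
          linarith [Real.add_one_le_exp ((ε - c) * X p)]
        have h3 : X p ≤ (ε - c)⁻¹ * Real.exp ((ε - c) * X p) := by
          rw [le_inv_mul_iff₀ hεc]; exact h2
        calc Real.exp (w.re * X p) * X p ≤
            Real.exp (c * X p) * ((ε - c)⁻¹ * Real.exp ((ε - c) * X p)) := by gcongr
          _ = (ε - c)⁻¹ * (Real.exp (c * X p) * Real.exp ((ε - c) * X p)) := by ring
          _ = _ := by rw [← Real.exp_add]; ring_nf)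
      (hF.norm.const_mul _)
      (ae_of_all _ fun p w _ => by
        have : HasDerivAt (fun z : ℂ => Complex.exp (z * X p)) (Complex.exp (w * X p) * X p) w := by
          simpa using ((hasDerivAt_id w).mul_const (X p : ℂ)).cexp
        exact this.mul_const _)
    exact h1.2.differentiableAt.differentiableWithinAt
  have hloc : (fun z => ∫ p, Complex.exp (z * X p) * F p ∂μ) =ᶠ[𝓝 0] 0 := by
    filter_upwards [Metric.ball_mem_nhds (0 : ℂ) hε] with w hw
    have hw : ‖w‖ < ε := mem_ball_zero_iff.1 hw
    have h1 := hasSum_integral_of_dominated_convergence (μ := μ)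
      (F := fun (n : ℕ) p => (w * X p) ^ n / n.factorial * F p)
      (f := fun p => Complex.exp (w * X p) * F p)
      (bound := fun n p => (‖w‖ * X p) ^ n / n.factorial * ‖F p‖)
      (fun n => (((hXc.const_mul w).pow_const n).div_const _).aestronglyMeasurable.mul hFm)
      (fun n => ae_of_all _ fun p => by
        rw [norm_mul, norm_div, norm_pow, norm_mul, Complex.norm_real,
          Real.norm_of_nonneg (hX0 p)]
        simp)
      (ae_of_all _ fun p => (Real.summable_pow_div_factorial _).mul_right _)
      (by
        refine (hF.mono (?_ : AEStronglyMeasurable (fun p => Real.exp (‖w‖ * X p) * ‖F p‖) μ)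
          (ae_of_all _ fun p => ?_)).congr (ae_of_all _ fun p => ?_)
        · exact (Real.measurable_exp.comp (hX.const_mul _)).aestronglyMeasurable.mul hFm.norm
        · rw [norm_mul, norm_mul, norm_norm, Complex.norm_real,
            Real.norm_of_nonneg (Real.exp_pos _).le, Real.norm_of_nonneg (Real.exp_pos _).le]
          have := hX0 p
          gcongr
        · simp only
          rw [tsum_mul_right, Real.exp_eq_exp_ℝ, NormedSpace.exp_eq_tsum_div])
      (ae_of_all _ fun p => by
        have := (NormedSpace.expSeries_div_hasSum_exp (w * X p : ℂ)).mul_right (F p)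
        rwa [← Complex.exp_eq_exp_ℂ] at this)
    refine h1.unique ?_
    have h2 : ∀ n : ℕ, ∫ p, (w * X p) ^ n / n.factorial * F p ∂μ = 0 := fun n => by
      have h3 : ∀ p, (w * X p) ^ n / n.factorial * F p =
          (w ^ n / n.factorial) * ((X p : ℂ) ^ n * F p) := fun p => by rw [mul_pow]; ring
      simp only [h3]
      rw [integral_const_mul, hmom, mul_zero]
    simp only [h2]
    exact hasSum_zero
  exact (hdiff.analyticOnNhd hUo).eqOn_zero_of_preconnected_of_eventuallyEq_zero hUc
    (show (0 : ℂ) ∈ U from hε) hloc hz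

/-- On the imaginary axis the exponential integrals are those tested by characteristic functions,
and these determine finite measures. The exponential moment makes the moment problem determinate. -/
theorem integral_comp_mul_eq_zero_of_moments {X : Ω → ℝ} (hX : Measurable X) (hX0 : ∀ p, 0 ≤ X p)
    {F : Ω → ℂ} (hFm : Integrable F μ) {ε : ℝ} (hε : 0 < ε)
    (hF : Integrable (fun p => ((Real.exp (ε * X p) : ℝ) : ℂ) * F p) μ)
    (hmom : ∀ n : ℕ, ∫ p, (X p : ℂ) ^ n * F p ∂μ = 0)
    {χ : ℝ → ℂ} (hχ : Measurable χ) {C : ℝ} (hC : ∀ x, ‖χ x‖ ≤ C) :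
    ∫ p, χ (X p) * F p ∂μ = 0 := by
  refine integral_comp_mul_eq_zero_of_separating
    (T := Set.range fun (ξ : ℝ) (x : ℝ) => Complex.exp (ξ * x * Complex.I)) ?_ ?_ ?_ hX hFm ?_ hχ hC
  · rintro _ ⟨ξ, rfl⟩
    refine ⟨by fun_prop, 1, fun x => ?_⟩
    simp only
    rw [← Complex.ofReal_mul, Complex.norm_exp_ofReal_mul_I]
  · rintro _ ⟨ξ, rfl⟩
    refine ⟨-ξ, ?_⟩
    ext x
    simp only
    rw [← Complex.exp_conj]
    simp
  · intro P P' _ _ h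
    refine Measure.ext_of_charFun ?_
    ext ξ
    rw [charFun_apply_real, charFun_apply_real]
    exact h _ ⟨ξ, rfl⟩
  · rintro _ ⟨ξ, rfl⟩
    have := integral_cexp_mul_eq_zero_of_moments hX hX0 hFm.aestronglyMeasurable hε hF hmom
      (ξ * Complex.I) (by simpa using hε)
    rw [← this]
    refine integral_congr_ae (ae_of_all _ fun p => ?_)
    simp only
    ring_nf

end Separating

/-! ### Completeness of the Gaussian modes -/

/-- The functions `e^{ikθ} χ(r²)` with `χ` bounded and measurable, as a submonoid. -/
def angularMonoid : Submonoid (Plane → ℂ) where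
  carrier := {a | ∃ (k : ℤ) (χ : ℝ → ℂ), Measurable χ ∧ (∃ C, ∀ ρ, ‖χ ρ‖ ≤ C) ∧
    a = fun x => Complex.exp (Complex.I * k * planeArg x) * χ (‖x‖ ^ 2)}
  mul_mem' := by
    rintro _ _ ⟨k, χ, hχ, ⟨C, hC⟩, rfl⟩ ⟨l, ψ, hψ, ⟨D, hD⟩, rfl⟩
    refine ⟨k + l, fun ρ => χ ρ * ψ ρ, hχ.mul hψ, ⟨C * D, fun ρ => ?_⟩, ?_⟩
    · rw [norm_mul]
      have := (norm_nonneg _).trans (hC ρ)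
      gcongr
      exacts [hC ρ, hD ρ]
    · ext x
      have : Complex.I * ((k + l : ℤ) : ℂ) * planeArg x =
          Complex.I * k * planeArg x + Complex.I * l * planeArg x := by push_cast; ring
      rw [this, Complex.exp_add, Pi.mul_apply]
      ring
  one_mem' := ⟨0, fun _ => 1, measurable_const, ⟨1, fun _ => by simp⟩, by ext x; simp⟩

theorem conj_mem_angularMonoid {a : Plane → ℂ} (ha : a ∈ angularMonoid) :
    (fun x => (starRingEnd ℂ) (a x)) ∈ angularMonoid := by
  obtain ⟨k, χ, hχ, ⟨C, hC⟩, rfl⟩ := ha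
  refine ⟨-k, fun ρ => (starRingEnd ℂ) (χ ρ), Complex.continuous_conj.measurable.comp hχ,
    ⟨C, fun ρ => by simpa using hC ρ⟩, ?_⟩
  ext x
  rw [map_mul, ← Complex.exp_conj]
  simp

theorem conj_mem_adjoin_angularMonoid {a : Plane → ℂ}
    (ha : a ∈ Algebra.adjoin ℂ (angularMonoid : Set (Plane → ℂ))) :
    (fun x => (starRingEnd ℂ) (a x)) ∈ Algebra.adjoin ℂ (angularMonoid : Set (Plane → ℂ)) := by
  induction ha using Algebra.adjoin_induction with
  | mem a ha => exact Algebra.subset_adjoin (conj_mem_angularMonoid ha)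
  | algebraMap c => exact Subalgebra.algebraMap_mem _ ((starRingEnd ℂ) c)
  | add a b _ _ ha hb =>
    have := Subalgebra.add_mem _ ha hb
    simpa [Pi.add_def] using this
  | mul a b _ _ ha hb =>
    have := Subalgebra.mul_mem _ ha hb
    simpa [Pi.mul_def] using this

theorem measurable_of_mem_angularMonoid {a : Plane → ℂ} (ha : a ∈ angularMonoid) :
    Measurable a ∧ ∃ C, ∀ x, ‖a x‖ ≤ C := by
  obtain ⟨k, χ, hχ, ⟨C, hC⟩, rfl⟩ := ha
  refine ⟨?_, C, fun x => ?_⟩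
  · exact (Complex.measurable_exp.comp
      ((Complex.measurable_ofReal.comp measurable_planeArg).const_mul _)).mul
      (hχ.comp (measurable_norm.pow_const 2))
  · rw [norm_mul, norm_exp_I_int_mul, one_mul]
    exact hC _

/-- The bounded continuous functions in the span of the angular monomials. -/
def angularAlgebra : StarSubalgebra ℂ (BoundedContinuousFunction Plane ℂ) where
  carrier := {g | (g : Plane → ℂ) ∈ Algebra.adjoin ℂ (angularMonoid : Set (Plane → ℂ))}
  mul_mem' := fun hf hg =>
    Subalgebra.mul_mem (Algebra.adjoin ℂ (angularMonoid : Set (Plane → ℂ))) hf hg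
  one_mem' := Subalgebra.one_mem (Algebra.adjoin ℂ (angularMonoid : Set (Plane → ℂ)))
  add_mem' := fun hf hg =>
    Subalgebra.add_mem (Algebra.adjoin ℂ (angularMonoid : Set (Plane → ℂ))) hf hg
  zero_mem' := Subalgebra.zero_mem (Algebra.adjoin ℂ (angularMonoid : Set (Plane → ℂ)))
  algebraMap_mem' := fun c =>
    Subalgebra.algebraMap_mem (Algebra.adjoin ℂ (angularMonoid : Set (Plane → ℂ))) c
  star_mem' := fun hf => conj_mem_adjoin_angularMonoid hf

theorem exp_planeArg_mul_norm (x : Plane) :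
    Complex.exp (Complex.I * (1 : ℤ) * planeArg x) * (‖x‖ : ℂ) = planeComplex x := by
  rw [planeArg_eq, ← norm_planeComplex, mul_comm]
  have : Complex.I * (1 : ℤ) * ((planeComplex x).arg : ℂ) = (planeComplex x).arg * Complex.I := by
    push_cast; ring
  rw [this, Complex.norm_mul_exp_arg_mul_I]

theorem planeComplex_injective : Function.Injective planeComplex := by
  intro x y h
  rw [← sub_eq_zero, ← map_sub] at h
  by_contra h1
  exact planeComplex_ne_zero (sub_ne_zero.2 h1) h

/-- The two functions e^{-r²} and z e^{-r²} suffice: their quotient is z. -/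
theorem separatesPoints_angularAlgebra :
    (angularAlgebra.map (BoundedContinuousFunction.toContinuousMapStarₐ ℂ)).SeparatesPoints := by
  have hE : ∀ x : Plane, ‖((Real.exp (-‖x‖ ^ 2) : ℝ) : ℂ)‖ ≤ 1 := fun x => by
    rw [Complex.norm_real, Real.norm_of_nonneg (Real.exp_pos _).le, Real.exp_le_one_iff]
    have : 0 ≤ ‖x‖ ^ 2 := by positivity
    linarith
  have hr : ∀ r : ℝ, 0 ≤ r → r * Real.exp (-r ^ 2) ≤ Real.exp (1 / 4) := fun r hr => by
    have := rpow_mul_exp_neg_sq_le (ν := 1) zero_le_one one_pos hr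
    simpa using this
  set g1 : BoundedContinuousFunction Plane ℂ := BoundedContinuousFunction.ofNormedAddCommGroup
    (fun x => ((Real.exp (-‖x‖ ^ 2) : ℝ) : ℂ)) (by fun_prop) 1 hE with hg1
  set g2 : BoundedContinuousFunction Plane ℂ := BoundedContinuousFunction.ofNormedAddCommGroup
    (fun x => planeComplex x * ((Real.exp (-‖x‖ ^ 2) : ℝ) : ℂ)) (by fun_prop) (Real.exp (1 / 4))
    (fun x => by
      rw [norm_mul, norm_planeComplex, Complex.norm_real, Real.norm_of_nonneg (Real.exp_pos _).le]
      exact hr _ (norm_nonneg _)) with hg2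
  have m1 : g1 ∈ angularAlgebra := by
    -- The radial profile must be bounded on all of ℝ, not only for ρ ≥ 0; hence |ρ|.
    refine Algebra.subset_adjoin ⟨0, fun ρ => ((Real.exp (-|ρ|) : ℝ) : ℂ), by fun_prop,
      ⟨1, fun ρ => ?_⟩, ?_⟩
    · rw [Complex.norm_real, Real.norm_of_nonneg (Real.exp_pos _).le, Real.exp_le_one_iff]
      have := abs_nonneg ρ
      linarith
    · ext x
      simp [hg1]
  have m2 : g2 ∈ angularAlgebra := by
    refine Algebra.subset_adjoin ⟨1, fun ρ => ((√ρ * Real.exp (-(√ρ) ^ 2) : ℝ) : ℂ), by fun_prop,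
      ⟨Real.exp (1 / 4), fun ρ => ?_⟩, ?_⟩
    · rw [Complex.norm_real, Real.norm_of_nonneg (by positivity)]
      exact hr _ (Real.sqrt_nonneg _)
    · ext x
      simp only [Real.sqrt_sq (norm_nonneg _)]
      change planeComplex x * ((Real.exp (-‖x‖ ^ 2) : ℝ) : ℂ) = _
      rw [Complex.ofReal_mul, ← mul_assoc, exp_planeArg_mul_norm]
  intro x y hxy
  by_contra hne
  push Not at hne
  have e1 : g1 x = g1 y := hne g1 ⟨g1.toContinuousMap, ⟨g1, m1, rfl⟩, rfl⟩
  have e2 : g2 x = g2 y := hne g2 ⟨g2.toContinuousMap, ⟨g2, m2, rfl⟩, rfl⟩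
  change ((Real.exp (-‖x‖ ^ 2) : ℝ) : ℂ) = ((Real.exp (-‖y‖ ^ 2) : ℝ) : ℂ) at e1
  change planeComplex x * ((Real.exp (-‖x‖ ^ 2) : ℝ) : ℂ) =
    planeComplex y * ((Real.exp (-‖y‖ ^ 2) : ℝ) : ℂ) at e2
  rw [e1] at e2
  refine hxy (planeComplex_injective (mul_right_cancel₀ ?_ e2))
  exact_mod_cast (Real.exp_pos _).ne'

/-- The monomials are closed under products, so the algebra they generate is their span and F
annihilates it. It contains a point-separating star algebra of bounded continuous functions, which
determines finite measures; indicators of measurable sets are therefore annihilated too. -/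
theorem ae_eq_zero_of_integral_angular {F : Plane → ℂ} (hF : Integrable F volume)
    (h : ∀ a ∈ angularMonoid, ∫ x, a x * F x = 0) : F =ᵐ[volume] 0 := by
  have hspan : ∀ a ∈ Algebra.adjoin ℂ (angularMonoid : Set (Plane → ℂ)),
      Integrable (fun x => a x * F x) volume ∧ ∫ x, a x * F x = 0 := by
    intro a ha
    rw [← Subalgebra.mem_toSubmodule, Algebra.adjoin_eq_span, Submonoid.closure_eq] at ha
    induction ha using Submodule.span_induction with
    | mem a ha =>
      obtain ⟨hm, C, hC⟩ := measurable_of_mem_angularMonoid ha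
      exact ⟨integrable_comp_mul measurable_id hF hm hC, h a ha⟩
    | zero => simp
    | add a b _ _ ha hb =>
      simp only [Pi.add_apply, add_mul]
      exact ⟨ha.1.add hb.1, by rw [integral_add ha.1 hb.1, ha.2, hb.2, add_zero]⟩
    | smul c a _ ha =>
      simp only [Pi.smul_apply, smul_eq_mul, mul_assoc]
      exact ⟨ha.1.const_mul c, by rw [integral_const_mul, ha.2, mul_zero]⟩
  refine hF.ae_eq_zero_of_forall_setIntegral_eq_zero fun s hs _ => ?_
  have key := integral_comp_mul_eq_zero_of_separating
    (T := {a : Plane → ℂ | ∃ g ∈ angularAlgebra, (g : Plane → ℂ) = a}) (X := id) (μ := volume)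
    (F := F) (χ := s.indicator fun _ => 1) (C := 1) ?_ ?_ ?_ measurable_id hF ?_
    (measurable_const.indicator hs) ?_
  · rw [← integral_indicator hs, ← key]
    refine integral_congr_ae (ae_of_all _ fun x => ?_)
    by_cases hx : x ∈ s <;> simp [hx]
  · rintro _ ⟨g, -, rfl⟩
    exact ⟨g.continuous.measurable, ‖g‖, g.norm_coe_le_norm⟩
  · rintro _ ⟨g, hg, rfl⟩
    exact ⟨star g, star_mem hg, rfl⟩
  · intro P P' _ _ hP
    exact ext_of_forall_mem_subalgebra_integral_eq_of_polish separatesPoints_angularAlgebra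
      fun g hg => hP g ⟨g, hg, rfl⟩
  · rintro _ ⟨g, hg, rfl⟩
    exact (hspan _ hg).2
  · intro x
    by_cases hx : x ∈ s <;> simp [hx]

/-- For fixed k, orthogonality to all n says that e^{ikθ} r^ν e^{-sρ} f̄ has vanishing moments in ρ,
while e^{sρ/2} times it is still integrable. So the moment lemma annihilates every bounded radial
weight, and varying k gives all angular monomials. -/
theorem eq_zero_of_inner_gaussVec (α : ℝ) {s : ℝ} (hs : 0 < s) (f : L2Plane)
    (h : ∀ k n, inner ℂ f (gaussVec α k n s) = 0) : f = 0 := by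
  have hs2 : 0 < s / 2 := half_pos hs
  have h1 : ∀ (k : ℤ) (χ : ℝ → ℂ), Measurable χ → ∀ C, (∀ ρ, ‖χ ρ‖ ≤ C) →
      ∫ x, χ (‖x‖ ^ 2) * (mode α k (gaussMono 0 s) x * (starRingEnd ℂ) (f x)) = 0 := by
    intro k χ hχ C hC
    refine integral_comp_mul_eq_zero_of_moments (X := fun x : Plane => ‖x‖ ^ 2) (μ := volume)
      (measurable_norm.pow_const 2) (fun x => by positivity)
      (integrable_mode_mul_conj α k 0 hs f) hs2 ?_ (fun n => ?_) hχ hC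
    · refine (integrable_mode_mul_conj α k 0 hs2 f).congr (ae_of_all _ fun x => ?_)
      simp only [mode, gaussMono]
      have : Real.exp (-(s / 2) * ‖x‖ ^ 2) =
          Real.exp (s / 2 * ‖x‖ ^ 2) * Real.exp (-s * ‖x‖ ^ 2) := by
        rw [← Real.exp_add]; ring_nf
      rw [this]
      push_cast
      ring
    · rw [← h k n, inner_gaussVec α k n hs]
      refine integral_congr_ae (ae_of_all _ fun x => ?_)
      simp only [mode, gaussMono]
      push_cast
      ring
  -- Localisation to annuli makes f integrable and lets the weight r^ν e^{-sρ} be divided out by a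
  -- bounded function; the annuli exhaust the punctured plane.
  have h2 : ∀ N : ℕ, (fun x => (Set.Icc ((N : ℝ) + 1)⁻¹ (N + 1)).indicator (fun _ => (1 : ℂ))
      (‖x‖ ^ 2) * (starRingEnd ℂ) (f x)) =ᵐ[volume] 0 := by
    intro N
    set J : Set ℝ := Set.Icc ((N : ℝ) + 1)⁻¹ (N + 1) with hJ
    have hJpos : ∀ ρ ∈ J, 0 < ρ := fun ρ hρ => lt_of_lt_of_le (by positivity) hρ.1
    have hint : Integrable (fun x : Plane => J.indicator (fun _ => (1 : ℂ)) (‖x‖ ^ 2) *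
        (starRingEnd ℂ) (f x)) volume := by
      have hm : Measurable fun x : Plane => J.indicator (fun _ => (1 : ℂ)) (‖x‖ ^ 2) :=
        (measurable_const.indicator measurableSet_Icc).comp (measurable_norm.pow_const 2)
      have h3 : MemLp (fun x : Plane => J.indicator (fun _ => (1 : ℂ)) (‖x‖ ^ 2)) 2 volume := by
        -- On the annulus ρ ≤ N + 1, so the indicator is at most e^{N+1}e^{-ρ}.
        refine (memLp_mode_gaussMono 0 0 0 one_pos).const_mul ((Real.exp (N + 1) : ℝ) : ℂ)
          |>.mono hm.aestronglyMeasurable (ae_of_all _ fun x => ?_)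
        rw [norm_mul, norm_mode]
        by_cases hx : ‖x‖ ^ 2 ∈ J
        · rw [Set.indicator_of_mem hx]
          simp only [norm_one, Complex.norm_real, gaussMono, pow_zero, one_mul, Int.cast_zero,
            add_zero, abs_zero, Real.rpow_zero, Real.norm_of_nonneg (Real.exp_pos _).le,
            abs_of_pos (Real.exp_pos _)]
          rw [← Real.exp_add, Real.one_le_exp_iff]
          linarith [hx.2]
        · rw [Set.indicator_of_notMem hx, norm_zero]
          positivity
      exact h3.integrable_mul (Lp.memLp f).star
    refine ae_eq_zero_of_integral_angular hint ?_
    rintro _ ⟨k, χ, hχ, ⟨C, hC⟩, rfl⟩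
    set ν := |(k : ℝ) + α| with hν
    have hcont : ContinuousOn (fun ρ : ℝ => ρ ^ (-(ν / 2)) * Real.exp (s * ρ)) J := by
      refine ContinuousOn.mul (fun ρ hρ => ?_) (by fun_prop)
      exact (Real.continuousAt_rpow_const _ _ (Or.inl (hJpos ρ hρ).ne')).continuousWithinAt
    obtain ⟨D, hD⟩ := isCompact_Icc.exists_bound_of_continuousOn hcont
    have hm : Measurable fun ρ : ℝ => ((ρ ^ (-(ν / 2)) * Real.exp (s * ρ) : ℝ) : ℂ) := by
      fun_prop
    have h4 := h1 k (J.indicator fun ρ => ((ρ ^ (-(ν / 2)) * Real.exp (s * ρ) : ℝ) : ℂ) * χ ρ)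
      ((hm.mul hχ).indicator measurableSet_Icc) (|D| * |C|) (fun ρ => by
        by_cases hρ : ρ ∈ J
        · rw [Set.indicator_of_mem hρ, norm_mul, Complex.norm_real]
          gcongr
          exacts [(hD ρ hρ).trans (le_abs_self _), (hC ρ).trans (le_abs_self _)]
        · rw [Set.indicator_of_notMem hρ, norm_zero]
          positivity)
    rw [← h4]
    refine integral_congr_ae (ae_of_all _ fun x => ?_)
    by_cases hx : ‖x‖ ^ 2 ∈ J
    · simp only [Set.indicator_of_mem hx, mode, gaussMono]
      have e1 : (‖x‖ ^ 2) ^ (-(ν / 2)) * Real.exp (s * ‖x‖ ^ 2) *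
          (‖x‖ ^ ν * (‖x‖ ^ 2) ^ 0 * Real.exp (-s * ‖x‖ ^ 2)) = 1 := by
        have hx0 : 0 < ‖x‖ ^ 2 := hJpos _ hx
        have e2 : ‖x‖ ^ ν = (‖x‖ ^ 2) ^ (ν / 2) := by
          rw [← Real.rpow_natCast, ← Real.rpow_mul (norm_nonneg _)]
          congr 1
          push_cast
          ring
        rw [e2, Real.rpow_neg hx0.le, neg_mul, Real.exp_neg]
        have := (Real.rpow_pos_of_pos hx0 (ν / 2)).ne'
        field_simp
      rw [← hν]
      have e3 := congrArg (fun r : ℝ => (r : ℂ)) e1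
      push_cast at e3 ⊢
      linear_combination (-(Complex.exp (Complex.I * k * planeArg x) * χ (‖x‖ ^ 2) *
        (starRingEnd ℂ) (f x))) * e3
    · simp [Set.indicator_of_notMem hx]
  rw [Lp.eq_zero_iff_ae_eq_zero]
  filter_upwards [ae_all_iff.2 h2, ae_ne_zero_plane] with x hx hx0
  have hρ : 0 < ‖x‖ ^ 2 := pow_pos (norm_pos_iff.2 hx0) 2
  obtain ⟨N, hN⟩ := exists_nat_ge (max (‖x‖ ^ 2) (‖x‖ ^ 2)⁻¹)
  have h3 := hx N
  rw [Set.indicator_of_mem] at h3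
  · simpa using h3
  · constructor
    · rw [inv_le_comm₀ (by positivity) hρ]
      exact (le_max_right _ _).trans (hN.trans (by linarith))
    · exact (le_max_left _ _).trans (hN.trans (by linarith))

/-- Repeated differentiation in s passes from n = 0 to every n, so orthogonality for all s > 0 at n
= 0 is enough. -/
theorem eq_zero_of_inner_gaussVec_zero (α : ℝ) (f : L2Plane)
    (h : ∀ (k : ℤ) (s : ℝ), 0 < s → inner ℂ f (gaussVec α k 0 s) = 0) : f = 0 := by
  have h1 : ∀ (k : ℤ) (n : ℕ) (s : ℝ), 0 < s → inner ℂ f (gaussVec α k n s) = 0 := by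
    intro k n
    induction n with
    | zero => exact h k
    | succ n ih =>
      intro s hs
      have h2 := hasDerivAt_inner_gaussVec α k n hs f
      have h3 : HasDerivAt (fun s => inner ℂ f (gaussVec α k n s)) 0 s := by
        refine (hasDerivAt_const s (0 : ℂ)).congr_of_eventuallyEq ?_
        filter_upwards [lt_mem_nhds hs] with t ht
        exact ih t ht
      have h4 := h2.unique h3
      rwa [neg_eq_zero] at h4
  exact eq_zero_of_inner_gaussVec α one_pos f fun k n => h1 k n 1 one_pos

/-- At s = B₀/4 the triangular formula puts every Gaussian mode in a span of eigenvectors. Within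
one sector the diagonal entries increase in steps of 2B₀, so they are distinct; a vector orthogonal
to all eigenspaces is thus orthogonal to a total family. -/
theorem exists_hilbertBasis_hamiltonianGraph (α : ℝ) {B₀ : ℝ} (hB : 0 < B₀) :
    ∃ (ι : Type) (b : HilbertBasis ι ℂ L2Plane) (lam : ι → ℝ),
      (∀ i, 0 ≤ lam i) ∧ ∀ i, (b i, (lam i : ℂ) • b i) ∈ hamiltonianGraph α B₀ := by
  obtain ⟨ι, b, lam, hb⟩ := exists_hilbertBasis_relEigenspace (isClosed_hamiltonianGraph α B₀)
    (hamiltonianGraph_symm α B₀) (fun u hu => by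
      have hs : 0 < B₀ / 4 := by positivity
      refine eq_zero_of_inner_gaussVec α hs u fun k n => ?_
      have h1 := mem_span_relEigenspace (G := hamiltonianGraph α B₀)
        (v := fun n => gaussVec α k n (B₀ / 4))
        (lam := fun n => 8 * (B₀ / 4) * n + 4 * (|(k : ℝ) + α| + 1) * (B₀ / 4) + B₀ * (k + α))
        (c := fun n => 4 * n * (n + |(k : ℝ) + α|)) (fun m n hmn => by
          simp only [add_left_inj] at hmn
          exact_mod_cast mul_left_cancel₀ (by positivity) hmn) (fun n => by
          have h2 := gaussVec_mem_hamiltonianGraph α B₀ k n hs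
          have h3 : B₀ ^ 2 / 4 - 4 * (B₀ / 4) ^ 2 = 0 := by ring
          rw [h3] at h2
          simpa using h2) (by simp) n
      have h2 : Submodule.span ℂ (⋃ j ∈ Set.Iic n, (relEigenspace (hamiltonianGraph α B₀)
          (8 * (B₀ / 4) * j + 4 * (|(k : ℝ) + α| + 1) * (B₀ / 4) + B₀ * (k + α)) :
          Set L2Plane)) ≤ (Submodule.span ℂ {u})ᗮ := by
        rw [Submodule.span_le]
        intro x hx
        simp only [Set.mem_iUnion] at hx
        obtain ⟨j, -, hx⟩ := hx
        rw [SetLike.mem_coe, Submodule.mem_orthogonal_singleton_iff_inner_left]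
        exact hu _ x hx
      exact (Submodule.mem_orthogonal_singleton_iff_inner_right).1 (h2 h1))
  refine ⟨ι, b, lam, fun i => ?_, hb⟩
  refine nonneg_of_mem_hamiltonianGraph α B₀ (fun h => ?_) (hb i)
  have := b.orthonormal.1 i
  rw [h, norm_zero] at this
  exact zero_ne_one this

/-! ### Bounds for modified Bessel functions -/

/-- The terms of the series of `I_ν(2w)`. -/
def besselTerm (ν w : ℝ) (m : ℕ) : ℝ :=
  w ^ (2 * (m : ℝ) + ν) / ((m.factorial : ℝ) * Real.Gamma ((m : ℝ) + ν + 1))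

theorem besselI_eq_tsum (ν z : ℝ) : besselI ν z = ∑' m, besselTerm ν (z / 2) m := rfl

theorem besselTerm_nonneg {ν w : ℝ} (hν : 0 ≤ ν) (hw : 0 ≤ w) (m : ℕ) : 0 ≤ besselTerm ν w m := by
  have := Real.Gamma_pos_of_pos (show 0 < (m : ℝ) + ν + 1 by positivity)
  rw [besselTerm]
  positivity

theorem besselTerm_natCast (n : ℕ) (w : ℝ) (m : ℕ) :
    besselTerm n w m = w ^ (2 * m + n) / (m.factorial * (m + n).factorial) := by
  rw [besselTerm]
  have h1 : 2 * (m : ℝ) + n = ((2 * m + n : ℕ) : ℝ) := by push_cast; ring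
  have h2 : (m : ℝ) + n + 1 = ((m + n : ℕ) : ℝ) + 1 := by push_cast; ring
  rw [h1, h2, Real.rpow_natCast, Real.Gamma_nat_eq_factorial]

/-- Log-convexity of Γ at x = N + β + 1 and x + 1 with weights β and 1 - β, whose mean is N + 2. The
functional equation Γ(x + 1) = xΓ(x) leaves Γ(N + 2) ≤ x^{1-β}Γ(x). -/
theorem inv_Gamma_le {N : ℕ} {β : ℝ} (h0 : 0 ≤ β) (h1 : β ≤ 1) :
    (Real.Gamma (N + β + 1))⁻¹ ≤ ((N : ℝ) + 1 + β) ^ (1 - β) / (N + 1).factorial := by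
  have hG := Real.Gamma_pos_of_pos (show 0 < (N : ℝ) + β + 1 by positivity)
  rcases h0.eq_or_lt with rfl | h0
  · rw [add_zero, add_zero, sub_zero, Real.rpow_one, Real.Gamma_nat_eq_factorial,
      Nat.factorial_succ]
    push_cast
    field_simp
    rfl
  rcases h1.eq_or_lt with rfl | h1
  · have : (N : ℝ) + 1 + 1 = ((N + 1 : ℕ) : ℝ) + 1 := by push_cast; ring
    rw [sub_self, Real.rpow_zero, this, Real.Gamma_nat_eq_factorial, one_div]
  have h2 := Real.Gamma_mul_add_mul_le_rpow_Gamma_mul_rpow_Gamma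
    (show 0 < (N : ℝ) + β + 1 by positivity) (show 0 < (N : ℝ) + β + 1 + 1 by positivity)
    h0 (sub_pos.2 h1) (add_sub_cancel β 1)
  have h3 : β * ((N : ℝ) + β + 1) + (1 - β) * (N + β + 1 + 1) = ((N + 1 : ℕ) : ℝ) + 1 := by
    push_cast; ring
  rw [h3, Real.Gamma_nat_eq_factorial,
    Real.Gamma_add_one (show (N : ℝ) + β + 1 ≠ 0 by positivity), Real.mul_rpow (by positivity) hG.le, mul_left_comm, ← Real.rpow_add hG, add_sub_cancel,
    Real.rpow_one] at h2
  rw [inv_le_iff_one_le_mul₀ hG, div_mul_eq_mul_div, one_le_div (by positivity)]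
  rwa [add_right_comm]

/-- Weighted AM-GM bounds w^β(N + 1 + β)^{1-β} by w + 2(N + 1), the constant 2 coming from N + 1 + β
≤ 2(N + 1). The two summands give the terms of orders n + 1 and n. -/
theorem besselTerm_add_le {n : ℕ} {β w : ℝ} (h0 : 0 ≤ β) (h1 : β ≤ 1) (hw : 0 ≤ w) (m : ℕ) :
    besselTerm (n + β) w m ≤ 2 * besselTerm n w m + besselTerm (n + 1 : ℕ) w m := by
  have hG := Real.Gamma_pos_of_pos (show 0 < ((m + n : ℕ) : ℝ) + β + 1 by positivity)
  have key : w ^ β * (Real.Gamma ((m + n : ℕ) + β + 1))⁻¹ ≤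
      2 / (m + n).factorial + w / (m + n + 1).factorial := by
    set N := m + n
    have h2 := Real.geom_mean_le_arith_mean2_weighted h0 (sub_nonneg.2 h1) hw
      (show 0 ≤ (N : ℝ) + 1 + β by positivity) (add_sub_cancel β 1)
    have h3 : β * w ≤ w := mul_le_of_le_one_left hw h1
    have h4 : (1 - β) * ((N : ℝ) + 1 + β) ≤ 1 * (2 * (N + 1)) := by
      gcongr
      · linarith
      · have : (0 : ℝ) ≤ N := Nat.cast_nonneg N
        linarith
    calc w ^ β * (Real.Gamma (N + β + 1))⁻¹ ≤
        w ^ β * (((N : ℝ) + 1 + β) ^ (1 - β) / (N + 1).factorial) := by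
          gcongr; exact inv_Gamma_le h0 h1
      _ = (w ^ β * ((N : ℝ) + 1 + β) ^ (1 - β)) / (N + 1).factorial := by ring
      _ ≤ (w + 2 * (N + 1)) / (N + 1).factorial := by gcongr; linarith
      _ = _ := by
        rw [Nat.factorial_succ]
        push_cast
        field_simp
        ring
  rw [besselTerm_natCast, besselTerm_natCast, besselTerm]
  have e1 : w ^ (2 * (m : ℝ) + (n + β)) = w ^ (2 * m + n) * w ^ β := by
    rw [← Real.rpow_natCast, ← Real.rpow_add_of_nonneg hw (by positivity) h0]
    congr 1
    push_cast
    ring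
  have e2 : (m : ℝ) + (n + β) + 1 = (m + n : ℕ) + β + 1 := by push_cast; ring
  rw [e1, e2]
  calc _ = w ^ (2 * m + n) / m.factorial * (w ^ β * (Real.Gamma ((m + n : ℕ) + β + 1))⁻¹) := by
        field_simp
    _ ≤ w ^ (2 * m + n) / m.factorial * (2 / (m + n).factorial + w / (m + n + 1).factorial) := by
        gcongr
    _ = _ := by
      rw [← add_assoc, ← add_assoc, pow_succ]
      field_simp

/-- Expand e^{we^τ}e^{we^{-τ}} = e^{2w cosh τ} as a double exponential series. The terms in question
are those at index (m + n, m), a subfamily of a nonnegative series. -/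
theorem summable_exp_mul_besselTerm_prod {w : ℝ} (hw : 0 ≤ w) (τ : ℝ) :
    Summable (fun p : ℕ × ℕ => Real.exp (p.1 * τ) * besselTerm p.1 w p.2) ∧
    ∑' p : ℕ × ℕ, Real.exp (p.1 * τ) * besselTerm p.1 w p.2 ≤ Real.exp (2 * w * Real.cosh τ) := by
  set u : ℕ → ℝ := fun i => (w * Real.exp τ) ^ i / i.factorial with hu
  set v : ℕ → ℝ := fun i => (w * Real.exp (-τ)) ^ i / i.factorial with hv
  have hu0 : ∀ i, 0 ≤ u i := fun i => by simp only [hu]; positivity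
  have hv0 : ∀ i, 0 ≤ v i := fun i => by simp only [hv]; positivity
  have su : Summable u := Real.summable_pow_div_factorial _
  have sv : Summable v := Real.summable_pow_div_factorial _
  have suv := su.mul_of_nonneg sv hu0 hv0
  have htsum : ∑' p : ℕ × ℕ, u p.1 * v p.2 = Real.exp (2 * w * Real.cosh τ) := by
    rw [← su.tsum_mul_tsum sv suv]
    have e : ∀ x : ℝ, ∑' i : ℕ, x ^ i / i.factorial = Real.exp x := fun x => by
      rw [Real.exp_eq_exp_ℝ, NormedSpace.exp_eq_tsum_div]
    rw [hu, hv, e, e, ← Real.exp_add, Real.cosh_eq]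
    ring_nf
  have hinj : Function.Injective fun p : ℕ × ℕ => (p.2 + p.1, p.2) := by
    rintro ⟨a, b⟩ ⟨c, d⟩ h
    simp only [Prod.mk.injEq] at h ⊢
    omega
  have heq : (fun p : ℕ × ℕ => Real.exp (p.1 * τ) * besselTerm p.1 w p.2) =
      (fun p : ℕ × ℕ => u p.1 * v p.2) ∘ fun p : ℕ × ℕ => (p.2 + p.1, p.2) := by
    ext ⟨n, m⟩
    simp only [Function.comp_apply, hu, hv, besselTerm_natCast]
    rw [mul_pow, mul_pow, ← Real.exp_nat_mul, ← Real.exp_nat_mul]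
    have e : Real.exp (n * τ) = Real.exp ((m + n : ℕ) * τ) * Real.exp (m * -τ) := by
      rw [← Real.exp_add]; push_cast; ring_nf
    rw [e]
    field_simp
    ring
  rw [heq]
  refine ⟨suv.comp_injective hinj, ?_⟩
  rw [← htsum]
  exact tsum_comp_le_tsum_of_inj suv (fun p => mul_nonneg (hu0 _) (hv0 _)) hinj

theorem summable_besselTerm_nat {w : ℝ} (hw : 0 ≤ w) (n : ℕ) : Summable (besselTerm n w) := by
  have h := (summable_exp_mul_besselTerm_prod hw 0).1.comp_injective (Prod.mk_right_injective n)
  simpa [Function.comp_def] using h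

theorem exists_nat_add_eq {ν : ℝ} (hν : 0 ≤ ν) : ∃ (n : ℕ) (β : ℝ), 0 ≤ β ∧ β ≤ 1 ∧ ν = n + β :=
  ⟨⌊ν⌋₊, ν - ⌊ν⌋₊, sub_nonneg.2 (Nat.floor_le hν), by
    linarith [Nat.lt_floor_add_one ν], by ring⟩

theorem summable_besselTerm {ν w : ℝ} (hν : 0 ≤ ν) (hw : 0 ≤ w) : Summable (besselTerm ν w) := by
  obtain ⟨n, β, h0, h1, rfl⟩ := exists_nat_add_eq hν
  exact Summable.of_nonneg_of_le (besselTerm_nonneg hν hw) (besselTerm_add_le h0 h1 hw)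
    (((summable_besselTerm_nat hw n).mul_left 2).add (summable_besselTerm_nat hw (n + 1)))

theorem besselI_nonneg {ν z : ℝ} (hν : 0 ≤ ν) (hz : 0 ≤ z) : 0 ≤ besselI ν z :=
  tsum_nonneg (besselTerm_nonneg hν (by positivity))

theorem besselI_add_le {n : ℕ} {β z : ℝ} (h0 : 0 ≤ β) (h1 : β ≤ 1) (hz : 0 ≤ z) :
    besselI (n + β) z ≤ 2 * besselI n z + besselI (n + 1 : ℕ) z := by
  have hw : 0 ≤ z / 2 := by positivity
  rw [besselI_eq_tsum, besselI_eq_tsum, besselI_eq_tsum, ← tsum_mul_left,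
    ← ((summable_besselTerm_nat hw n).mul_left 2).tsum_add (summable_besselTerm_nat hw (n + 1))]
  exact (summable_besselTerm (by positivity) hw).tsum_le_tsum (besselTerm_add_le h0 h1 hw)
    (((summable_besselTerm_nat hw n).mul_left 2).add (summable_besselTerm_nat hw (n + 1)))

theorem summable_exp_mul_besselI_nat {z : ℝ} (hz : 0 ≤ z) (τ : ℝ) :
    Summable (fun n : ℕ => Real.exp (n * τ) * besselI n z) ∧
    ∑' n : ℕ, Real.exp (n * τ) * besselI n z ≤ Real.exp (z * Real.cosh τ) := by
  have hw : 0 ≤ z / 2 := by positivity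
  obtain ⟨h1, h2⟩ := summable_exp_mul_besselTerm_prod hw τ
  have h3 : ∀ n : ℕ, ∑' m, Real.exp (n * τ) * besselTerm n (z / 2) m =
      Real.exp (n * τ) * besselI n z := fun n => by rw [tsum_mul_left, besselI_eq_tsum]
  have h4 := h1.prod
  simp only [h3] at h4
  refine ⟨h4, ?_⟩
  rw [h1.tsum_prod] at h2
  simp only [h3] at h2
  rwa [mul_div_cancel₀ _ (two_ne_zero)] at h2

theorem tsum_shift_le {z : ℝ} (hz : 0 ≤ z) (τ : ℝ) :
    Summable (fun n : ℕ => Real.exp ((n + 1 : ℕ) * τ) * besselI (n + 1 : ℕ) z) ∧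
    ∑' n : ℕ, Real.exp ((n + 1 : ℕ) * τ) * besselI (n + 1 : ℕ) z ≤ Real.exp (z * Real.cosh τ) := by
  obtain ⟨h1, h2⟩ := summable_exp_mul_besselI_nat hz τ
  refine ⟨(summable_nat_add_iff 1).2 h1, le_trans ?_ h2⟩
  rw [h1.tsum_eq_zero_add]
  have := besselI_nonneg (Nat.cast_nonneg 0 : (0 : ℝ) ≤ (0 : ℕ)) hz
  exact le_add_of_nonneg_left (mul_nonneg (Real.exp_pos _).le this)

/-- The comparison with orders n and n + 1 shifts the exponential weight by e^{βτ} and e^{(β-1)τ}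
respectively; each remaining sum is at most e^{z cosh τ}. -/
theorem summable_exp_mul_besselI_add {β z : ℝ} (h0 : 0 ≤ β) (h1 : β ≤ 1) (hz : 0 ≤ z) (τ : ℝ) :
    Summable (fun n : ℕ => Real.exp ((n + β) * τ) * besselI (n + β) z) ∧
    ∑' n : ℕ, Real.exp ((n + β) * τ) * besselI (n + β) z ≤
      (2 * Real.exp (β * τ) + Real.exp ((β - 1) * τ)) * Real.exp (z * Real.cosh τ) := by
  obtain ⟨s1, t1⟩ := summable_exp_mul_besselI_nat hz τ
  obtain ⟨s2, t2⟩ := tsum_shift_le hz τ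
  have hle : ∀ n : ℕ, Real.exp ((n + β) * τ) * besselI (n + β) z ≤
      2 * Real.exp (β * τ) * (Real.exp (n * τ) * besselI n z) +
      Real.exp ((β - 1) * τ) * (Real.exp ((n + 1 : ℕ) * τ) * besselI (n + 1 : ℕ) z) := fun n => by
    have e1 : Real.exp ((n + β) * τ) = Real.exp (β * τ) * Real.exp (n * τ) := by
      rw [← Real.exp_add]; ring_nf
    have e2 : Real.exp ((n + β) * τ) = Real.exp ((β - 1) * τ) * Real.exp ((n + 1 : ℕ) * τ) := by
      rw [← Real.exp_add]; push_cast; ring_nf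
    calc _ ≤ Real.exp ((n + β) * τ) * (2 * besselI n z + besselI (n + 1 : ℕ) z) := by
          gcongr; exact besselI_add_le h0 h1 hz
      _ = 2 * (Real.exp ((n + β) * τ) * besselI n z) +
          Real.exp ((n + β) * τ) * besselI (n + 1 : ℕ) z := by ring
      _ = _ := by
        conv_lhs => arg 1; rw [e1]
        rw [e2]
        ring
  have hs := (s1.mul_left (2 * Real.exp (β * τ))).add (s2.mul_left (Real.exp ((β - 1) * τ)))
  have hsum : Summable (fun n : ℕ => Real.exp ((n + β) * τ) * besselI (n + β) z) :=
    Summable.of_nonneg_of_le (fun n => mul_nonneg (Real.exp_pos _).le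
      (besselI_nonneg (by positivity) hz)) hle hs
  refine ⟨hsum, (hsum.tsum_le_tsum hle hs).trans ?_⟩
  rw [(s1.mul_left _).tsum_add (s2.mul_left _), tsum_mul_left, tsum_mul_left, add_mul]
  gcongr

/-- The sum splits by the sign of k + α into orders n + (1 - γ) and n + γ, n ≥ 0, with γ = ⌈α⌉ - α.
Each half costs at most 3e^{γτ}. -/
theorem summable_exp_mul_besselI_int (α : ℝ) {z τ : ℝ} (hz : 0 ≤ z) (hτ : 0 ≤ τ) :
    Summable (fun k : ℤ => Real.exp (-((k + α) * τ)) * besselI |(k : ℝ) + α| z) ∧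
    ∑' k : ℤ, Real.exp (-((k + α) * τ)) * besselI |(k : ℝ) + α| z ≤
      6 * Real.exp ((⌈α⌉ - α) * τ) * Real.exp (z * Real.cosh τ) := by
  set γ : ℝ := ⌈α⌉ - α with hγ
  have h0 : 0 ≤ γ := sub_nonneg.2 (Int.le_ceil α)
  have h1 : γ ≤ 1 := by rw [hγ]; linarith [Int.ceil_lt_add_one α]
  set f : ℤ → ℝ := fun k => Real.exp (-((k + α) * τ)) * besselI |(k : ℝ) + α| z with hf
  -- The shift makes index 0 the first k with k + α > 0; for integer α the term of order 0 falls in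
  -- the other half.
  set e : ℤ ≃ ℤ := Equiv.addRight (1 - ⌈α⌉) with he
  have hpos : ∀ n : ℕ, f (e n) =
      Real.exp ((n + (1 - γ)) * -τ) * besselI (n + (1 - γ)) z := fun n => by
    have e1 : ((e n : ℤ) : ℝ) + α = n + (1 - γ) := by
      simp only [he, Equiv.coe_addRight, hγ]
      push_cast
      ring
    simp only [hf]
    rw [e1, abs_of_nonneg (by have := sub_nonneg.2 h1; positivity)]
    ring_nf
  have hneg : ∀ n : ℕ, f (e (-(n + 1))) =
      Real.exp ((n + γ) * τ) * besselI (n + γ) z := fun n => by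
    have e1 : ((e (-(n + 1)) : ℤ) : ℝ) + α = -(n + γ) := by
      simp only [he, Equiv.coe_addRight, hγ]
      push_cast
      ring
    simp only [hf]
    rw [e1, abs_neg, abs_of_nonneg (by positivity)]
    ring_nf
  obtain ⟨s1, t1⟩ := summable_exp_mul_besselI_add (sub_nonneg.2 h1) (by linarith) hz (-τ)
  obtain ⟨s2, t2⟩ := summable_exp_mul_besselI_add h0 h1 hz τ
  have hs := HasSum.of_nat_of_neg_add_one (f := f ∘ e)
    (by simpa only [Function.comp_apply, hpos] using s1.hasSum)
    (by simpa only [Function.comp_apply, hneg] using s2.hasSum)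
  refine ⟨(e.summable_iff).1 hs.summable, ?_⟩
  rw [← e.tsum_eq f]
  have hts := hs.tsum_eq
  simp only [Function.comp_apply] at hts
  rw [hts]
  rw [Real.cosh_neg] at t1
  have b1 : Real.exp ((1 - γ) * -τ) ≤ Real.exp (γ * τ) := by
    rw [Real.exp_le_exp]; nlinarith
  have b2 : Real.exp ((1 - γ - 1) * -τ) = Real.exp (γ * τ) := by ring_nf
  have b3 : Real.exp ((γ - 1) * τ) ≤ Real.exp (γ * τ) := by
    rw [Real.exp_le_exp]; nlinarith
  have hE := Real.exp_pos (z * Real.cosh τ)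
  rw [b2] at t1
  have c1 : (2 * Real.exp ((1 - γ) * -τ) + Real.exp (γ * τ)) * Real.exp (z * Real.cosh τ) ≤
      (3 * Real.exp (γ * τ)) * Real.exp (z * Real.cosh τ) := by gcongr; linarith
  have c2 : (2 * Real.exp (γ * τ) + Real.exp ((γ - 1) * τ)) * Real.exp (z * Real.cosh τ) ≤
      (3 * Real.exp (γ * τ)) * Real.exp (z * Real.cosh τ) := by gcongr; linarith
  linarith

/-! ### The heat kernel: convergence, bound, polar coordinates -/

theorem norm_heatKernelTerm {α B₀ t r₁ r₂ : ℝ} (hB : 0 < B₀) (ht : 0 < t) (h1 : 0 ≤ r₁)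
    (h2 : 0 ≤ r₂) (θ₁ θ₂ : ℝ) (k : ℤ) : ‖heatKernelTerm α B₀ t r₁ θ₁ r₂ θ₂ k‖ =
      Real.exp (α * (t * B₀)) * (Real.exp (-((k + α) * (t * B₀))) *
        besselI |(k : ℝ) + α| (B₀ * r₁ * r₂ / (2 * Real.sinh (t * B₀)))) := by
  have hs : 0 < Real.sinh (t * B₀) := Real.sinh_pos_iff.2 (by positivity)
  rw [heatKernelTerm, norm_mul, Complex.norm_exp, Complex.norm_real,
    Real.norm_of_nonneg (besselI_nonneg (abs_nonneg _) (by positivity)), ← mul_assoc,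
    ← Real.exp_add]
  congr 2
  simp
  ring

theorem summable_norm_heatKernelTerm {α B₀ t r₁ r₂ : ℝ} (hB : 0 < B₀) (ht : 0 < t) (h1 : 0 ≤ r₁)
    (h2 : 0 ≤ r₂) (θ₁ θ₂ : ℝ) : Summable (fun k => ‖heatKernelTerm α B₀ t r₁ θ₁ r₂ θ₂ k‖) ∧
    ∑' k, ‖heatKernelTerm α B₀ t r₁ θ₁ r₂ θ₂ k‖ ≤
      6 * Real.exp (⌈α⌉ * (t * B₀)) *
        Real.exp (B₀ * r₁ * r₂ / (2 * Real.sinh (t * B₀)) * Real.cosh (t * B₀)) := by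
  have hs : 0 < Real.sinh (t * B₀) := Real.sinh_pos_iff.2 (by positivity)
  obtain ⟨h3, h4⟩ := summable_exp_mul_besselI_int α (τ := t * B₀)
    (show 0 ≤ B₀ * r₁ * r₂ / (2 * Real.sinh (t * B₀)) by positivity) (by positivity)
  simp only [norm_heatKernelTerm hB ht h1 h2]
  refine ⟨h3.mul_left _, ?_⟩
  rw [tsum_mul_left]
  calc _ ≤ Real.exp (α * (t * B₀)) * (6 * Real.exp ((⌈α⌉ - α) * (t * B₀)) *
        Real.exp (B₀ * r₁ * r₂ / (2 * Real.sinh (t * B₀)) * Real.cosh (t * B₀))) := by gcongr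
    _ = 6 * (Real.exp (α * (t * B₀)) * Real.exp ((⌈α⌉ - α) * (t * B₀))) *
        Real.exp (B₀ * r₁ * r₂ / (2 * Real.sinh (t * B₀)) * Real.cosh (t * B₀)) := by ring
    _ = _ := by rw [← Real.exp_add]; ring_nf

/-- The factor e^{z cosh τ} from the series completes the square in the Gaussian prefactor, leaving
-(r₁ - r₂)² over tanh. The numerical constant is 6/(4π) ≤ 1. -/
theorem norm_heatKernelPolar_le {α B₀ t r₁ r₂ : ℝ} (hB : 0 < B₀) (ht : 0 < t) (h1 : 0 ≤ r₁)
    (h2 : 0 ≤ r₂) (θ₁ θ₂ : ℝ) : ‖heatKernelPolar α B₀ t r₁ θ₁ r₂ θ₂‖ ≤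
      (B₀ * Real.exp ((⌈α⌉ - α) * (t * B₀)) / Real.sinh (t * B₀)) *
        Real.exp (-(B₀ * (r₁ - r₂) ^ 2 / (4 * Real.tanh (t * B₀)))) := by
  have hs : 0 < Real.sinh (t * B₀) := Real.sinh_pos_iff.2 (by positivity)
  have hc : 0 < Real.cosh (t * B₀) := Real.cosh_pos _
  obtain ⟨h3, h4⟩ := summable_norm_heatKernelTerm (α := α) hB ht h1 h2 θ₁ θ₂
  have hpi := Real.pi_pos
  rw [heatKernelPolar, norm_mul, norm_mul, Complex.norm_real, Complex.norm_real,
    Real.norm_of_nonneg (by positivity), Real.norm_of_nonneg (by positivity)]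
  have hpi3 := Real.pi_gt_three
  calc _ ≤ B₀ * Real.exp (-(α * t * B₀)) / (4 * Real.pi * Real.sinh (t * B₀)) *
        Real.exp (-(B₀ * (r₁ ^ 2 + r₂ ^ 2) * Real.cosh (t * B₀) / (4 * Real.sinh (t * B₀)))) *
        (6 * Real.exp (⌈α⌉ * (t * B₀)) *
        Real.exp (B₀ * r₁ * r₂ / (2 * Real.sinh (t * B₀)) * Real.cosh (t * B₀))) := by
        gcongr
        exact (norm_tsum_le_tsum_norm h3).trans h4
    _ = (6 / (4 * Real.pi)) * ((B₀ * (Real.exp (-(α * t * B₀)) * Real.exp (⌈α⌉ * (t * B₀))) /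
          Real.sinh (t * B₀)) *
        (Real.exp (-(B₀ * (r₁ ^ 2 + r₂ ^ 2) * Real.cosh (t * B₀) / (4 * Real.sinh (t * B₀)))) *
        Real.exp (B₀ * r₁ * r₂ / (2 * Real.sinh (t * B₀)) * Real.cosh (t * B₀)))) := by
        field_simp
    _ ≤ 1 * ((B₀ * (Real.exp (-(α * t * B₀)) * Real.exp (⌈α⌉ * (t * B₀))) /
          Real.sinh (t * B₀)) *
        (Real.exp (-(B₀ * (r₁ ^ 2 + r₂ ^ 2) * Real.cosh (t * B₀) / (4 * Real.sinh (t * B₀)))) *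
        Real.exp (B₀ * r₁ * r₂ / (2 * Real.sinh (t * B₀)) * Real.cosh (t * B₀)))) := by
        gcongr
        rw [div_le_one (by positivity)]
        linarith
    _ = _ := by
        rw [one_mul, ← Real.exp_add, ← Real.exp_add, Real.tanh_eq_sinh_div_cosh]
        congr 2
        · congr 2
          ring_nf
        · field_simp
          ring

theorem norm_polarPoint {r : ℝ} (hr : 0 < r) (θ : ℝ) : ‖polarPoint r θ‖ = r := by
  rw [← sq_eq_sq₀ (norm_nonneg _) hr.le, plane_norm_sq]
  simp only [polarPoint, Matrix.cons_val_zero, Matrix.cons_val_one]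
  linear_combination r ^ 2 * Real.sin_sq_add_cos_sq θ

theorem exists_planeArg_polarPoint {r : ℝ} (hr : 0 < r) (θ : ℝ) :
    ∃ n : ℤ, planeArg (polarPoint r θ) = θ + n * (2 * Real.pi) := by
  have h1 : planeComplex (polarPoint r θ) = r * Complex.exp (θ * Complex.I) := by
    rw [planeComplex_apply, Complex.exp_mul_I]
    simp only [polarPoint, Matrix.cons_val_zero, Matrix.cons_val_one]
    push_cast
    ring
  have h2 := exp_planeArg_mul_norm (polarPoint r θ)
  rw [norm_polarPoint hr, h1, mul_comm] at h2
  have h3 := mul_left_cancel₀ (by exact_mod_cast hr.ne') h2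
  obtain ⟨n, hn⟩ := Complex.exp_eq_exp_iff_exists_int.1 h3
  refine ⟨n, ?_⟩
  have h4 : (planeArg (polarPoint r θ) : ℂ) * Complex.I =
      ((θ + n * (2 * Real.pi) : ℝ) : ℂ) * Complex.I := by
    push_cast at hn ⊢
    linear_combination hn
  exact_mod_cast mul_right_cancel₀ Complex.I_ne_zero h4

theorem heatKernel_polarPoint {r₁ r₂ : ℝ} (α B₀ t θ₁ θ₂ : ℝ) (h1 : 0 < r₁) (h2 : 0 < r₂) :
    heatKernel α B₀ t (polarPoint r₁ θ₁) (polarPoint r₂ θ₂) =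
      heatKernelPolar α B₀ t r₁ θ₁ r₂ θ₂ := by
  obtain ⟨m, hm⟩ := exists_planeArg_polarPoint h1 θ₁
  obtain ⟨n, hn⟩ := exists_planeArg_polarPoint h2 θ₂
  rw [heatKernel, norm_polarPoint h1, norm_polarPoint h2, heatKernelPolar, heatKernelPolar]
  congr 2
  ext k
  rw [heatKernelTerm, heatKernelTerm, hm, hn]
  congr 1
  rw [Complex.exp_eq_exp_iff_exists_int]
  -- Since k is an integer, changing the angles by multiples of 2π changes the exponent by a
  -- multiple of 2πi.
  refine ⟨k * (m - n), ?_⟩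
  push_cast
  ring

/-! ### The heat kernel acting on Gaussian modes -/

theorem measurable_tsum_of_summable {X ι E : Type*} [MeasurableSpace X] [Countable ι]
    [NormedAddCommGroup E] [MeasurableSpace E] [BorelSpace E] [SecondCountableTopology E]
    {f : ι → X → E} (hf : ∀ i, Measurable (f i)) (hs : ∀ x, Summable fun i => f i x) :
    Measurable fun x => ∑' i, f i x := by
  refine measurable_of_tendsto_metrizable' (atTop : Filter (Finset ι))
    (f := fun s x => ∑ i ∈ s, f i x) (fun s => Finset.measurable_sum s fun i _ => hf i) ?_
  rw [tendsto_pi_nhds]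
  exact fun x => (hs x).hasSum

theorem measurable_besselI_comp {X : Type*} [MeasurableSpace X] {ν : ℝ} (hν : 0 ≤ ν) {g : X → ℝ}
    (hg : Measurable g) (h0 : ∀ x, 0 ≤ g x) : Measurable fun x => besselI ν (g x) := by
  simp only [besselI_eq_tsum]
  refine measurable_tsum_of_summable (fun m => ?_)
    (fun x => summable_besselTerm hν (div_nonneg (h0 x) two_pos.le))
  exact ((hg.div_const 2).pow_const _).div_const _

theorem integral_rpow_mul_exp_neg_sq {a s : ℝ} (ha : -2 < a) (hs : 0 < s) :
    ∫ x : Plane, ‖x‖ ^ a * Real.exp (-s * ‖x‖ ^ 2) =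
      Real.pi * s ^ (-((a + 2) / 2)) * Real.Gamma ((a + 2) / 2) := by
  rw [integral_fun_norm_addHaar volume (f := fun r => r ^ a * Real.exp (-s * r ^ 2)),
    finrank_euclideanSpace_fin]
  have h1 : ∫ r in Set.Ioi (0 : ℝ), r ^ (2 - 1) • (r ^ a * Real.exp (-s * r ^ 2)) =
      ∫ r in Set.Ioi (0 : ℝ), r ^ (a + 1) * Real.exp (-s * r ^ (2 : ℝ)) := by
    refine setIntegral_congr_fun measurableSet_Ioi fun r hr => ?_
    have hr : 0 < r := hr
    simp only [Nat.add_one_sub_one, pow_one, smul_eq_mul]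
    rw [Real.rpow_add_one hr.ne', Real.rpow_two]
    ring
  rw [h1, integral_rpow_mul_exp_neg_mul_rpow two_pos (by linarith) hs, Measure.real,
    EuclideanSpace.volume_ball_fin_two]
  simp only [ENNReal.ofReal_one, one_pow, one_mul, ENNReal.toReal_ofReal Real.pi_pos.le,
    nsmul_eq_mul, smul_eq_mul]
  push_cast
  have h2 : a + 1 + 1 = a + 2 := by ring
  rw [h2, neg_div]
  ring

/-- Weber's integral. -/
theorem integral_besselI_mul_gaussian {ν c p : ℝ} (hν : 0 ≤ ν) (hc : 0 ≤ c) (hp : 0 < p) :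
    ∫ x : Plane, besselI ν (2 * (c * ‖x‖)) * (‖x‖ ^ ν * Real.exp (-p * ‖x‖ ^ 2)) =
      Real.pi * c ^ ν * p ^ (-(ν + 1)) * Real.exp (c ^ 2 / p) := by
  set F : ℕ → Plane → ℝ := fun m x =>
    besselTerm ν (c * ‖x‖) m * (‖x‖ ^ ν * Real.exp (-p * ‖x‖ ^ 2)) with hF
  have hF0 : ∀ m x, 0 ≤ F m x := fun m x =>
    mul_nonneg (besselTerm_nonneg hν (by positivity) m) (by positivity)
  have hF1 : ∀ m, F m = fun x => besselTerm ν c m *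
      (‖x‖ ^ (2 * (m : ℝ) + 2 * ν) * Real.exp (-p * ‖x‖ ^ 2)) := fun m => by
    funext x
    have h1 : 2 * (m : ℝ) + 2 * ν = (2 * m + ν) + ν := by ring
    rw [hF, h1, Real.rpow_add_of_nonneg (norm_nonneg x) (by positivity) hν]
    simp only [besselTerm]
    rw [Real.mul_rpow hc (norm_nonneg x)]
    ring
  have hF2 : ∀ m, Integrable (F m) volume := fun m => by
    rw [hF1]
    exact (integrable_rpow_mul_exp_neg_sq (by linarith [show 0 ≤ 2 * (m : ℝ) + 2 * ν by positivity])
      hp).const_mul _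
  -- The radial integral produces Γ(m + ν + 1), which cancels the Gamma factor of the Bessel series;
  -- what remains is the exponential series of c²/p.
  have hF3 : ∀ m, ∫ x, F m x =
      Real.pi * c ^ ν * p ^ (-(ν + 1)) * ((c ^ 2 / p) ^ m / m.factorial) := fun m => by
    have hG := Real.Gamma_pos_of_pos (show 0 < (m : ℝ) + ν + 1 by positivity)
    have h1 : (2 * (m : ℝ) + 2 * ν + 2) / 2 = m + ν + 1 := by ring
    have h2 : -((m : ℝ) + ν + 1) = -(ν + 1) - m := by ring
    rw [hF1, integral_const_mul,
      integral_rpow_mul_exp_neg_sq (by linarith [show 0 ≤ 2 * (m : ℝ) + 2 * ν by positivity]) hp,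
      h1, h2, besselTerm, Real.rpow_sub hp, Real.rpow_natCast,
      Real.rpow_add_of_nonneg hc (by positivity) hν, div_pow, ← pow_mul]
    have h3 : c ^ (2 * (m : ℝ)) = c ^ (2 * m) := by
      rw [← Real.rpow_natCast]
      push_cast
      rfl
    rw [h3]
    field_simp
  have h1 := hasSum_integral_of_summable_integral_norm hF2 (by
    simp only [Real.norm_of_nonneg (hF0 _ _), hF3]
    exact (Real.summable_pow_div_factorial _).mul_left _)
  have h2 : HasSum (fun m => ∫ x, F m x)
      (Real.pi * c ^ ν * p ^ (-(ν + 1)) * Real.exp (c ^ 2 / p)) := by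
    simp only [hF3]
    rw [Real.exp_eq_exp_ℝ]
    exact (NormedSpace.expSeries_div_hasSum_exp (c ^ 2 / p)).mul_left _
  rw [← h1.unique h2]
  refine integral_congr_ae (ae_of_all _ fun x => ?_)
  simp only [hF, besselI_eq_tsum, mul_div_cancel_left₀ (c * ‖x‖) (two_ne_zero' ℝ), tsum_mul_right]

/-- The rotation of the plane by a unit complex number. -/
def planeRotation (a : Circle) : Plane ≃ₗᵢ[ℝ] Plane :=
  (Complex.orthonormalBasisOneI.repr.symm.trans (rotation a)).trans
    Complex.orthonormalBasisOneI.repr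

theorem planeComplex_planeRotation (a : Circle) (x : Plane) :
    planeComplex (planeRotation a x) = a * planeComplex x := by
  have h : ∀ y : Plane, planeComplex y = Complex.orthonormalBasisOneI.repr.symm y := fun y => by
    rw [planeComplex_apply, Complex.orthonormalBasisOneI_repr_symm_apply, mul_comm]
  rw [h, h, planeRotation]
  simp [rotation_apply]

theorem exp_int_planeArg (k : ℤ) {x : Plane} (hx : x ≠ 0) :
    Complex.exp (Complex.I * k * planeArg x) = (planeComplex x / ‖x‖) ^ k := by
  have hx0 : (‖x‖ : ℂ) ≠ 0 := by simpa using hx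
  rw [← exp_planeArg_mul_norm, mul_div_cancel_right₀ _ hx0, ← Complex.exp_int_mul]
  congr 1
  push_cast
  ring

/-- Rotation by π/k preserves the measure and the radial factor but changes the sign of the
integrand. No integrability is required. -/
theorem integral_exp_planeArg_mul_radial {k : ℤ} (hk : k ≠ 0) (q : ℝ → ℂ) :
    ∫ x : Plane, Complex.exp (Complex.I * k * planeArg x) * q ‖x‖ = 0 := by
  set F : Plane → ℂ := fun x => Complex.exp (Complex.I * k * planeArg x) * q ‖x‖ with hF
  have hk0 : (k : ℝ) ≠ 0 := Int.cast_ne_zero.2 hk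
  set a : Circle := Circle.exp (Real.pi / k) with ha
  have ha1 : (a : ℂ) ^ k = -1 := by
    rw [ha, Circle.coe_exp, ← Complex.exp_int_mul]
    have : (k : ℂ) * ((Real.pi / k : ℝ) * Complex.I) = Real.pi * Complex.I := by
      have : (k : ℂ) ≠ 0 := Int.cast_ne_zero.2 hk
      push_cast
      field_simp
    rw [this, Complex.exp_pi_mul_I]
  have h1 : ∫ x, F (planeRotation a x) = ∫ x, F x :=
    (planeRotation a).measurePreserving.integral_comp
      (planeRotation a).toHomeomorph.measurableEmbedding F
  have h2 : ∫ x, F (planeRotation a x) = ∫ x, -F x := by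
    refine integral_congr_ae ?_
    filter_upwards [ae_ne_zero_plane] with x hx
    have hx' : planeRotation a x ≠ 0 := by simpa using hx
    simp only [hF]
    rw [exp_int_planeArg k hx', exp_int_planeArg k hx, planeComplex_planeRotation,
      LinearIsometryEquiv.norm_map, mul_div_assoc, mul_zpow, ha1]
    ring
  rw [integral_neg, h1] at h2
  exact self_eq_neg.1 h2

theorem measurable_heatKernelTerm {α B₀ t : ℝ} (hB : 0 < B₀) (ht : 0 < t) (x : Plane) (k : ℤ) :
    Measurable fun y : Plane => heatKernelTerm α B₀ t ‖x‖ (planeArg x) ‖y‖ (planeArg y) k := by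
  have hs : 0 < Real.sinh (t * B₀) := Real.sinh_pos_iff.2 (by positivity)
  have h1 := measurable_besselI_comp (abs_nonneg ((k : ℝ) + α))
    (g := fun y : Plane => B₀ * ‖x‖ * ‖y‖ / (2 * Real.sinh (t * B₀)))
    ((measurable_norm.const_mul _).div_const _) (fun y => by positivity)
  have h2 : Measurable fun y : Plane => (planeArg y : ℂ) :=
    Complex.measurable_ofReal.comp measurable_planeArg
  refine Measurable.mul ?_ (Complex.measurable_ofReal.comp h1)
  exact Complex.measurable_exp.comp (((h2.const_sub _).add_const _).const_mul _)

theorem measurable_heatKernel {α B₀ t : ℝ} (hB : 0 < B₀) (ht : 0 < t) (x : Plane) :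
    Measurable (heatKernel α B₀ t x) := by
  have h1 : Measurable fun y : Plane =>
      ∑' k, heatKernelTerm α B₀ t ‖x‖ (planeArg x) ‖y‖ (planeArg y) k :=
    measurable_tsum_of_summable (measurable_heatKernelTerm hB ht x) fun y =>
      (summable_norm_heatKernelTerm hB ht (norm_nonneg x) (norm_nonneg y) _ _).1.of_norm
  refine Measurable.mul (Measurable.const_mul ?_ _) h1
  refine Complex.measurable_ofReal.comp (Real.measurable_exp.comp (Measurable.neg ?_))
  exact ((((measurable_norm.pow_const 2).const_add _).const_mul _).mul_const _).div_const _

theorem memLp_heatKernel {α B₀ t : ℝ} (hB : 0 < B₀) (ht : 0 < t) (x : Plane) :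
    MemLp (heatKernel α B₀ t x) 2 volume := by
  have hth : 0 < Real.tanh (t * B₀) := by
    rw [Real.tanh_eq_sinh_div_cosh]
    exact div_pos (Real.sinh_pos_iff.2 (by positivity)) (Real.cosh_pos _)
  set A := B₀ * Real.exp ((⌈α⌉ - α) * (t * B₀)) / Real.sinh (t * B₀) with hA
  set γ := B₀ / (4 * Real.tanh (t * B₀)) with hγ
  have hγ0 : 0 < γ := by positivity
  have hA0 : 0 ≤ A := by
    have hs : 0 < Real.sinh (t * B₀) := Real.sinh_pos_iff.2 (by positivity)
    positivity
  refine ((memLp_rpow_mul_exp_neg_sq (a := 0) (s := γ / 2) (by norm_num)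
    (by positivity)).const_mul (A * Real.exp (γ * ‖x‖ ^ 2))).of_le
    (measurable_heatKernel hB ht x).aestronglyMeasurable (ae_of_all _ fun y => ?_)
  refine (norm_heatKernelPolar_le hB ht (norm_nonneg x) (norm_nonneg y) _ _).trans ?_
  rw [Real.norm_of_nonneg (by positivity), Real.rpow_zero, one_mul, mul_assoc, ← Real.exp_add]
  refine mul_le_mul_of_nonneg_left (Real.exp_le_exp.2 ?_) hA0
  have h1 : B₀ * (‖x‖ - ‖y‖) ^ 2 / (4 * Real.tanh (t * B₀)) = γ * (‖x‖ - ‖y‖) ^ 2 := by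
    rw [hγ]
    ring
  rw [h1]
  -- This square is the inequality -(|x| - |y|)² ≤ |x|² - |y|²/2, which leaves a Gaussian in y for
  -- fixed x.
  have h2 : 0 ≤ γ * ((2 * ‖x‖ - ‖y‖) ^ 2 / 2) := by positivity
  linarith

theorem integrable_heatKernel_mul {α B₀ t : ℝ} (hB : 0 < B₀) (ht : 0 < t) (x : Plane)
    (f : L2Plane) : Integrable (fun y => heatKernel α B₀ t x y * f y) volume :=
  (memLp_heatKernel hB ht x).integrable_mul (Lp.memLp f)

/-- Weber's integral with c = B₀r/(4 sinh) and p = D/sinh = s + (B₀/4) coth, compared with the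
evolved Gaussian. The exponents match because D cosh - B₀/4 = N sinh, a form of cosh² - sinh² = 1.
-/
theorem flow_identity {B₀ s t ν κ r : ℝ} (hB : 0 < B₀) (hs : 0 < s) (ht : 0 < t) (hr : 0 ≤ r) :
    B₀ / (4 * Real.sinh (t * B₀)) *
        ((B₀ * r / (4 * Real.sinh (t * B₀))) ^ ν *
          (flowDen B₀ s (t * B₀) / Real.sinh (t * B₀)) ^ (-(ν + 1)) *
          Real.exp ((B₀ * r / (4 * Real.sinh (t * B₀))) ^ 2 /
            (flowDen B₀ s (t * B₀) / Real.sinh (t * B₀)))) *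
        Real.exp (-(t * B₀ * κ)) *
        Real.exp (-(B₀ * r ^ 2 * Real.cosh (t * B₀) / (4 * Real.sinh (t * B₀)))) =
      flowAmp ν κ B₀ s t * (r ^ ν * Real.exp (-flowExp B₀ s t * r ^ 2)) := by
  have hS : 0 < Real.sinh (t * B₀) := Real.sinh_pos_iff.2 (by positivity)
  have hD : 0 < flowDen B₀ s (t * B₀) := flowDen_pos hB hs (by positivity)
  have h1 : (B₀ * r / (4 * Real.sinh (t * B₀))) ^ 2 / (flowDen B₀ s (t * B₀) / Real.sinh (t * B₀)) +
      -(B₀ * r ^ 2 * Real.cosh (t * B₀) / (4 * Real.sinh (t * B₀))) =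
      -flowExp B₀ s t * r ^ 2 := by
    have h2 : flowDen B₀ s (t * B₀) * Real.cosh (t * B₀) - B₀ / 4 =
        Real.sinh (t * B₀) * flowNum B₀ s (t * B₀) := by
      rw [flowDen, flowNum]
      linear_combination (B₀ / 4) * Real.cosh_sq (t * B₀)
    rw [flowExp]
    generalize flowDen B₀ s (t * B₀) = D at hD h2 ⊢
    generalize flowNum B₀ s (t * B₀) = N at h2 ⊢
    generalize Real.sinh (t * B₀) = S at hS h2 ⊢
    have h5 : N = (D * Real.cosh (t * B₀) - B₀ / 4) / S := by
      rw [h2]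
      field_simp
    rw [h5]
    field_simp
    ring
  have h3 : B₀ / 4 / flowDen B₀ s (t * B₀) =
      B₀ / (4 * Real.sinh (t * B₀)) * (flowDen B₀ s (t * B₀) / Real.sinh (t * B₀))⁻¹ := by
    field_simp
  have h4 : B₀ * r / (4 * Real.sinh (t * B₀)) = B₀ / (4 * Real.sinh (t * B₀)) * r := by ring
  have hb : 0 < B₀ / (4 * Real.sinh (t * B₀)) := by positivity
  have hp : 0 < flowDen B₀ s (t * B₀) / Real.sinh (t * B₀) := by positivity
  rw [← h1, Real.exp_add, flowAmp, h3, Real.mul_rpow hb.le (inv_nonneg.2 hp.le),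
    Real.inv_rpow hp.le, ← Real.rpow_neg hp.le, Real.rpow_add_one hb.ne', h4,
    Real.mul_rpow hb.le hr]
  ring

/-- The factor in front of the series of the heat kernel. -/
def heatPrefactor (α B₀ t r₁ r₂ : ℝ) : ℝ :=
  B₀ * Real.exp (-(α * t * B₀)) / (4 * Real.pi * Real.sinh (t * B₀)) *
    Real.exp (-(B₀ * (r₁ ^ 2 + r₂ ^ 2) * Real.cosh (t * B₀) / (4 * Real.sinh (t * B₀))))

theorem heatKernel_eq (α B₀ t : ℝ) (x y : Plane) :
    heatKernel α B₀ t x y = heatPrefactor α B₀ t ‖x‖ ‖y‖ *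
      ∑' k, heatKernelTerm α B₀ t ‖x‖ (planeArg x) ‖y‖ (planeArg y) k := by
  rw [heatKernel, heatKernelPolar, heatPrefactor, Complex.ofReal_mul]

theorem measurable_heatPrefactor (α B₀ t r : ℝ) :
    Measurable fun y : Plane => heatPrefactor α B₀ t r ‖y‖ := by
  refine Measurable.const_mul (Real.measurable_exp.comp (Measurable.neg ?_)) _
  exact ((((measurable_norm.pow_const 2).const_add _).const_mul _).mul_const _).div_const _

theorem heatPrefactor_nonneg {α B₀ t r₁ r₂ : ℝ} (hB : 0 < B₀) (ht : 0 < t) :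
    0 ≤ heatPrefactor α B₀ t r₁ r₂ := by
  have hs : 0 < Real.sinh (t * B₀) := Real.sinh_pos_iff.2 (by positivity)
  have := Real.pi_pos
  rw [heatPrefactor]
  positivity

/-- A bound on the absolute series that is uniform in y dominates all partial sums by a multiple of
the integrable Gaussian mode, which justifies integrating the kernel term by term. -/
theorem exists_heatPrefactor_mul_tsum_le {α B₀ t : ℝ} (hB : 0 < B₀) (ht : 0 < t) (x : Plane) :
    ∃ C, ∀ y : Plane, heatPrefactor α B₀ t ‖x‖ ‖y‖ *
      ∑' k, ‖heatKernelTerm α B₀ t ‖x‖ (planeArg x) ‖y‖ (planeArg y) k‖ ≤ C := by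
  have hs : 0 < Real.sinh (t * B₀) := Real.sinh_pos_iff.2 (by positivity)
  have hc : 0 < Real.cosh (t * B₀) := Real.cosh_pos _
  have hpi := Real.pi_pos
  refine ⟨B₀ * Real.exp (-(α * t * B₀)) / (4 * Real.pi * Real.sinh (t * B₀)) *
    (6 * Real.exp (⌈α⌉ * (t * B₀))), fun y => ?_⟩
  have h1 := (summable_norm_heatKernelTerm (α := α) hB ht (norm_nonneg x) (norm_nonneg y)
    (planeArg x) (planeArg y)).2
  refine (mul_le_mul_of_nonneg_left h1 (heatPrefactor_nonneg hB ht)).trans ?_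
  have h2 : Real.exp (-(B₀ * (‖x‖ ^ 2 + ‖y‖ ^ 2) * Real.cosh (t * B₀) /
      (4 * Real.sinh (t * B₀)))) *
      Real.exp (B₀ * ‖x‖ * ‖y‖ / (2 * Real.sinh (t * B₀)) * Real.cosh (t * B₀)) ≤ 1 := by
    rw [← Real.exp_add, Real.exp_le_one_iff]
    have : -(B₀ * (‖x‖ ^ 2 + ‖y‖ ^ 2) * Real.cosh (t * B₀) / (4 * Real.sinh (t * B₀))) +
        B₀ * ‖x‖ * ‖y‖ / (2 * Real.sinh (t * B₀)) * Real.cosh (t * B₀) =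
        -(B₀ * (‖x‖ - ‖y‖) ^ 2 * Real.cosh (t * B₀) / (4 * Real.sinh (t * B₀))) := by
      field_simp
      ring
    rw [this, neg_nonpos]
    positivity
  rw [heatPrefactor]
  calc _ = B₀ * Real.exp (-(α * t * B₀)) / (4 * Real.pi * Real.sinh (t * B₀)) *
      (6 * Real.exp (⌈α⌉ * (t * B₀))) * (Real.exp (-(B₀ * (‖x‖ ^ 2 + ‖y‖ ^ 2) *
        Real.cosh (t * B₀) / (4 * Real.sinh (t * B₀)))) *
      Real.exp (B₀ * ‖x‖ * ‖y‖ / (2 * Real.sinh (t * B₀)) * Real.cosh (t * B₀))) := by ring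
    _ ≤ _ := mul_le_of_le_one_right (by positivity) h2

/-- Isolates the dependence on the angle of y as e^{i(k-j)θ}, so that only j = k can contribute to
the integral. -/
theorem heatKernelTerm_mul_mode (α B₀ t r θ s : ℝ) (j k : ℤ) (y : Plane) :
    heatKernelTerm α B₀ t r θ ‖y‖ (planeArg y) j * mode α k (gaussMono 0 s) y =
      Complex.exp (Complex.I * ((k - j : ℤ) : ℂ) * planeArg y) *
        (Complex.exp (Complex.I * j * θ) * ((Real.exp (-(t * B₀ * j)) *
          (besselI |(j : ℝ) + α| (B₀ * r * ‖y‖ / (2 * Real.sinh (t * B₀))) *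
          (‖y‖ ^ |(k : ℝ) + α| * Real.exp (-s * ‖y‖ ^ 2))) : ℝ) : ℂ)) := by
  have h1 : Complex.exp (Complex.I * j * (θ - planeArg y + Complex.I * t * B₀)) *
      Complex.exp (Complex.I * k * planeArg y) =
      Complex.exp (Complex.I * ((k - j : ℤ) : ℂ) * planeArg y) *
        (Complex.exp (Complex.I * j * θ) * (Real.exp (-(t * B₀ * j)) : ℝ)) := by
    rw [Complex.ofReal_exp, ← Complex.exp_add, ← Complex.exp_add, ← Complex.exp_add]
    congr 1
    push_cast
    linear_combination ((j : ℂ) * t * B₀) * Complex.I_mul_I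
  rw [heatKernelTerm, mode, gaussMono, pow_zero, one_mul]
  push_cast at h1 ⊢
  linear_combination (besselI |(j : ℝ) + α| (B₀ * r * ‖y‖ / (2 * Real.sinh (t * B₀))) *
    (((‖y‖ ^ |(k : ℝ) + α| : ℝ) : ℂ) * Complex.exp (-s * ‖y‖ ^ 2)) : ℂ) * h1

theorem integrable_mode_gaussMono (α : ℝ) (k : ℤ) {s : ℝ} (hs : 0 < s) :
    Integrable (mode α k (gaussMono 0 s)) volume := by
  refine (integrable_rpow_mul_exp_neg_sq (a := |(k : ℝ) + α|)
    (by linarith [abs_nonneg ((k : ℝ) + α)]) hs).mono'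
    (measurable_mode α k (measurable_gaussMono 0 s)).aestronglyMeasurable (ae_of_all _ fun x => ?_)
  rw [norm_mode, gaussMono, pow_zero, one_mul, abs_of_pos (Real.exp_pos _)]

theorem integral_heatKernel_mul_mode {α B₀ s t : ℝ} (hB : 0 < B₀) (hs : 0 < s) (ht : 0 < t)
    (k : ℤ) (x : Plane) :
    ∫ y, heatKernel α B₀ t x y * mode α k (gaussMono 0 s) y =
      (flowAmp |(k : ℝ) + α| (k + α) B₀ s t : ℂ) *
        mode α k (gaussMono 0 (flowExp B₀ s t)) x := by
  have hS : 0 < Real.sinh (t * B₀) := Real.sinh_pos_iff.2 (by positivity)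
  have hC : 0 < Real.cosh (t * B₀) := Real.cosh_pos _
  have hD : 0 < flowDen B₀ s (t * B₀) := flowDen_pos hB hs (by positivity)
  set ν := |(k : ℝ) + α| with hν
  set T : ℤ → Plane → ℂ := fun j y =>
    heatKernelTerm α B₀ t ‖x‖ (planeArg x) ‖y‖ (planeArg y) j with hT
  set F : ℤ → Plane → ℂ := fun j y =>
    heatPrefactor α B₀ t ‖x‖ ‖y‖ * T j y * mode α k (gaussMono 0 s) y with hF
  have hTs : ∀ y, Summable fun j => ‖T j y‖ := fun y =>
    (summable_norm_heatKernelTerm hB ht (norm_nonneg x) (norm_nonneg y) _ _).1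
  have hFn : ∀ j y, ‖F j y‖ =
      heatPrefactor α B₀ t ‖x‖ ‖y‖ * ‖T j y‖ * ‖mode α k (gaussMono 0 s) y‖ := fun j y => by
    rw [hF, norm_mul, norm_mul, Complex.norm_real,
      Real.norm_of_nonneg (heatPrefactor_nonneg hB ht)]
  obtain ⟨C, hbound⟩ := exists_heatPrefactor_mul_tsum_le (α := α) hB ht x
  have hsum : ∀ (J : Finset ℤ) y, ∑ j ∈ J, ‖F j y‖ ≤ C * ‖mode α k (gaussMono 0 s) y‖ := by
    intro J y
    simp only [hFn]
    rw [← Finset.sum_mul, ← Finset.mul_sum]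
    refine mul_le_mul_of_nonneg_right (le_trans ?_ (hbound y)) (norm_nonneg _)
    exact mul_le_mul_of_nonneg_left ((hTs y).sum_le_tsum J fun _ _ => norm_nonneg _)
      (heatPrefactor_nonneg hB ht)
  have hmode := integrable_mode_gaussMono α k hs
  have hFi : ∀ j, Integrable (F j) volume := fun j => by
    refine (hmode.norm.const_mul C).mono' ?_ (ae_of_all _ fun y => ?_)
    · exact (((Complex.measurable_ofReal.comp (measurable_heatPrefactor α B₀ t ‖x‖)).mul
        (measurable_heatKernelTerm hB ht x j)).mul
        (measurable_mode α k (measurable_gaussMono 0 s))).aestronglyMeasurable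
    · simpa using hsum {j} y
  have hFs : Summable fun j => ∫ y, ‖F j y‖ := by
    refine summable_of_sum_le (c := ∫ y, C * ‖mode α k (gaussMono 0 s) y‖)
      (fun j => integral_nonneg fun y => norm_nonneg _) fun J => ?_
    rw [← integral_finsetSum J fun j _ => (hFi j).norm]
    exact integral_mono (integrable_finsetSum J fun j _ => (hFi j).norm) (hmode.norm.const_mul C)
      (hsum J)
  have h1 := hasSum_integral_of_summable_integral_norm hFi hFs
  have h2 : ∀ y, ∑' j, F j y = heatKernel α B₀ t x y * mode α k (gaussMono 0 s) y := fun y => by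
    rw [heatKernel_eq, ← tsum_mul_left, ← tsum_mul_right]
  simp only [h2] at h1
  have h3 : ∀ j, F j = fun y => Complex.exp (Complex.I * ((k - j : ℤ) : ℂ) * planeArg y) *
      (heatPrefactor α B₀ t ‖x‖ ‖y‖ * (Complex.exp (Complex.I * j * planeArg x) *
        ((Real.exp (-(t * B₀ * j)) *
          (besselI |(j : ℝ) + α| (B₀ * ‖x‖ * ‖y‖ / (2 * Real.sinh (t * B₀))) *
          (‖y‖ ^ |(k : ℝ) + α| * Real.exp (-s * ‖y‖ ^ 2))) : ℝ) : ℂ))) := fun j => by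
    funext y
    simp only [hF, hT]
    rw [mul_assoc, heatKernelTerm_mul_mode]
    ring
  have h4 : ∀ j, j ≠ k → ∫ y, F j y = 0 := fun j hj => by
    rw [h3]
    exact integral_exp_planeArg_mul_radial (sub_ne_zero.2 hj.symm) (fun r =>
      (heatPrefactor α B₀ t ‖x‖ r * (Complex.exp (Complex.I * j * planeArg x) *
        ((Real.exp (-(t * B₀ * j)) *
          (besselI |(j : ℝ) + α| (B₀ * ‖x‖ * r / (2 * Real.sinh (t * B₀))) *
          (r ^ |(k : ℝ) + α| * Real.exp (-s * r ^ 2))) : ℝ) : ℂ))))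
  rw [h1.unique (hasSum_single k h4)]
  have h5 : ∀ y, F k y = Complex.exp (Complex.I * k * planeArg x) *
      ((B₀ / (4 * Real.pi * Real.sinh (t * B₀)) * Real.exp (-(t * B₀ * (k + α))) *
        Real.exp (-(B₀ * ‖x‖ ^ 2 * Real.cosh (t * B₀) / (4 * Real.sinh (t * B₀)))) *
        (besselI ν (2 * (B₀ * ‖x‖ / (4 * Real.sinh (t * B₀)) * ‖y‖)) * (‖y‖ ^ ν *
          Real.exp (-(flowDen B₀ s (t * B₀) / Real.sinh (t * B₀)) * ‖y‖ ^ 2))) : ℝ) : ℂ) := by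
    intro y
    have e1 : B₀ * ‖x‖ * ‖y‖ / (2 * Real.sinh (t * B₀)) =
        2 * (B₀ * ‖x‖ / (4 * Real.sinh (t * B₀)) * ‖y‖) := by
      field_simp
      ring
    have e2 : Real.exp (-(α * t * B₀)) * Real.exp (-(B₀ * (‖x‖ ^ 2 + ‖y‖ ^ 2) *
        Real.cosh (t * B₀) / (4 * Real.sinh (t * B₀)))) *
        Real.exp (-(t * B₀ * k)) * Real.exp (-s * ‖y‖ ^ 2) =
        Real.exp (-(t * B₀ * (k + α))) *
        Real.exp (-(B₀ * ‖x‖ ^ 2 * Real.cosh (t * B₀) / (4 * Real.sinh (t * B₀)))) *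
        Real.exp (-(flowDen B₀ s (t * B₀) / Real.sinh (t * B₀)) * ‖y‖ ^ 2) := by
      simp only [← Real.exp_add]
      congr 1
      rw [flowDen]
      field_simp
      ring
    have e3 : heatPrefactor α B₀ t ‖x‖ ‖y‖ * (Real.exp (-(t * B₀ * k)) *
          (besselI |(k : ℝ) + α| (B₀ * ‖x‖ * ‖y‖ / (2 * Real.sinh (t * B₀))) *
          (‖y‖ ^ |(k : ℝ) + α| * Real.exp (-s * ‖y‖ ^ 2)))) =
        B₀ / (4 * Real.pi * Real.sinh (t * B₀)) * Real.exp (-(t * B₀ * (k + α))) *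
        Real.exp (-(B₀ * ‖x‖ ^ 2 * Real.cosh (t * B₀) / (4 * Real.sinh (t * B₀)))) *
        (besselI ν (2 * (B₀ * ‖x‖ / (4 * Real.sinh (t * B₀)) * ‖y‖)) * (‖y‖ ^ ν *
          Real.exp (-(flowDen B₀ s (t * B₀) / Real.sinh (t * B₀)) * ‖y‖ ^ 2))) := by
      rw [heatPrefactor, e1]
      linear_combination (B₀ / (4 * Real.pi * Real.sinh (t * B₀)) *
        besselI ν (2 * (B₀ * ‖x‖ / (4 * Real.sinh (t * B₀)) * ‖y‖)) * ‖y‖ ^ ν) * e2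
    rw [h3, ← e3, sub_self]
    push_cast
    rw [mul_zero, zero_mul, Complex.exp_zero]
    ring
  simp only [h5]
  rw [integral_const_mul, integral_complex_ofReal, integral_const_mul,
    integral_besselI_mul_gaussian (abs_nonneg _) (by positivity) (by positivity), mode, gaussMono,
    pow_zero, one_mul, mul_left_comm (flowAmp ν (k + α) B₀ s t : ℂ), ← Complex.ofReal_mul,
    ← flow_identity hB hs ht (norm_nonneg x)]
  congr 2
  have := Real.pi_pos
  field_simp
  rw [hν]

/-! ### The kernel of the heat semigroup -/

/-- The functions f satisfying the identity form a closed subspace containing every Gaussian mode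
with n = 0. A vector orthogonal to all of these is zero, so the subspace is everything. -/
theorem semigroup_ae_eq_integral_heatKernel {α B₀ t : ℝ} (hB : 0 < B₀) (ht : 0 < t)
    {ι : Type*} (b : HilbertBasis ι ℂ L2Plane) (lam : ι → ℝ) (h0 : ∀ i, 0 ≤ lam i)
    (hb : ∀ i, (b i, (lam i : ℂ) • b i) ∈ hamiltonianGraph α B₀) (f : L2Plane) :
    b.semigroup lam h0 t f =ᵐ[volume] fun x => ∫ y, heatKernel α B₀ t x y * f y := by
  set V : Submodule ℂ L2Plane :=
    { carrier := {f | b.semigroup lam h0 t f =ᵐ[volume]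
        fun x => ∫ y, heatKernel α B₀ t x y * f y}
      add_mem' := by
        intro f g hf hg
        change _ =ᵐ[volume] _ at hf hg ⊢
        rw [map_add]
        filter_upwards [hf, hg, Lp.coeFn_add (b.semigroup lam h0 t f) (b.semigroup lam h0 t g)]
          with x h1 h2 h3
        rw [h3, Pi.add_apply, h1, h2, ← integral_add (integrable_heatKernel_mul hB ht x f)
          (integrable_heatKernel_mul hB ht x g)]
        refine integral_congr_ae ?_
        filter_upwards [Lp.coeFn_add f g] with y hy
        rw [hy, Pi.add_apply, mul_add]
      zero_mem' := by
        change _ =ᵐ[volume] _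
        rw [map_zero]
        filter_upwards [Lp.coeFn_zero ℂ 2 (volume : Measure Plane)] with x h1
        rw [h1, Pi.zero_apply, ← integral_zero Plane ℂ (μ := volume)]
        refine integral_congr_ae ?_
        filter_upwards [Lp.coeFn_zero ℂ 2 (volume : Measure Plane)] with y hy
        rw [hy, Pi.zero_apply, mul_zero]
      smul_mem' := by
        intro c f hf
        change _ =ᵐ[volume] _ at hf ⊢
        rw [map_smul]
        filter_upwards [hf, Lp.coeFn_smul c (b.semigroup lam h0 t f)] with x h1 h2
        rw [h2, Pi.smul_apply, h1, smul_eq_mul, ← integral_const_mul]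
        refine integral_congr_ae ?_
        filter_upwards [Lp.coeFn_smul c f] with y hy
        rw [hy, Pi.smul_apply, smul_eq_mul]
        ring } with hV
  have hVc : IsClosed (V : Set L2Plane) := by
    refine isClosed_of_closure_subset fun f hf => ?_
    obtain ⟨u, hu, huf⟩ := mem_closure_iff_seq_limit.1 hf
    have h1 : Tendsto (fun n => b.semigroup lam h0 t (u n)) atTop (𝓝 (b.semigroup lam h0 t f)) :=
      ((b.semigroup lam h0 t).continuous.tendsto f).comp huf
    obtain ⟨ns, hns, h2⟩ := (tendstoInMeasure_of_tendsto_Lp h1).exists_seq_tendsto_ae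
    have h3 : ∀ᵐ x, ∀ n, b.semigroup lam h0 t (u n) x = ∫ y, heatKernel α B₀ t x y * u n y :=
      ae_all_iff.2 fun n => hu n
    change _ =ᵐ[volume] _
    filter_upwards [h2, h3] with x h4 h5
    -- For each x the integral is an inner product with a fixed L² function, hence continuous in g;
    -- for the semigroup side, convergence almost everywhere along a subsequence suffices.
    have h6 : ∀ g : L2Plane, ∫ y, heatKernel α B₀ t x y * g y =
        inner ℂ ((memLp_heatKernel (α := α) hB ht x).star.toLp _) g := fun g => by
      rw [L2.inner_def]
      refine integral_congr_ae ?_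
      filter_upwards [(memLp_heatKernel (α := α) hB ht x).star.coeFn_toLp] with y hy
      rw [hy]
      simp [mul_comm]
    simp only [h5, h6] at h4
    rw [h6]
    refine tendsto_nhds_unique h4 ?_
    exact ((continuous_const.inner continuous_id).tendsto f).comp (huf.comp hns.tendsto_atTop)
  have hVg : ∀ (k : ℤ) (s : ℝ), 0 < s → gaussVec α k 0 s ∈ V := fun k s hs => by
    change _ =ᵐ[volume] _
    rw [semigroup_gaussVec hB b lam h0 hb k hs ht.le]
    filter_upwards [coeFn_gaussVec α k 0 (flowExp_pos hB hs ht.le),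
      Lp.coeFn_smul (flowAmp |(k : ℝ) + α| (k + α) B₀ s t : ℂ)
        (gaussVec α k 0 (flowExp B₀ s t))] with x h1 h2
    rw [h2, Pi.smul_apply, h1, smul_eq_mul, ← integral_heatKernel_mul_mode hB hs ht k x]
    refine integral_congr_ae ?_
    filter_upwards [coeFn_gaussVec α k 0 hs] with y hy
    rw [hy]
  have : CompleteSpace V := hVc.completeSpace_coe
  have hVt : V = ⊤ := by
    rw [← Submodule.orthogonal_eq_bot_iff, Submodule.eq_bot_iff]
    intro g hg
    exact eq_zero_of_inner_gaussVec_zero α g fun k s hs =>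
      (Submodule.mem_orthogonal' V g).1 hg _ (hVg k s hs)
  have : f ∈ V := hVt ▸ Submodule.mem_top
  exact this

/-! ### The heat semigroup -/

theorem mem_neg_hamiltonian_graph (α B₀ : ℝ) (u v : L2Plane) :
    (u, v) ∈ (-hamiltonian α B₀).graph ↔ (u, -v) ∈ hamiltonianGraph α B₀ := by
  rw [LinearPMap.neg_graph, hamiltonian_graph, Submodule.mem_map]
  constructor
  · rintro ⟨⟨a, c⟩, h, h1⟩
    simp only [LinearMap.prodMap_apply, LinearMap.id_coe, id, LinearMap.neg_apply,
      Prod.mk.injEq] at h1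
    rw [← h1.1, ← h1.2, neg_neg]
    exact h
  · exact fun h => ⟨(u, -v), h, by simp⟩

theorem exists_hamiltonian_eq (α B₀ : ℝ) {u v : L2Plane} (h : (u, v) ∈ hamiltonianGraph α B₀) :
    ∃ hu : u ∈ (hamiltonian α B₀).domain, hamiltonian α B₀ ⟨u, hu⟩ = v := by
  rw [← hamiltonian_graph, LinearPMap.mem_graph_iff] at h
  obtain ⟨⟨y, hy⟩, h1, h2⟩ := h
  obtain rfl : y = u := h1
  exact ⟨hy, h2⟩

theorem hamiltonian_mem_graph (α B₀ : ℝ) {u : L2Plane} (hu : u ∈ (hamiltonian α B₀).domain) :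
    (u, hamiltonian α B₀ ⟨u, hu⟩) ∈ hamiltonianGraph α B₀ := by
  rw [← hamiltonian_graph]
  exact LinearPMap.mem_graph _ ⟨u, hu⟩

theorem mainTheorem5 :
    (∀ α B₀ : ℝ, 0 < B₀ →
      ∃ S : ℝ → L2Plane →L[ℂ] L2Plane,
        IsSemigroupGeneratedBy (-hamiltonian α B₀) S ∧
        (∀ f : L2Plane, IsHeatSolution (hamiltonian α B₀) f (fun t => S t f) ∧
          ∀ u : ℝ → L2Plane, IsHeatSolution (hamiltonian α B₀) f u →
            ∀ t : ℝ, 0 ≤ t → u t = S t f) ∧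
        (∀ (t : ℝ), 0 < t → ∀ f : L2Plane,
          (∀ x : Plane, Integrable (fun y => heatKernel α B₀ t x y * f y) volume) ∧
          S t f =ᵐ[volume] fun x => ∫ y, heatKernel α B₀ t x y * f y) ∧
        (∀ t r₁ θ₁ r₂ θ₂ : ℝ, 0 < t → 0 < r₁ → 0 < r₂ →
          Summable (heatKernelTerm α B₀ t r₁ θ₁ r₂ θ₂) ∧
          heatKernel α B₀ t (polarPoint r₁ θ₁) (polarPoint r₂ θ₂) =
            heatKernelPolar α B₀ t r₁ θ₁ r₂ θ₂)) ∧
    (∃ C : ℝ, 0 < C ∧ ∀ α B₀ : ℝ, α ≤ 1 → 0 < B₀ → ∀ t : ℝ, 0 < t → ∀ x y : Plane,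
      ‖heatKernel α B₀ t x y‖ ≤
        C * (B₀ * Real.exp ((1 - α) * B₀ * t) / Real.sinh (t * B₀)) *
          Real.exp (-(B₀ * (‖x‖ - ‖y‖) ^ 2 / (4 * Real.tanh (t * B₀))))) := by
  refine ⟨fun α B₀ hB => ?_, 1, one_pos, fun α B₀ hα hB t ht x y => ?_⟩
  · obtain ⟨ι, b, lam, h0, hb⟩ := exists_hilbertBasis_hamiltonianGraph α hB
    have hmem : ∀ u v, (u, v) ∈ hamiltonianGraph α B₀ ↔ ∀ i, b.repr v i = lam i * b.repr u i :=
      mem_iff_repr_of_hilbertBasis (isClosed_hamiltonianGraph α B₀) (hamiltonianGraph_symm α B₀)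
        b lam hb
    refine ⟨b.semigroup lam h0, ⟨b.semigroup_zero lam h0, fun s t hs ht =>
      b.semigroup_add lam h0 hs ht, fun f => (b.continuous_semigroup lam h0 f).continuousOn,
      fun u v => ?_⟩, fun f => ⟨⟨?_, (b.continuous_semigroup lam h0 f).continuousOn, ?_⟩, ?_⟩,
      fun t ht f => ⟨fun x => integrable_heatKernel_mul hB ht x f,
        semigroup_ae_eq_integral_heatKernel hB ht b lam h0 hb f⟩,
      fun t r₁ θ₁ r₂ θ₂ ht h1 h2 =>
        ⟨(summable_norm_heatKernelTerm hB ht h1.le h2.le θ₁ θ₂).1.of_norm,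
        heatKernel_polarPoint α B₀ t θ₁ θ₂ h1 h2⟩⟩
    · rw [mem_neg_hamiltonian_graph, hmem]
      refine (forall_congr' fun i => ?_).trans (b.semigroup_generator lam h0 u v)
      rw [map_neg, lp.coeFn_neg, Pi.neg_apply, neg_eq_iff_eq_neg]
    · simp only [b.semigroup_zero lam h0, ContinuousLinearMap.id_apply]
    · intro t ht
      obtain ⟨v, hv, hd⟩ := b.exists_semigroup_deriv lam h0 ht f
      obtain ⟨hu, rfl⟩ := exists_hamiltonian_eq α B₀ ((hmem _ _).2 hv)
      exact ⟨hu, hd⟩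
    -- Uniqueness: each coordinate of an arbitrary solution solves a scalar linear equation with the
    -- same initial value.
    · intro u hu t ht
      refine b.ext_repr fun i => ?_
      set L : L2Plane →L[ℝ] ℂ := (innerSL ℂ (b i)).restrictScalars ℝ with hL
      have hLr : ∀ g, b.repr g i = L g := fun g => b.repr_apply_apply g i
      have hc : ContinuousOn (fun s => b.repr (u s) i) (Set.Ici 0) := by
        simp only [hLr]
        exact L.continuous.comp_continuousOn hu.continuousOn
      have hd : ∀ s > 0, HasDerivAt (fun s => b.repr (u s) i)
          (-((lam i : ℂ) * b.repr (u s) i)) s := fun s hs => by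
        obtain ⟨h1, h2⟩ := hu.equation s hs
        rw [← (hmem _ _).1 (hamiltonian_mem_graph α B₀ h1) i]
        simp only [hLr]
        rw [← map_neg]
        exact L.hasFDerivAt.comp_hasDerivAt s h2
      rw [eq_exp_mul_of_hasDerivAt hc hd ht, hu.initial, b.repr_semigroup lam h0 ht]
  · have hs : 0 < Real.sinh (t * B₀) := Real.sinh_pos_iff.2 (by positivity)
    refine (norm_heatKernelPolar_le hB ht (norm_nonneg x) (norm_nonneg y) _ _).trans ?_
    rw [one_mul]
    -- The only use of α ≤ 1: the exponent ⌈α⌉ - α of the general bound is then at most 1 - α, so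
    -- the constant C = 1 works.
    have h1 : (⌈α⌉ : ℝ) ≤ 1 := by exact_mod_cast Int.ceil_le.2 (by simpa using hα)
    have h2 : (1 - α) * B₀ * t = (1 - α) * (t * B₀) := by ring
    rw [h2]
    gcongr

end
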